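/- Let $n,m\ge 1$. Consider an annulus with the points $1,\dots,n$ in clockwise order on the exterior circle and $n+1,\dots,n+m$ in counterclockwise order on the interior circle. A permutation $\pi$ of $[n+m]$ is drawn by an arrow from $x$ to $\pi(x)$ for each $x$. It is *annular noncrossing* if it can be drawn in the annulus with every cycle oriented clockwise and without crossing arrows. Precisely, this means that after slitting the annulus along a curve from a gap of the exterior circle to a gap of the interior circle, $\pi$ is drawn in the resulting disk with noncrossing arrows and with every cycle clockwise; on the boundary of this disk the points lie in the clockwise order $a,a+1,\dots,n,1,\dots,a-1,\,b+1,\dots,n+m,n+1,\dots,b$ for some $a\in[n]$ and some $b\in\{n+1,\dots,n+m\}$. A cycle (fixed points included) is *exterior* (*interior*) if all its elements are on the exterior (interior) circle, and *connected* otherwise; the exterior (interior) size of a cycle is the number of its elements on the exterior (interior) circle. Let $\mathrm{Par}(k,\ell)$ be the set of partitions of $k$ with $\ell$ parts, and define: * $ANC(n,m)$: the annular noncrossing permutations with at least one connected cycle; * $ANC(n,m;c)$: those $\pi\in ANC(n,m)$ with exactly $c$ connected cycles; * $ANC(n,m;c,r,s)$: those $\pi\in ANC(n,m;c)$ with $r$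 exterior and $s$ interior cycles; * $ANC(n,m;c,r,s,R,S)$: those $\pi\in ANC(n,m;c,r,s)$ whose exterior cycles have total size $R$ and whose interior cycles have total size $S$; * $ANC(n,m;c,r,s,R,S;\alpha,\beta,\lambda,\mu)$, for $\alpha\in\mathrm{Par}(R,r)$, $\beta\in\mathrm{Par}(S,s)$, $\lambda\in\mathrm{Par}(n-R,c)$, $\mu\in\mathrm{Par}(m-S,c)$: those $\pi\in ANC(n,m)$ whose exterior cycles have sizes $\alpha$, whose interior cycles have sizes $\beta$, and whose connected cycles have exterior sizes $\lambda$ and interior sizes $\mu$ (as multisets). Let $g=\gcd(n,m)$, and let $C$ be the cyclic group generated by the rotation of the annulus by $2\pi/g$ clockwise, i.e. by the permutation $\rho$ of $[n+m]$ with $\rho(i)\equiv i+n/g \pmod n$ on $[n]$ and $\rho(n+j)=n+j'$ with $j'\equiv j-m/g\pmod m$ for $j,j'\in[m]$. It acts on permutations by conjugation, $\sigma\cdot\pi=\sigma\pi\sigma^{-1}$. Write $[k]_q=\frac{1-q^k}{1-q}$ and $[k]_q!=[1]_q\cdots[k]_q$. For $0\le b\le a$ let $\binom{a}{b}_q=\frac{[a]_q!}{[b]_q![a-b]_q!}$;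 put $\binom{-1}{-1}_q=1$ and let all other $\binom{a}{b}_q$ with $a\neq b$ be $0$. For a partition $\lambda$ with $k$ parts, $m_i$ of them equal to $i$, let $\binom{k}{\lambda}_q=\frac{[k]_q!}{[m_1]_q![m_2]_q!\cdots}$ and $\tau(\lambda)=\sum_{i\ge1}\lambda'_i\lambda'_{i+1}$, where $\lambda'$ is the transpose of $\lambda$. Put $$X=c(c-1),\quad Y=r(c+r)+s(c+s),\quad Z=r(n-c-R)+s(m-c-S),$$ $$W=r(R-r)+s(S-s)+c(n-R-c)+c(m-S-c)-\tau(\alpha)-\tau(\beta)-\tau(\lambda)-\tau(\mu),$$ $$\mathrm{Kre}=q^{X+Y+Z+W}\frac{[nm]_q}{[n]_q[m]_q}\frac{[2c]_q}{2}\frac{[n-R]_q[m-S]_q}{[c]_q^2}\binom nr_q\binom ms_q\binom r\alpha_q\binom s\beta_q\binom c\lambda_q\binom c\mu_q,$$ $$\mathrm{Nara}_1=q^{X+Y+Z}\frac{[nm]_q}{[n]_q[m]_q}\frac{[2c]_q}{2}\binom nr_q\binom ms_q\binom{R-1}{r-1}_q\binom{S-1}{s-1}_q\binom{n-R}c_q\binom{m-S}c_q,$$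 $$\mathrm{Nara}_2=q^{X+Y}\frac{[nm]_q}{[n]_q[m]_q}\frac{[2c]_q}{2}\binom nr_q\binom ms_q\binom n{r+c}_q\binom m{s+c}_q,$$ $$\mathrm{Nara}_3=q^{X}\frac{[nm]_q}{[n]_q[m]_q}\frac{[2c]_q}{2}\binom{2n}{n-c}_q\binom{2m}{m-c}_q,\qquad \mathrm{Cat}(n,m)=\frac{[nm]_q}{2[m+n]_q}\binom{2n}n_q\binom{2m}m_q.$$ A finite set $\mathcal X$ with an action of a finite cyclic group $C$ and a polynomial $P(q)\in\mathbb C[q]$ *exhibit the cyclic sieving phenomenon* if for every embedding $w:C\to\mathbb C^\times$ and every $\sigma\in C$ one has $P(w(\sigma))=|\{x\in\mathcal X:\sigma\cdot x=x\}|$. **Theorem.** Let $c,r,s,R,S\ge0$ be integers. Each of the five sets above is stable under $C$, each of the five rational functions above is a polynomial in $q$, and the following exhibit the cyclic sieving phenomenon: 1. $ANC(n,m;c,r,s,R,S;\alpha,\beta,\lambda,\mu)$ with $C$ and $\mathrm{Kre}$, for all $c\ge1$, $R\le n$, $S\le m$, $\alpha\in\mathrm{Par}(R,r)$, $\beta\in\mathrm{Par}(S,s)$,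 $\lambda\in\mathrm{Par}(n-R,c)$, $\mu\in\mathrm{Par}(m-S,c)$; 2. $ANC(n,m;c,r,s,R,S)$ with $C$ and $\mathrm{Nara}_1$; 3. $ANC(n,m;c,r,s)$ with $C$ and $\mathrm{Nara}_2$; 4. $ANC(n,m;c)$ with $C$ and $\mathrm{Nara}_3$; 5. $ANC(n,m)$ with $C$ and $\mathrm{Cat}(n,m)$. -/

import Mathlib

noncomputable section

namespace AnnularCSP

/-! ### Noncrossing permutations of a disk and of an annulus -/

/-- `N` points are placed clockwise on the boundary circle of a disk, and an arrow is drawn from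
`x` to `σ x` for every `x`. The permutation `σ` is noncrossing if every cycle is oriented clockwise
(no element of the cycle of `x` lies strictly between `x` and `σ x` in clockwise order) and no two
arrows cross (the tail and the head of one arrow never lie strictly on different sides of another).
Here `sbtw x y z` says that `x, y, z` are distinct and met in this order clockwise. -/
def IsDiskNoncrossing {N : ℕ} (σ : Equiv.Perm (Fin N)) : Prop :=
  (∀ x y, σ.SameCycle x y → ¬ sbtw x y (σ x)) ∧
  ∀ x y, ¬ (sbtw x y (σ x) ∧ sbtw (σ x) (σ y) x) ∧ ¬ (sbtw x (σ y) (σ x) ∧ sbtw (σ x) y x)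

/-- The points of the `(n,m)`-annulus. `Sum.inl i` is the exterior point with label `i + 1`
(labels increase clockwise on the exterior circle), `Sum.inr j` is the interior point with label
`n + j + 1` (labels increase counterclockwise on the interior circle). -/
abbrev Pt (n m : ℕ) : Type := Fin n ⊕ Fin m

/-- Slit the annulus by a curve that joins a gap of the exterior circle to a gap of the interior
circle. The result is a disk; going clockwise along its boundary one meets the exterior points,
cyclically in their order and starting just after the slit, and then the interior points,
cyclically in their order and starting just after the slit. The numbers `a` and `b` determine the
two gaps, and the value at a point is its place in this order. -/
def slit (n m a b : ℕ) : Pt n m ≃ Fin (n + m) :=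
  (Equiv.sumCongr (finRotate n ^ a) (finRotate m ^ b)).trans finSumFinEquiv

/-- `π` can be drawn in the annulus with all cycles oriented clockwise and without crossing arrows:
for some slit, it is drawn in this way in the disk which is left after slitting. (In a drawing
with a connected cycle one may slit alongside an arrow from the interior to the exterior circle;
conversely, a drawing in the slit annulus is a drawing in the annulus.) -/
def IsAnnularNoncrossing {n m : ℕ} (π : Equiv.Perm (Pt n m)) : Prop :=
  ∃ a b : ℕ, IsDiskNoncrossing ((slit n m a b).permCongr π)

/-! ### Cycles and cycle types -/

/-- The underlying sets of all cycles of `π`, fixed points included. -/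
def cycles {n m : ℕ} (π : Equiv.Perm (Pt n m)) : Finset (Finset (Pt n m)) :=
  Finset.univ.image fun x => Finset.univ.filter fun y => π.SameCycle x y

/-- The cycles all of whose elements are exterior. -/
def extCycles {n m : ℕ} (π : Equiv.Perm (Pt n m)) : Finset (Finset (Pt n m)) :=
  (cycles π).filter fun B => B.toRight = ∅

/-- The cycles all of whose elements are interior. -/
def intCycles {n m : ℕ} (π : Equiv.Perm (Pt n m)) : Finset (Finset (Pt n m)) :=
  (cycles π).filter fun B => B.toLeft = ∅

/-- The connected cycles: those with an exterior and an interior element. -/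
def connCycles {n m : ℕ} (π : Equiv.Perm (Pt n m)) : Finset (Finset (Pt n m)) :=
  (cycles π).filter fun B => B.toLeft.Nonempty ∧ B.toRight.Nonempty

/-- Exterior cycle type: the multiset of sizes of the exterior cycles. -/
def extType {n m : ℕ} (π : Equiv.Perm (Pt n m)) : Multiset ℕ :=
  (extCycles π).val.map Finset.card

/-- Interior cycle type: the multiset of sizes of the interior cycles. -/
def intType {n m : ℕ} (π : Equiv.Perm (Pt n m)) : Multiset ℕ :=
  (intCycles π).val.map Finset.card

/-- Connected exterior cycle type: the multiset of exterior sizes of the connected cycles. -/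
def connExtType {n m : ℕ} (π : Equiv.Perm (Pt n m)) : Multiset ℕ :=
  (connCycles π).val.map fun B => B.toLeft.card

/-- Connected interior cycle type: the multiset of interior sizes of the connected cycles. -/
def connIntType {n m : ℕ} (π : Equiv.Perm (Pt n m)) : Multiset ℕ :=
  (connCycles π).val.map fun B => B.toRight.card

/-! ### The sets of connected annular noncrossing permutations -/

/-- `ANC(n,m)`. -/
def ANC (n m : ℕ) : Set (Equiv.Perm (Pt n m)) :=
  {π | IsAnnularNoncrossing π ∧ (connCycles π).Nonempty}

/-- `ANC(n,m;c)`. -/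
def ANC₃ (n m c : ℕ) : Set (Equiv.Perm (Pt n m)) :=
  {π | π ∈ ANC n m ∧ (connCycles π).card = c}

/-- `ANC(n,m;c,r,s)`. -/
def ANC₂ (n m c r s : ℕ) : Set (Equiv.Perm (Pt n m)) :=
  {π | π ∈ ANC₃ n m c ∧ (extCycles π).card = r ∧ (intCycles π).card = s}

/-- `ANC(n,m;c,r,s,R,S)`. -/
def ANC₁ (n m c r s R S : ℕ) : Set (Equiv.Perm (Pt n m)) :=
  {π | π ∈ ANC₂ n m c r s ∧
    ∑ B ∈ extCycles π, B.card = R ∧ ∑ B ∈ intCycles π, B.card = S}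

/-- `ANC(n,m;c,r,s,R,S;α,β,lam,mu)`; the numbers `c,r,s` are the numbers of parts of the
partitions. -/
def ANCtype (n m : ℕ) {R S : ℕ} (α : R.Partition) (β : S.Partition)
    (lam : (n - R).Partition) (mu : (m - S).Partition) : Set (Equiv.Perm (Pt n m)) :=
  {π | π ∈ ANC n m ∧ extType π = α.parts ∧ intType π = β.parts ∧
    connExtType π = lam.parts ∧ connIntType π = mu.parts}

/-! ### Annular rotations -/

/-- The rotation of the whole annulus clockwise by the angle `2π / gcd(n,m)`. Exterior labels
increase by `n / gcd(n,m)` modulo `n`, and interior labels decrease by `m / gcd(n,m)` modulo `m`. -/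
def annularRotation (n m : ℕ) : Equiv.Perm (Pt n m) :=
  Equiv.sumCongr (finRotate n ^ (n / n.gcd m)) (finRotate m ^ (m / n.gcd m))⁻¹

/-- The cyclic group of `(n,m)`-annular rotations, acting on permutations of the points by
relabelling their cycles, that is, by conjugation. -/
def rotationGroup (n m : ℕ) : Subgroup (ConjAct (Equiv.Perm (Pt n m))) :=
  Subgroup.zpowers (ConjAct.toConjAct (annularRotation n m))

/-! ### The cyclic sieving phenomenon -/

/-- The cyclic sieving phenomenon for a finite cyclic group `C` acting on a finite set `X` (a stable
subset of a `C`-set) and a rational function `f` of `q`: the function `f` is a polynomial, and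
for every embedding `w` of `C` into the multiplicative group of the complex numbers, the value of
this polynomial at `w c` is the number of elements of `X` that are fixed by `c`. -/
structure ExhibitsCSP (C : Type*) [Group C] {A : Type*} [MulAction C A] (X : Set A)
    (f : RatFunc ℂ) : Prop where
  isCyclic : IsCyclic C
  finite_group : Finite C
  finite_set : X.Finite
  stable : ∀ c : C, ∀ x ∈ X, c • x ∈ X
  sieving : ∃ P : Polynomial ℂ, algebraMap (Polynomial ℂ) (RatFunc ℂ) P = f ∧
    ∀ w : C →* ℂˣ, Function.Injective w → ∀ c : C,
      P.eval (w c : ℂ) = ({x | x ∈ X ∧ c • x = x}.ncard : ℂ)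

/-! ### The `q`-analogues, as rational functions of `q` -/

/-- The variable `q`. -/
def q : RatFunc ℂ := RatFunc.X

/-- `[k]_q = (1 - q^k) / (1 - q)`. -/
def qNum (k : ℕ) : RatFunc ℂ := (1 - q ^ k) / (1 - q)

/-- `[k]_q! = [1]_q [2]_q ⋯ [k]_q`. -/
def qFact (k : ℕ) : RatFunc ℂ := ∏ i ∈ Finset.range k, qNum (i + 1)

/-- The `q`-binomial coefficient `[a choose b]_q` for integers `a`, `b`. It is `1` if `a = b`
(also for `a = b = -1`), and otherwise `0` unless `0 ≤ b ≤ a`. -/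
def qBinom (a b : ℤ) : RatFunc ℂ :=
  if a = b then 1
  else if 0 ≤ b ∧ b ≤ a then
    qFact a.toNat / (qFact b.toNat * qFact (a - b).toNat)
  else 0

/-- `[k choose lam]_q = [k]_q! / ([m_1]_q! [m_2]_q! ⋯)`, where `m_i` is the number of parts of `lam`
that are equal to `i`. -/
def qMultinom (k : ℕ) (lam : Multiset ℕ) : RatFunc ℂ :=
  qFact k / ∏ i ∈ lam.toFinset, qFact (lam.count i)

/-- The `i`-th part of the transpose of `lam`: the number of parts of `lam` of size at least `i`. -/
def transposePart (lam : Multiset ℕ) (i : ℕ) : ℕ := lam.countP fun x => i ≤ x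

/-- `τ(lam) = ∑_{i ≥ 1} lam'_i lam'_{i+1}`, with `lam'` the transpose of `lam` (the terms with
`i` larger than the sum of all parts vanish). -/
def tau (lam : Multiset ℕ) : ℕ :=
  ∑ i ∈ Finset.Icc 1 lam.sum, transposePart lam i * transposePart lam (i + 1)

def expX (c : ℤ) : ℤ := c * (c - 1)

def expY (c r s : ℤ) : ℤ := r * (c + r) + s * (c + s)

def expZ (n m c r s R S : ℤ) : ℤ := r * (n - c - R) + s * (m - c - S)

def expW (n m c r s R S : ℤ) (α β lam mu : Multiset ℕ) : ℤ :=
  r * (R - r) + s * (S - s) + c * (n - R - c) + c * (m - S - c)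
    - tau α - tau β - tau lam - tau mu

/-- The annular `q`-Kreweras number. -/
def Kre (n m c r s R S : ℕ) (α β lam mu : Multiset ℕ) : RatFunc ℂ :=
  q ^ expX c * q ^ expY c r s * q ^ expZ n m c r s R S * q ^ expW n m c r s R S α β lam mu *
    (qNum (n * m) / (qNum n * qNum m)) * (qNum (2 * c) / 2) *
    (qNum (n - R) * qNum (m - S) / qNum c ^ 2) * qBinom n r * qBinom m s *
    qMultinom r α * qMultinom s β * qMultinom c lam * qMultinom c mu

/-- The annular `q`-Narayana number of type `1`. -/
def Nara₁ (n m c r s R S : ℕ) : RatFunc ℂ :=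
  q ^ expX c * q ^ expY c r s * q ^ expZ n m c r s R S *
    (qNum (n * m) / (qNum n * qNum m)) * (qNum (2 * c) / 2) * qBinom n r * qBinom m s *
    qBinom (R - 1) (r - 1) * qBinom (S - 1) (s - 1) * qBinom (n - R) c * qBinom (m - S) c

/-- The annular `q`-Narayana number of type `2`. -/
def Nara₂ (n m c r s : ℕ) : RatFunc ℂ :=
  q ^ expX c * q ^ expY c r s *
    (qNum (n * m) / (qNum n * qNum m)) * (qNum (2 * c) / 2) * qBinom n r * qBinom m s *
    qBinom n (r + c) * qBinom m (s + c)

/-- The annular `q`-Narayana number of type `3`. -/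
def Nara₃ (n m c : ℕ) : RatFunc ℂ :=
  q ^ expX c * (qNum (n * m) / (qNum n * qNum m)) * (qNum (2 * c) / 2) *
    qBinom (2 * n) (n - c) * qBinom (2 * m) (m - c)

/-- The annular `q`-Catalan number. -/
def Cat (n m : ℕ) : RatFunc ℂ :=
  qNum (n * m) / (2 * qNum (m + n)) * qBinom (2 * n) n * qBinom (2 * m) m

end AnnularCSP

end

open AnnularCSP

/-!
The permutations are counted through lattice words, and the rational functions are evaluated at a
root of unity through their order and leading coefficient there. The two computations agree.

**From permutations to words.** For a permutation drawn in a disk, the arrows do not cross and all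
cycles are clockwise if and only if each cycle runs through its elements in clockwise order and the
cycles are the blocks of a noncrossing partition (`isDiskNoncrossing_iff`). An annular noncrossing
permutation with a connected cycle can be slit next to any of its connected cycles, in only one way
(`exists_isRooted_turn`), so that both sides of the slit start with an element of that cycle. On
each circle, the block sizes recorded at the first elements of the blocks then form a Łukasiewicz
word, with the letters of the connected cycles marked; the marked letters sit at height zero and
the first letter is one of them (`IsRootedWord`). Conversely, any two such words with equally many
marks are glued to exactly one permutation (`exists_isRooted`, `Noncrossing.eq_of_words`), because
the connected cycles meet the two circles in opposite orders.

A permutation with `c` connected cycles on circles with `n = d k` and `m = d l` points is fixed by the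
rotation by `2π / d` if and only if both of its words are `d`-fold repetitions. Choosing one of the
`c` connected cycles and the place of the slit gives `c * #fixed = n * m * #words * #words`
(`card_fixedSet`), where the words are those of lengths `k` and `l` with `c / d` marks. There are
none if `d` does not divide `c`.

**Counting words.** Replacing the marked letters by zeros leaves a word that begins with a zero and
whose path ends at its minimum, and the removed letters are an arbitrary sequence of positive numbers
(`ncard_rootedWords`). The words that are left are counted by the cycle lemma (`cycle_lemma`). Words with
prescribed letters are counted by multinomial coefficients (`ncard_rooted_types`), those
with a prescribed number and sum of unmarked letters by products of binomial coefficients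
(`ncard_rooted_card_sum`), which are then summed over the sum of the letters (`ncard_rooted_card`)
and over their number (`ncard_rooted`). The sum over `c` which gives all annular
noncrossing permutations telescopes (`sum_mul_choose_mul_choose`).

**Roots of unity.** `HasLead ζ f v a` says that the rational function `f` has order `v` and leading
coefficient `a` at `ζ`. A function of nonnegative order everywhere is a polynomial
(`exists_polynomial_of_hasLead`). The rational functions, apart from the one summed over all `c`, are
the product of a power of `q`, a common factor `qBase` and one factor for each circle. At a root of
unity of order `d` dividing the number of points, the factor of a circle with `n` points
either has the value `n / c` times the count of `d`-periodic words or vanishes together with that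
count (`IsSide`); this is proved in
`isSide_types`, `isSide_card_sum`, `isSide_card` and `isSide_conn`. The order of `qBase` is at least
`-1`, and it is negative only where `d` divides `n` and `m` but not `c`, where the factors of both
circles vanish. Hence the product is a polynomial with the required values
(`exists_polynomial_of_isSide`).

**The group.** An element of order `d` of the rotation group has the same fixed points as the rotation
by `2π / d`, and an embedding into `ℂˣ` sends it to a root of unity of order `d`, so the values
at roots of unity are what cyclic sieving asks for (`smul_eq_iff_turn`, `exhibitsCSP_of_eval`).
-/


noncomputable section
namespace AnnularCSP

open Equiv

/-! ### Noncrossing permutations and noncrossing partitions -/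

/-- `b` lies strictly between `a` and `c` in clockwise order. -/
def CircLt (a b c : ℕ) : Prop := a < b ∧ b < c ∨ b < c ∧ c < a ∨ c < a ∧ a < b

/-- The cycles of `π` are oriented clockwise, for the circular order of the positions `pos`. -/
def Clockwise {X : Type*} (pos : X → ℕ) (π : Perm X) : Prop :=
  ∀ x y, π.SameCycle x y → ¬ CircLt (pos x) (pos y) (pos (π x))

/-- The cycles of `π` are the blocks of a noncrossing partition, for the positions `pos`. -/
def BlocksNoncrossing {X : Type*} (pos : X → ℕ) (π : Perm X) : Prop :=
  ∀ x y z w, pos x < pos y → pos y < pos z → pos z < pos w →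
    π.SameCycle x z → π.SameCycle y w → π.SameCycle x y

/-- Noncrossing permutations of points at the positions `pos`, described by their cycles. -/
structure Noncrossing {X : Type*} (pos : X → ℕ) (π : Perm X) : Prop where
  clockwise : Clockwise pos π
  blocks : BlocksNoncrossing pos π

section general
variable {X : Type*} {pos : X → ℕ} {π : Perm X}

lemma sameCycle_apply_self (π : Perm X) (x : X) : π.SameCycle x (π x) := ⟨1, by simp⟩

lemma Clockwise.lt_apply (hpos : Function.Injective pos) (h : Clockwise pos π) {x y : X}
    (hxy : π.SameCycle x y) (hlt : pos x < pos y) : pos x < pos (π x) ∧ pos (π x) ≤ pos y := by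
  have h1 := h x y hxy
  have hne : π x ≠ x := by
    intro he
    obtain ⟨k, rfl⟩ := hxy
    have : (π ^ k) x = x := Equiv.Perm.zpow_apply_eq_self_of_apply_eq_self he k
    rw [this] at hlt
    exact lt_irrefl _ hlt
  have hne' : pos (π x) ≠ pos x := fun he => hne (hpos he)
  unfold CircLt at h1
  omega

lemma Clockwise.apply_le_of_isMax (hpos : Function.Injective pos) (h : Clockwise pos π) {x : X}
    (hmax : ∀ y, π.SameCycle x y → pos y ≤ pos x) {y : X} (hxy : π.SameCycle x y) :
    pos (π x) ≤ pos y := by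
  have h1 := h x y hxy
  have h2 := hmax y hxy
  have h3 := hmax (π x) (sameCycle_apply_self π x)
  by_cases he : π x = x
  · obtain ⟨k, rfl⟩ := hxy
    rw [Equiv.Perm.zpow_apply_eq_self_of_apply_eq_self he k, he]
  · have hne' : pos (π x) ≠ pos x := fun he' => he (hpos he')
    unfold CircLt at h1
    omega

/-- A clockwise permutation is determined by its cycles. -/
lemma Clockwise.eq_of_sameCycle_iff (hpos : Function.Injective pos) {π' : Perm X}
    (h : Clockwise pos π) (h' : Clockwise pos π')
    (hs : ∀ x y, π.SameCycle x y ↔ π'.SameCycle x y) : π = π' := by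
  have fixed : ∀ (σ : Perm X) (x y : X), σ.SameCycle x y → σ x = x → y = x := by
    rintro σ x y ⟨k, rfl⟩ he
    exact Equiv.Perm.zpow_apply_eq_self_of_apply_eq_self he k
  ext x
  by_contra hne
  have e1 : π'.SameCycle x (π x) := (hs _ _).1 (sameCycle_apply_self π x)
  have e2 : π.SameCycle x (π' x) := (hs _ _).2 (sameCycle_apply_self π' x)
  have n1 : π x ≠ x := fun he => hne (he.trans (fixed π x _ e2 he).symm)
  have n2 : π' x ≠ x := fun he => hne ((fixed π' x _ e1 he).trans he.symm)
  have h1 := h x _ e2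
  have h2 := h' x _ e1
  have n3 : pos (π x) ≠ pos (π' x) := fun he => hne (hpos he)
  have n1' : pos (π x) ≠ pos x := fun he => n1 (hpos he)
  have n2' : pos (π' x) ≠ pos x := fun he => n2 (hpos he)
  unfold CircLt at h1 h2
  omega

/-- Every partition of a finite set of positions is the partition into cycles of a clockwise
permutation. -/
lemma exists_clockwise [Finite X] (hpos : Function.Injective pos) {ι : Type*} (p : X → ι) :
    ∃ π : Perm X, Clockwise pos π ∧ ∀ x y, π.SameCycle x y ↔ p x = p y := by
  classical
  cases nonempty_fintype X
  have key : ∀ x, ∃ z, p z = p x ∧ (∀ y, p y = p x → ¬ CircLt (pos x) (pos y) (pos z)) ∧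
      (z = x → ∀ y, p y = p x → y = x) := by
    intro x
    by_cases hx : ∃ y, p y = p x ∧ y ≠ x
    · obtain ⟨y₀, hy₀⟩ := hx
      let M := (Finset.univ.sup pos) + 1
      have hM : ∀ y, pos y < M := fun y =>
        Nat.lt_succ_of_le (Finset.le_sup (f := pos) (Finset.mem_univ y))
      -- the next element minimizes the clockwise distance from `x`
      obtain ⟨z, hz, hmin⟩ := Finset.exists_min_image
        (Finset.univ.filter fun y => p y = p x ∧ y ≠ x)
        (fun y => if pos x < pos y then pos y - pos x else pos y + M - pos x)
        ⟨y₀, by simpa using hy₀⟩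
      simp only [Finset.mem_filter, Finset.mem_univ, true_and] at hz hmin
      refine ⟨z, hz.1, ?_, fun h => absurd h hz.2⟩
      intro y hy hc
      have hyx : y ≠ x := by
        rintro rfl
        unfold CircLt at hc
        omega
      have h1 := hmin y ⟨hy, hyx⟩
      have h2 := hM y
      have h3 := hM z
      have h4 := hM x
      have h5 : pos y ≠ pos x := fun h => hyx (hpos h)
      have h6 : pos z ≠ pos x := fun h => hz.2 (hpos h)
      unfold CircLt at hc
      split_ifs at h1 <;> omega
    · push Not at hx
      refine ⟨x, rfl, ?_, fun _ y hy => hx y hy⟩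
      intro y hy
      rw [hx y hy]
      unfold CircLt
      omega
  choose σ hσp hσc hσf using key
  have hinj : Function.Injective σ := by
    intro x x' he
    by_contra hne
    have hp : p x = p x' := by rw [← hσp x, he, hσp x']
    have h1 := hσc x x' hp.symm
    have h2 := hσc x' x hp
    have n1 : pos (σ x) ≠ pos x := fun h => hne (hσf x (hpos h) x' hp.symm).symm
    have n2 : pos (σ x') ≠ pos x' := fun h => hne (hσf x' (hpos h) x hp)
    have n3 : pos x ≠ pos x' := fun h => hne (hpos h)
    rw [he] at h1 n1
    unfold CircLt at h1 h2
    omega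
  let π : Perm X := Equiv.ofBijective σ (Finite.injective_iff_bijective.1 hinj)
  have hπ : ∀ x, π x = σ x := fun x => rfl
  have himp : ∀ x y, π.SameCycle x y → p x = p y := by
    intro x y hxy
    obtain ⟨k, rfl⟩ := hxy.exists_nat_pow_eq
    induction k with
    | zero => rfl
    | succ k ih =>
      rw [pow_succ', Perm.mul_apply, hπ, hσp]
      exact ih ⟨k, by simp⟩
  refine ⟨π, fun x y hxy => hσc x y (himp x y hxy).symm, fun x y => ⟨himp x y, fun hxy => ?_⟩⟩
  -- every element of a block is reached from the least one
  obtain ⟨m, hm, hmin⟩ := Finset.exists_min_image (Finset.univ.filter fun y => p y = p x) pos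
    ⟨x, by simp⟩
  simp only [Finset.mem_filter, Finset.mem_univ, true_and] at hm hmin
  have reach : ∀ (k : ℕ) (y : X), pos y = k → p y = p x → π.SameCycle m y := by
    intro k
    induction k using Nat.strong_induction_on with
    | _ k ih =>
      intro y hk hy
      by_cases hym : y = m
      · rw [hym]
      have hlt : pos m < pos y := lt_of_le_of_ne (hmin y hy) fun h => hym (hpos h).symm
      obtain ⟨u, hu, hmax⟩ := Finset.exists_max_image
        (Finset.univ.filter fun u => p u = p x ∧ pos u < pos y) pos ⟨m, by simp [hm, hlt]⟩
      simp only [Finset.mem_filter, Finset.mem_univ, true_and] at hu hmax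
      have hmu := ih (pos u) (by omega) u rfl hu.1
      have h1 := hσc u y (hy.trans hu.1.symm)
      have h2 : pos (σ u) ≠ pos u := fun h => by
        have := hσf u (hpos h) y (hy.trans hu.1.symm)
        rw [this] at hu
        exact lt_irrefl _ hu.2
      have h3 : ¬ (pos (σ u) < pos y ∧ pos u < pos (σ u)) := fun h => by
        have := hmax (σ u) ⟨(hσp u).trans hu.1, h.1⟩
        omega
      have h4 : σ u = y := by
        apply hpos
        unfold CircLt at h1
        omega
      exact hmu.trans (h4 ▸ sameCycle_apply_self π u)
  exact (reach _ x rfl rfl).symm.trans (reach _ y rfl hxy.symm)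

/-- Arrows of a clockwise permutation do not cross if and only if its blocks do not cross. -/
lemma isDiskNoncrossing_iff {N : ℕ} (σ : Perm (Fin N)) :
    IsDiskNoncrossing σ ↔ Noncrossing (fun x : Fin N => (x : ℕ)) σ := by
  have hpos : Function.Injective (fun x : Fin N => (x : ℕ)) := Fin.val_injective
  have hs : ∀ a b c : Fin N, sbtw a b c ↔ CircLt a b c := fun a b c => Iff.rfl
  constructor
  · rintro ⟨h1, h2⟩
    have hcl : Clockwise (fun x : Fin N => (x : ℕ)) σ := fun x y hxy => h1 x y hxy
    refine ⟨hcl, ?_⟩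
    intro x y z w hxy hyz hzw hxz hyw
    by_contra hne
    -- `u` is the last element of the first block before `y`, and `v` the last element of the
    -- second block before `σ u`; the arrows at `u` and `v` cross
    obtain ⟨u, hu, humax⟩ := Finset.exists_max_image
      (Finset.univ.filter fun u => σ.SameCycle x u ∧ u < y) (fun u : Fin N => (u : ℕ))
      ⟨x, by simpa [Perm.SameCycle.refl] using hxy⟩
    simp only [Finset.mem_filter, Finset.mem_univ, true_and] at hu humax
    have huz : (u : ℕ) < z := lt_trans hu.2 hyz
    obtain ⟨a1, a2⟩ := hcl.lt_apply hpos (hu.1.symm.trans hxz) huz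
    have hσu : σ.SameCycle x (σ u) := hu.1.trans (sameCycle_apply_self σ u)
    have a3 : (y : ℕ) < σ u := by
      by_contra hcon
      rcases (not_lt.1 hcon).lt_or_eq with h | h
      · have := humax (σ u) ⟨hσu, h⟩
        omega
      · exact hne (by have : σ u = y := Fin.ext h
                      rwa [this] at hσu)
    obtain ⟨v, hv, hvmax⟩ := Finset.exists_max_image
      (Finset.univ.filter fun v => σ.SameCycle y v ∧ v < σ u) (fun u : Fin N => (u : ℕ))
      ⟨y, by simpa [Perm.SameCycle.refl] using a3⟩
    simp only [Finset.mem_filter, Finset.mem_univ, true_and] at hv hvmax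
    have hyv := hvmax y ⟨Perm.SameCycle.refl _ _, a3⟩
    have hvw : (v : ℕ) < w := by
      have h1 : (v : ℕ) < σ u := hv.2
      have h2 : (z : ℕ) < w := hzw
      omega
    obtain ⟨b1, b2⟩ := hcl.lt_apply hpos (hv.1.symm.trans hyw) hvw
    have hσv : σ.SameCycle y (σ v) := hv.1.trans (sameCycle_apply_self σ v)
    have b3 : ((σ u : Fin N) : ℕ) < σ v := by
      by_contra hcon
      rcases (not_lt.1 hcon).lt_or_eq with h | h
      · have := hvmax (σ v) ⟨hσv, h⟩
        omega
      · have : σ v = σ u := Fin.ext h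
        rw [this] at hσv
        exact hne (hσu.trans hσv.symm)
    have hv2 : (v : ℕ) < σ u := hv.2
    have hu2 : (u : ℕ) < y := hu.2
    refine (h2 u v).1 ⟨?_, ?_⟩
    · rw [hs]; unfold CircLt; omega
    · rw [hs]; unfold CircLt; omega
  · rintro ⟨hcl, hb⟩
    refine ⟨fun x y hxy => hcl x y hxy, fun x y => ?_⟩
    have sx := sameCycle_apply_self σ x
    have sy := sameCycle_apply_self σ y
    have cross : ∀ x y z w : Fin N, CircLt x y z → CircLt z w x → σ.SameCycle x z →
        σ.SameCycle y w → σ.SameCycle x y := by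
      intro x y z w h1 h2 hxz hyw
      unfold CircLt at h1 h2
      by_cases c1 : (x : ℕ) < y ∧ (y : ℕ) < z ∧ (z : ℕ) < w
      · exact hb x y z w c1.1 c1.2.1 c1.2.2 hxz hyw
      by_cases c2 : (y : ℕ) < z ∧ (z : ℕ) < w ∧ (w : ℕ) < x
      · exact hxz.trans (hb y z w x c2.1 c2.2.1 c2.2.2 hyw hxz.symm).symm
      by_cases c3 : (z : ℕ) < w ∧ (w : ℕ) < x ∧ (x : ℕ) < y
      · exact hxz.trans ((hb z w x y c3.1 c3.2.1 c3.2.2 hxz.symm hyw.symm).trans hyw.symm)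
      have c4 : (w : ℕ) < x ∧ (x : ℕ) < y ∧ (y : ℕ) < z := by omega
      exact (hyw.trans (hb w x y z c4.1 c4.2.1 c4.2.2 hyw.symm hxz)).symm
    constructor
    · rintro ⟨h1, h2⟩
      have h3 := cross x y (σ x) (σ y) h1 h2 sx sy
      exact hcl x y h3 h1
    · rintro ⟨h1, h2⟩
      have h3 := cross x (σ y) (σ x) y h1 h2 sx sy.symm
      have h4 := hcl x (σ y) h3
      exact h4 h1

lemma noncrossing_permCongr_iff {Y : Type*} (e : X ≃ Y) (pos : Y → ℕ) (π : Perm X) :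
    Noncrossing pos (e.permCongr π) ↔ Noncrossing (fun x => pos (e x)) π := by
  have hs : ∀ x y, (e.permCongr π).SameCycle (e x) (e y) ↔ π.SameCycle x y := by
    intro x y
    have : e.permCongr π = (Equiv.permCongrHom e) π := rfl
    simp only [Perm.SameCycle, this, ← map_zpow]
    simp [Equiv.permCongrHom]
  constructor
  · rintro ⟨h1, h2⟩
    refine ⟨fun x y hxy => ?_, fun x y z w a b c hxz hyw => ?_⟩
    · have := h1 (e x) (e y) ((hs _ _).2 hxy)
      simpa using this
    · exact (hs _ _).1 (h2 _ _ _ _ a b c ((hs _ _).2 hxz) ((hs _ _).2 hyw))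
  · rintro ⟨h1, h2⟩
    refine ⟨fun x y hxy => ?_, fun x y z w a b c hxz hyw => ?_⟩
    · obtain ⟨x, rfl⟩ := e.surjective x
      obtain ⟨y, rfl⟩ := e.surjective y
      have := h1 x y ((hs _ _).1 hxy)
      simpa using this
    · obtain ⟨x, rfl⟩ := e.surjective x
      obtain ⟨y, rfl⟩ := e.surjective y
      obtain ⟨z, rfl⟩ := e.surjective z
      obtain ⟨w, rfl⟩ := e.surjective w
      exact (hs _ _).2 (h2 _ _ _ _ a b c ((hs _ _).1 hxz) ((hs _ _).1 hyw))

end general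
end AnnularCSP
end

noncomputable section
namespace AnnularCSP

open Equiv

/-! ### Łukasiewicz words and noncrossing partitions of a line -/

section words
variable {n : ℕ}

/-- The height before position `x` of the lattice path with step `F i - 1` at the position `i`. -/
def height (F : Fin n → ℕ) (x : ℕ) : ℤ :=
  (∑ i ∈ Finset.univ.filter (fun i : Fin n => (i : ℕ) < x), (F i : ℤ)) - x

lemma height_zero (F : Fin n → ℕ) : height F 0 = 0 := by simp [height]

lemma height_succ (F : Fin n → ℕ) (x : Fin n) :
    height F ((x : ℕ) + 1) = height F x + F x - 1 := by
  have : (Finset.univ.filter fun i : Fin n => (i : ℕ) < x + 1) =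
      insert x (Finset.univ.filter fun i : Fin n => (i : ℕ) < x) := by
    ext i
    simp only [Finset.mem_filter, Finset.mem_univ, true_and, Finset.mem_insert, Fin.ext_iff]
    omega
  unfold height
  rw [this, Finset.sum_insert (by simp)]
  push_cast
  ring

lemma height_last (F : Fin n → ℕ) : height F n = ∑ i, (F i : ℤ) - n := by
  have : (Finset.univ.filter fun i : Fin n => (i : ℕ) < n) = Finset.univ := by
    ext i; simp
  rw [height, this]

/-- The path never goes below its starting level and returns to it at the end: the letters of
the word `F` are the block sizes of a noncrossing partition, recorded at the least elements. -/
structure IsLukasiewicz (F : Fin n → ℕ) : Prop where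
  nonneg : ∀ x ≤ n, 0 ≤ height F x
  last : height F n = 0

/-- The least element of the block of `x`: the last position `y ≤ x` such that the path does not
start above its level after `x`. -/
def blockStart (F : Fin n → ℕ) (x : Fin n) : Fin n :=
  if h : (Finset.univ.filter fun y : Fin n => y ≤ x ∧ height F y ≤ height F ((x : ℕ) + 1)).Nonempty
  then Finset.max' _ h else x

lemma IsLukasiewicz.blockStart_spec {F : Fin n → ℕ} (hF : IsLukasiewicz F) (x : Fin n) :
    (blockStart F x ≤ x ∧ height F (blockStart F x) ≤ height F ((x : ℕ) + 1)) ∧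
      ∀ t : Fin n, blockStart F x < t → t ≤ x → height F ((x : ℕ) + 1) < height F t := by
  have h : (Finset.univ.filter fun y : Fin n =>
      y ≤ x ∧ height F y ≤ height F ((x : ℕ) + 1)).Nonempty := by
    refine ⟨⟨0, x.pos⟩, ?_⟩
    simp only [Finset.mem_filter, Finset.mem_univ, true_and, height_zero]
    exact ⟨Nat.zero_le _, hF.nonneg _ x.2⟩
  rw [blockStart, dif_pos h]
  have h1 := Finset.max'_mem _ h
  simp only [Finset.mem_filter, Finset.mem_univ, true_and] at h1
  refine ⟨h1, fun t ht htx => ?_⟩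
  by_contra hcon
  have := Finset.le_max' (Finset.univ.filter fun y : Fin n =>
    y ≤ x ∧ height F y ≤ height F ((x : ℕ) + 1)) t (by simp [htx, not_lt.1 hcon])
  exact absurd ht (not_lt.2 this)

lemma IsLukasiewicz.blockStart_eq {F : Fin n → ℕ} (hF : IsLukasiewicz F) {x y : Fin n}
    (h1 : y ≤ x) (h2 : height F y ≤ height F ((x : ℕ) + 1))
    (h3 : ∀ t : Fin n, y < t → t ≤ x → height F ((x : ℕ) + 1) < height F t) :
    blockStart F x = y := by
  obtain ⟨⟨a, b⟩, c⟩ := hF.blockStart_spec x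
  rcases lt_trichotomy (blockStart F x) y with h | h | h
  · exact absurd (c y h h1) (not_lt.2 h2)
  · exact h
  · exact absurd (h3 _ h a) (not_lt.2 b)

lemma IsLukasiewicz.blockStart_le {F : Fin n → ℕ} (hF : IsLukasiewicz F) (x : Fin n) :
    blockStart F x ≤ x := (hF.blockStart_spec x).1.1

lemma IsLukasiewicz.blockStart_eq_self {F : Fin n → ℕ} (hF : IsLukasiewicz F) {y : Fin n}
    (hy : 0 < F y) : blockStart F y = y := by
  refine hF.blockStart_eq le_rfl ?_ fun t h1 h2 => absurd h1 (not_lt.2 h2)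
  rw [height_succ]
  omega

lemma IsLukasiewicz.pos_blockStart {F : Fin n → ℕ} (hF : IsLukasiewicz F) (x : Fin n) :
    0 < F (blockStart F x) := by
  obtain ⟨⟨a, b⟩, c⟩ := hF.blockStart_spec x
  have h1 := height_succ F (blockStart F x)
  rcases a.eq_or_lt with h | h
  · rw [h] at h1 b ⊢
    omega
  · have h2 : (blockStart F x : ℕ) < x := h
    have h3 := c ⟨blockStart F x + 1, by omega⟩ (Fin.lt_def.2 (by simp))
      (Fin.le_def.2 (by simp; omega))
    simp only at h3
    omega

lemma IsLukasiewicz.blockStart_blockStart {F : Fin n → ℕ} (hF : IsLukasiewicz F) (x : Fin n) :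
    blockStart F (blockStart F x) = blockStart F x :=
  hF.blockStart_eq_self (hF.pos_blockStart x)

lemma IsLukasiewicz.noncrossing {F : Fin n → ℕ} (hF : IsLukasiewicz F) {x y z w : Fin n}
    (hxy : x < y) (hyz : y < z) (hzw : z < w) (hxz : blockStart F x = blockStart F z)
    (hyw : blockStart F y = blockStart F w) : blockStart F x = blockStart F y := by
  obtain ⟨⟨a1, b1⟩, c1⟩ := hF.blockStart_spec x
  obtain ⟨⟨a2, b2⟩, c2⟩ := hF.blockStart_spec y
  obtain ⟨⟨a3, b3⟩, c3⟩ := hF.blockStart_spec z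
  obtain ⟨⟨a4, b4⟩, c4⟩ := hF.blockStart_spec w
  rw [← hxz] at a3 b3 c3
  rw [← hyw] at a4 b4 c4
  rw [Fin.lt_def] at hxy hyz hzw
  rw [Fin.le_def] at a1 a2 a3 a4
  rcases lt_trichotomy (blockStart F x) (blockStart F y) with h | h | h
  · have h1 := c3 _ h (Fin.le_def.2 (by omega))
    have h2 := c4 ⟨z + 1, by omega⟩ (Fin.lt_def.2 (by simp; omega)) (Fin.le_def.2 (by simp; omega))
    simp only at h2
    omega
  · exact h
  · have h1 := c2 _ h (Fin.le_def.2 (by omega))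
    have h2 := c3 ⟨y + 1, by omega⟩ (Fin.lt_def.2 (by simp; omega)) (Fin.le_def.2 (by simp; omega))
    simp only at h2
    omega

/-- No block straddles a position of height zero. -/
lemma IsLukasiewicz.le_blockStart {F : Fin n → ℕ} (hF : IsLukasiewicz F) {a x : Fin n}
    (ha : height F a = 0) (hax : a ≤ x) : a ≤ blockStart F x := by
  by_contra hcon
  have := (hF.blockStart_spec x).2 a (not_le.1 hcon) hax
  have h2 := hF.nonneg ((x : ℕ) + 1) x.2
  omega

/-- A block between two elements of another block does not start at height zero. -/
lemma IsLukasiewicz.blockStart_eq_of_between {F : Fin n → ℕ} (hF : IsLukasiewicz F) {x y z : Fin n}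
    (hxy : x < y) (hyz : y < z) (hxz : blockStart F x = blockStart F z)
    (hy : height F (blockStart F y) = 0) : blockStart F x = blockStart F y := by
  obtain ⟨⟨a2, b2⟩, c2⟩ := hF.blockStart_spec y
  obtain ⟨⟨a3, b3⟩, c3⟩ := hF.blockStart_spec z
  have h1 := hF.le_blockStart hy (a2.trans hyz.le)
  rw [← hxz] at h1 a3 b3 c3
  have a1 := hF.blockStart_le x
  rw [Fin.lt_def] at hxy hyz
  rw [Fin.le_def] at a1
  by_contra hne
  have h2 := c2 (blockStart F x) (lt_of_le_of_ne h1 (Ne.symm hne)) (Fin.le_def.2 (by omega))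
  have h3 := c3 ⟨y + 1, by omega⟩ (Fin.lt_def.2 (by simp; omega)) (Fin.le_def.2 (by simp; omega))
  simp only at h3
  omega

/-- The elements of a block are in bijection with the levels of the path after them. -/
lemma IsLukasiewicz.card_fiber {F : Fin n → ℕ} (hF : IsLukasiewicz F) (y : Fin n) :
    (Finset.univ.filter fun x => blockStart F x = y).card = F y := by
  rcases Nat.eq_zero_or_pos (F y) with h0 | hpos
  · rw [h0, Finset.card_eq_zero, Finset.filter_eq_empty_iff]
    rintro x - rfl
    have := hF.pos_blockStart x
    omega
  have hcard : F y = (Finset.Ico (height F y) (height F y + F y)).card := by simp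
  refine Eq.trans ?_ hcard.symm
  apply Finset.card_bij (fun (x : Fin n) _ => height F ((x : ℕ) + 1))
  · intro x hx
    simp only [Finset.mem_filter, Finset.mem_univ, true_and] at hx
    obtain ⟨⟨a, b⟩, c⟩ := hF.blockStart_spec x
    rw [hx] at a b c
    rw [Finset.mem_Ico]
    refine ⟨b, ?_⟩
    have h1 := height_succ F y
    rcases a.eq_or_lt with h | h
    · rw [← h]; omega
    · have h3 := c ⟨y + 1, by have : (y : ℕ) < x := h; omega⟩ (Fin.lt_def.2 (by simp))
        (Fin.le_def.2 (by have : (y : ℕ) < x := h; simp; omega))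
      simp only at h3
      omega
  · have key : ∀ x x' : Fin n, blockStart F x = y → blockStart F x' = y → x < x' →
        height F ((x' : ℕ) + 1) < height F ((x : ℕ) + 1) := by
      intro x x' hx hx' hlt
      have h1 := (hF.blockStart_spec x').2 ⟨x + 1, by have : (x : ℕ) < x' := hlt; omega⟩
        (Fin.lt_def.2 (by
          have := hF.blockStart_le x
          rw [hx', ← hx]
          have h2 : (blockStart F x : ℕ) ≤ x := this
          simp; omega))
        (Fin.le_def.2 (by have : (x : ℕ) < x' := hlt; simp; omega))
      simpa using h1
    intro x hx x' hx' he
    simp only [Finset.mem_filter, Finset.mem_univ, true_and] at hx hx'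
    rcases lt_trichotomy x x' with h | h | h
    · have := key x x' hx hx' h; omega
    · exact h
    · have := key x' x hx' hx h; omega
  · intro l hl
    rw [Finset.mem_Ico] at hl
    have hn := hF.nonneg y y.2.le
    have hyn := y.2
    have hex : ∃ k, (y : ℕ) ≤ k ∧ k < n ∧ height F (k + 1) ≤ l := by
      refine ⟨n - 1, by omega, by omega, ?_⟩
      rw [Nat.sub_add_cancel (by omega), hF.last]
      omega
    classical
    obtain ⟨h1, h2, h3⟩ := Nat.find_spec hex
    have hmin := fun m hm => Nat.find_min hex (m := m) hm
    set k := Nat.find hex with hk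
    have h4 := height_succ F ⟨k, h2⟩
    simp only at h4
    have hbelow : ∀ t : ℕ, (y : ℕ) < t → t ≤ k → l < height F t := by
      intro t ht htk
      have := hmin (t - 1) (by omega)
      rw [Nat.sub_add_cancel (by omega)] at this
      by_contra hcon
      exact this ⟨by omega, by omega, not_lt.1 hcon⟩
    have hval : height F (k + 1) = l := by
      rcases h1.eq_or_lt with h | h
      · have h5 := height_succ F y
        rw [← h] at h3 ⊢
        omega
      · have := hbelow k h le_rfl
        omega
    refine ⟨⟨k, h2⟩, ?_, hval⟩
    simp only [Finset.mem_filter, Finset.mem_univ, true_and]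
    refine hF.blockStart_eq (Fin.le_def.2 h1) ?_ fun t ht htk => ?_
    · exact hval.symm ▸ hl.1
    · exact hval.symm ▸ hbelow t ht htk

/-- A noncrossing partition of `Fin n`, given by the map that sends an element to the least element
of its block. -/
structure IsBlockMin (μ : Fin n → Fin n) : Prop where
  le : ∀ x, μ x ≤ x
  idem : ∀ x, μ (μ x) = μ x
  nc : ∀ x y z w, x < y → y < z → z < w → μ x = μ z → μ y = μ w → μ x = μ y

/-- The word that records the block sizes at the least elements of the blocks. -/
def blockWord (μ : Fin n → Fin n) (y : Fin n) : ℕ := (Finset.univ.filter fun x => μ x = y).card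

lemma height_blockWord (μ : Fin n → Fin n) (t : ℕ) :
    height (blockWord μ) t = (Finset.univ.filter fun x => (μ x : ℕ) < t).card - t := by
  unfold height
  congr 1
  rw [← Nat.cast_sum, Nat.cast_inj]
  unfold blockWord
  rw [Finset.card_eq_sum_card_fiberwise (f := μ) (t := Finset.univ.filter fun i : Fin n => (i : ℕ) < t)]
  · refine Finset.sum_congr rfl fun i hi => ?_
    congr 1
    ext x
    simp only [Finset.mem_filter, Finset.mem_univ, true_and] at hi ⊢
    constructor
    · rintro rfl; exact ⟨hi, rfl⟩
    · exact fun h => h.2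
  · intro x hx
    simpa using hx

/-- The difference of two heights counts the elements whose block starts in an interval. -/
lemma height_blockWord_sub (μ : Fin n → Fin n) {t u : ℕ} (htu : t ≤ u) :
    height (blockWord μ) u - height (blockWord μ) t =
      (Finset.univ.filter fun x => t ≤ (μ x : ℕ) ∧ (μ x : ℕ) < u).card - (u - t) := by
  rw [height_blockWord, height_blockWord]
  have : (Finset.univ.filter fun x => (μ x : ℕ) < u) =
      (Finset.univ.filter fun x => (μ x : ℕ) < t) ∪
        (Finset.univ.filter fun x => t ≤ (μ x : ℕ) ∧ (μ x : ℕ) < u) := by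
    ext x
    simp only [Finset.mem_filter, Finset.mem_univ, true_and, Finset.mem_union]
    omega
  rw [this, Finset.card_union_of_disjoint]
  · push_cast; ring
  · rw [Finset.disjoint_filter]
    intro x _ h
    omega

lemma card_fin_Ico {n t u : ℕ} (hu : u ≤ n) :
    (Finset.univ.filter fun x : Fin n => t ≤ (x : ℕ) ∧ (x : ℕ) < u).card = u - t := by
  rw [← Nat.card_Ico t u, ← Finset.card_map Fin.valEmbedding]
  congr 1
  ext x
  simp only [Finset.mem_map, Finset.mem_filter, Finset.mem_univ, true_and, Fin.valEmbedding_apply,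
    Finset.mem_Ico]
  constructor
  · rintro ⟨a, h, rfl⟩; exact h
  · intro h; exact ⟨⟨x, by omega⟩, h, rfl⟩

lemma IsBlockMin.isLukasiewicz {μ : Fin n → Fin n} (h : IsBlockMin μ) :
    IsLukasiewicz (blockWord μ) := by
  constructor
  · intro x hx
    rw [height_blockWord]
    have h1 := card_fin_Ico (n := n) (t := 0) hx
    have h2 : (Finset.univ.filter fun y : Fin n => 0 ≤ (y : ℕ) ∧ (y : ℕ) < x) ⊆
        (Finset.univ.filter fun y => (μ y : ℕ) < x) := by
      intro y hy
      simp only [Finset.mem_filter, Finset.mem_univ, true_and] at hy ⊢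
      have : (μ y : ℕ) ≤ y := h.le y
      omega
    have := Finset.card_le_card h2
    omega
  · rw [height_blockWord]
    simp

lemma IsBlockMin.blockStart_blockWord {μ : Fin n → Fin n} (h : IsBlockMin μ) (x : Fin n) :
    blockStart (blockWord μ) x = μ x := by
  refine h.isLukasiewicz.blockStart_eq (h.le x) ?_ fun t ht htx => ?_
  · have hle : (μ x : ℕ) ≤ x := h.le x
    have h1 := height_blockWord_sub μ (t := μ x) (u := x + 1) (by omega)
    have h2 := card_fin_Ico (n := n) (t := μ x) (u := x + 1) x.2
    have h3 : (Finset.univ.filter fun y : Fin n => (μ x : ℕ) ≤ (y : ℕ) ∧ (y : ℕ) < x + 1) ⊆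
        (Finset.univ.filter fun y => (μ x : ℕ) ≤ (μ y : ℕ) ∧ (μ y : ℕ) < x + 1) := by
      intro z hz
      simp only [Finset.mem_filter, Finset.mem_univ, true_and] at hz ⊢
      have hzz : (μ z : ℕ) ≤ z := h.le z
      refine ⟨?_, by omega⟩
      by_contra hcon
      have n1 : μ z ≠ μ x := fun he => by rw [he] at hcon; omega
      have n2 : (z : ℕ) ≠ μ x := fun he => by
        have : z = μ x := Fin.ext he
        rw [this, h.idem] at hcon
        omega
      have n3 : (z : ℕ) ≠ x := fun he => n1 (by rw [Fin.ext he])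
      have := h.nc (μ z) (μ x) z x (Fin.lt_def.2 (by omega)) (Fin.lt_def.2 (by omega))
        (Fin.lt_def.2 (by omega)) (h.idem z) (h.idem x)
      rw [h.idem, h.idem] at this
      exact n1 this
    have := Finset.card_le_card h3
    push_cast at h1
    omega
  · have htx' : (t : ℕ) ≤ x := htx
    have ht' : (μ x : ℕ) < t := ht
    have h1 := height_blockWord_sub μ (t := t) (u := x + 1) (by omega)
    have h2 := card_fin_Ico (n := n) (t := t) (u := x) x.2.le
    have h3 : (Finset.univ.filter fun y => (t : ℕ) ≤ (μ y : ℕ) ∧ (μ y : ℕ) < x + 1) ⊆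
        (Finset.univ.filter fun y : Fin n => (t : ℕ) ≤ (y : ℕ) ∧ (y : ℕ) < x) := by
      intro z hz
      simp only [Finset.mem_filter, Finset.mem_univ, true_and] at hz ⊢
      have hzz : (μ z : ℕ) ≤ z := h.le z
      refine ⟨by omega, ?_⟩
      by_contra hcon
      have n1 : μ z ≠ μ x := fun he => by rw [he] at hz; omega
      have n2 : (μ z : ℕ) ≠ x := fun he => by
        have h4 : μ z = x := Fin.ext he
        have h5 := h.idem z
        rw [h4] at h5
        rw [h5] at ht'
        omega
      have n3 : (z : ℕ) ≠ x := fun he => n1 (by rw [Fin.ext he])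
      have := h.nc (μ x) (μ z) x z (Fin.lt_def.2 (by omega)) (Fin.lt_def.2 (by omega))
        (Fin.lt_def.2 (by omega)) (h.idem x) (h.idem z)
      rw [h.idem, h.idem] at this
      exact n1 this.symm
    have := Finset.card_le_card h3
    push_cast at h1
    omega

/-- A fixed point `a` of the block-minimum map is at height zero if no block straddles it. -/
lemma IsBlockMin.height_eq_zero {μ : Fin n → Fin n} (h : IsBlockMin μ) {a : Fin n}
    (ha : ∀ x, a ≤ x → a ≤ μ x) : height (blockWord μ) a = 0 := by
  rw [height_blockWord]
  have h1 := card_fin_Ico (n := n) (t := 0) a.2.le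
  have : (Finset.univ.filter fun x => (μ x : ℕ) < a) =
      (Finset.univ.filter fun y : Fin n => 0 ≤ (y : ℕ) ∧ (y : ℕ) < a) := by
    ext y
    simp only [Finset.mem_filter, Finset.mem_univ, true_and]
    have h2 : (μ y : ℕ) ≤ y := h.le y
    constructor
    · intro hy
      refine ⟨Nat.zero_le _, ?_⟩
      by_contra hcon
      have : (a : ℕ) ≤ μ y := ha y (Fin.le_def.2 (by omega))
      omega
    · intro hy
      omega
  rw [this, h1]
  simp

/-- A Łukasiewicz word together with a set of marked letters at height zero, the first letter among
them: one side of a noncrossing permutation of the annulus which is slit next to a connected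
cycle. The marked letters are those of the connected cycles. -/
structure IsRootedWord [NeZero n] (F : Fin n → ℕ) (A : Finset (Fin n)) : Prop where
  luk : IsLukasiewicz F
  zero_mem : 0 ∈ A
  height_eq : ∀ a ∈ A, height F a = 0
  pos : ∀ a ∈ A, 0 < F a

end words
end AnnularCSP
end

noncomputable section
namespace AnnularCSP

open Equiv

/-! ### Gluing the two sides of a slit annulus -/

section counting
variable {k : ℕ}

/-- The number of elements of `A` below `a`. -/
def countBelow (A : Finset (Fin k)) (a : Fin k) : ℕ := (A.filter (· < a)).card

/-- The number of elements of `A` above `a`. -/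
def countAbove (A : Finset (Fin k)) (a : Fin k) : ℕ := (A.filter (a < ·)).card

lemma countBelow_lt_of_lt {A : Finset (Fin k)} {a b : Fin k} (ha : a ∈ A) (h : a < b) :
    countBelow A a < countBelow A b := by
  apply Finset.card_lt_card
  rw [Finset.ssubset_iff_of_subset]
  · exact ⟨a, by simp [ha, h], by simp⟩
  · intro x hx
    simp only [Finset.mem_filter] at hx ⊢
    exact ⟨hx.1, hx.2.trans h⟩

lemma countAbove_lt_of_lt {A : Finset (Fin k)} {a b : Fin k} (hb : b ∈ A) (h : a < b) :
    countAbove A b < countAbove A a := by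
  apply Finset.card_lt_card
  rw [Finset.ssubset_iff_of_subset]
  · exact ⟨b, by simp [hb, h], by simp⟩
  · intro x hx
    simp only [Finset.mem_filter] at hx ⊢
    exact ⟨hx.1, h.trans hx.2⟩

lemma countBelow_inj {A : Finset (Fin k)} {a b : Fin k} (ha : a ∈ A) (hb : b ∈ A)
    (h : countBelow A a = countBelow A b) : a = b := by
  rcases lt_trichotomy a b with h1 | h1 | h1
  · have := countBelow_lt_of_lt ha h1; omega
  · exact h1
  · have := countBelow_lt_of_lt hb h1; omega

lemma countAbove_inj {A : Finset (Fin k)} {a b : Fin k} (ha : a ∈ A) (hb : b ∈ A)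
    (h : countAbove A a = countAbove A b) : a = b := by
  rcases lt_trichotomy a b with h1 | h1 | h1
  · have := countAbove_lt_of_lt hb h1; omega
  · exact h1
  · have := countAbove_lt_of_lt ha h1; omega

lemma countBelow_lt_card {A : Finset (Fin k)} {a : Fin k} (ha : a ∈ A) :
    countBelow A a < A.card := by
  apply Finset.card_lt_card
  rw [Finset.ssubset_iff_of_subset (Finset.filter_subset _ _)]
  exact ⟨a, ha, by simp⟩

lemma countAbove_lt_card {A : Finset (Fin k)} {a : Fin k} (ha : a ∈ A) :
    countAbove A a < A.card := by
  apply Finset.card_lt_card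
  rw [Finset.ssubset_iff_of_subset (Finset.filter_subset _ _)]
  exact ⟨a, ha, by simp⟩

lemma exists_countAbove_eq {A : Finset (Fin k)} {j : ℕ} (hj : j < A.card) :
    ∃ a ∈ A, countAbove A a = j := by
  obtain ⟨a, ha, h⟩ := Finset.surj_on_of_inj_on_of_card_le (s := A) (t := Finset.range A.card)
    (fun a _ => countAbove A a) (fun a ha => Finset.mem_range.2 (countAbove_lt_card ha))
    (fun a b ha hb h => countAbove_inj ha hb h) (by simp) j (Finset.mem_range.2 hj)
  exact ⟨a, ha, h.symm⟩

lemma exists_countBelow_eq {A : Finset (Fin k)} {j : ℕ} (hj : j < A.card) :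
    ∃ a ∈ A, countBelow A a = j := by
  obtain ⟨a, ha, h⟩ := Finset.surj_on_of_inj_on_of_card_le (s := A) (t := Finset.range A.card)
    (fun a _ => countBelow A a) (fun a ha => Finset.mem_range.2 (countBelow_lt_card ha))
    (fun a b ha hb h => countBelow_inj ha hb h) (by simp) j (Finset.mem_range.2 hj)
  exact ⟨a, ha, h.symm⟩

end counting

section trace
variable {X : Type*} {k : ℕ}

open Classical in
/-- For points `ι 0, ι 1, …` on one side of the slit: the index of the first point that lies in the
cycle of `ι x`. -/
def traceMin (ι : Fin k → X) (π : Perm X) (x : Fin k) : Fin k :=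
  (Finset.univ.filter fun y => π.SameCycle (ι x) (ι y)).min' ⟨x, by simp [Perm.SameCycle.refl]⟩

variable {ι : Fin k → X} {π : Perm X}

open Classical in
lemma sameCycle_traceMin (x : Fin k) : π.SameCycle (ι x) (ι (traceMin ι π x)) := by
  exact (Finset.mem_filter.1 (Finset.min'_mem (Finset.univ.filter fun y => π.SameCycle (ι x) (ι y))
    ⟨x, by simp [Perm.SameCycle.refl]⟩)).2

open Classical in
lemma traceMin_le {x y : Fin k} (h : π.SameCycle (ι x) (ι y)) : traceMin ι π x ≤ y := by
  exact Finset.min'_le (Finset.univ.filter fun y => π.SameCycle (ι x) (ι y)) _ (Finset.mem_filter.2 ⟨Finset.mem_univ _, h⟩)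

lemma traceMin_eq_iff {x y : Fin k} :
    traceMin ι π x = traceMin ι π y ↔ π.SameCycle (ι x) (ι y) := by
  constructor
  · intro h
    have h1 := sameCycle_traceMin (ι := ι) (π := π) x
    rw [h] at h1
    exact h1.trans (sameCycle_traceMin y).symm
  · intro h
    exact le_antisymm (traceMin_le (h.trans (sameCycle_traceMin y)))
      (traceMin_le (h.symm.trans (sameCycle_traceMin x)))

lemma traceMin_idem (x : Fin k) : traceMin ι π (traceMin ι π x) = traceMin ι π x :=
  traceMin_eq_iff.2 (sameCycle_traceMin x).symm

lemma BlocksNoncrossing.isBlockMin {pos : X → ℕ} (h : BlocksNoncrossing pos π)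
    (hι : ∀ x y, x < y → pos (ι x) < pos (ι y)) : IsBlockMin (traceMin ι π) where
  le _ := traceMin_le (Perm.SameCycle.refl _ _)
  idem := traceMin_idem
  nc _ _ _ _ hxy hyz hzw hxz hyw := traceMin_eq_iff.2
    (h _ _ _ _ (hι _ _ hxy) (hι _ _ hyz) (hι _ _ hzw) (traceMin_eq_iff.1 hxz)
      (traceMin_eq_iff.1 hyw))

lemma traceMin_eq_blockStart {F : Fin k → ℕ} (hF : IsLukasiewicz F)
    (h : ∀ x y, π.SameCycle (ι x) (ι y) ↔ blockStart F x = blockStart F y) (x : Fin k) :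
    traceMin ι π x = blockStart F x := by
  apply le_antisymm
  · exact traceMin_le ((h _ _).2 (hF.blockStart_blockStart x).symm)
  · have h1 := (h _ _).1 (sameCycle_traceMin (ι := ι) (π := π) x)
    rw [h1]
    exact hF.blockStart_le _

end trace

section rooted
variable {n m : ℕ}

/-- The position of a point of the annulus on the boundary of the slit disk. -/
def slitPos : Pt n m → ℕ := Sum.elim (fun x => (x : ℕ)) (fun y => n + (y : ℕ))

@[simp] lemma slitPos_inl (x : Fin n) : slitPos (Sum.inl x : Pt n m) = x := rfl
@[simp] lemma slitPos_inr (y : Fin m) : slitPos (Sum.inr y : Pt n m) = n + y := rfl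

lemma slitPos_injective : Function.Injective (slitPos : Pt n m → ℕ) := by
  rintro (x | x) (y | y) h <;> simp only [slitPos_inl, slitPos_inr] at h
  · rw [Fin.ext h]
  · omega
  · omega
  · rw [Fin.ext (by omega : (x : ℕ) = y)]

/-- The exterior points at which an arrow from the interior circle ends. -/
def extMarks (π : Perm (Pt n m)) : Finset (Fin n) :=
  Finset.univ.filter fun x => (π⁻¹ (Sum.inl x)).isRight

/-- The interior points at which an arrow from the exterior circle ends. -/
def intMarks (π : Perm (Pt n m)) : Finset (Fin m) :=
  Finset.univ.filter fun y => (π⁻¹ (Sum.inr y)).isLeft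

/-- The exterior sizes of the cycles, recorded at the first exterior elements. -/
def extWord (π : Perm (Pt n m)) : Fin n → ℕ := blockWord (traceMin Sum.inl π)

/-- The interior sizes of the cycles, recorded at the first interior elements. -/
def intWord (π : Perm (Pt n m)) : Fin m → ℕ := blockWord (traceMin Sum.inr π)

lemma mem_extMarks {π : Perm (Pt n m)} {x : Fin n} :
    x ∈ extMarks π ↔ ∃ y, π (Sum.inr y) = Sum.inl x := by
  simp only [extMarks, Finset.mem_filter, Finset.mem_univ, true_and, Sum.isRight_iff]
  exact ⟨fun ⟨y, h⟩ => ⟨y, by rw [← h]; simp⟩, fun ⟨y, h⟩ => ⟨y, by rw [← h]; simp⟩⟩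

lemma mem_intMarks {π : Perm (Pt n m)} {y : Fin m} :
    y ∈ intMarks π ↔ ∃ x, π (Sum.inl x) = Sum.inr y := by
  simp only [intMarks, Finset.mem_filter, Finset.mem_univ, true_and, Sum.isLeft_iff]
  exact ⟨fun ⟨y, h⟩ => ⟨y, by rw [← h]; simp⟩, fun ⟨y, h⟩ => ⟨y, by rw [← h]; simp⟩⟩

/-- For a noncrossing permutation, the marked points are the first exterior elements of the connected
cycles. -/
lemma Clockwise.mem_extMarks_iff {π : Perm (Pt n m)} (h : Clockwise slitPos π) {x : Fin n} :
    x ∈ extMarks π ↔ traceMin Sum.inl π x = x ∧ ∃ y, π.SameCycle (Sum.inl x) (Sum.inr y) := by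
  rw [mem_extMarks]
  constructor
  · rintro ⟨y, hy⟩
    have hs : π.SameCycle (Sum.inr y) (Sum.inl x) := hy ▸ sameCycle_apply_self π _
    have hmax : ∀ z, π.SameCycle (Sum.inr y) z → slitPos z ≤ slitPos (Sum.inr y : Pt n m) := by
      intro z hz
      by_contra hcon
      have := (h.lt_apply slitPos_injective hz (not_le.1 hcon)).1
      rw [hy] at this
      simp only [slitPos_inl, slitPos_inr] at this
      omega
    refine ⟨?_, y, hs.symm⟩
    have h1 := h.apply_le_of_isMax slitPos_injective hmax (hs.trans (sameCycle_traceMin x))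
    rw [hy] at h1
    exact le_antisymm (traceMin_le (Perm.SameCycle.refl _ _)) h1
  · rintro ⟨hx, y, hy⟩
    rcases hu : π⁻¹ (Sum.inl x) with x' | y'
    · exfalso
      have hπ : π (Sum.inl x') = Sum.inl x := by rw [← hu]; simp
      have hs : π.SameCycle (Sum.inl x') (Sum.inl x) := hπ ▸ sameCycle_apply_self π _
      have h1 := (h.lt_apply slitPos_injective (hs.trans hy) (by simp; omega)).1
      rw [hπ] at h1
      have h2 : traceMin Sum.inl π x ≤ x' := traceMin_le hs.symm
      rw [hx] at h2
      exact absurd h2 (not_le.2 h1)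
    · exact ⟨y', by rw [← hu]; simp⟩

lemma Clockwise.mem_intMarks_iff {π : Perm (Pt n m)} (h : Clockwise slitPos π) {y : Fin m} :
    y ∈ intMarks π ↔ traceMin Sum.inr π y = y ∧ ∃ x, π.SameCycle (Sum.inl x) (Sum.inr y) := by
  classical
  rw [mem_intMarks]
  constructor
  · rintro ⟨x, hx⟩
    have hs : π.SameCycle (Sum.inl x) (Sum.inr y) := hx ▸ sameCycle_apply_self π _
    refine ⟨?_, x, hs⟩
    have h1 := (h.lt_apply slitPos_injective (hs.trans (sameCycle_traceMin y)) (by simp; omega)).2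
    rw [hx] at h1
    simp only [slitPos_inr, add_le_add_iff_left] at h1
    exact le_antisymm (traceMin_le (Perm.SameCycle.refl _ _)) h1
  · rintro ⟨hy, x, hx⟩
    -- the arrow at the last exterior element of the cycle ends at `y`
    obtain ⟨u, hu, hmax⟩ := Finset.exists_max_image
      (Finset.univ.filter fun u : Fin n => π.SameCycle (Sum.inl x) (Sum.inl u))
      (fun u => (u : ℕ)) ⟨x, by simp [Perm.SameCycle.refl]⟩
    simp only [Finset.mem_filter, Finset.mem_univ, true_and] at hu hmax
    refine ⟨u, ?_⟩
    obtain ⟨h1, h2⟩ := h.lt_apply slitPos_injective (hu.symm.trans hx) (by simp; omega)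
    have h3 := hu.trans (sameCycle_apply_self π _)
    rcases hπ : π (Sum.inl u) with u' | y'
    · exfalso
      rw [hπ] at h1 h3
      have := hmax u' h3
      simp only [slitPos_inl] at h1
      omega
    · rw [hπ] at h2 h3
      simp only [slitPos_inr, add_le_add_iff_left] at h2
      have h4 : traceMin Sum.inr π y ≤ y' := traceMin_le (hx.symm.trans h3)
      rw [hy] at h4
      rw [Fin.le_antisymm h2 h4]

variable {π : Perm (Pt n m)}

lemma Noncrossing.isBlockMin_ext (h : Noncrossing slitPos π) :
    IsBlockMin (traceMin Sum.inl π : Fin n → Fin n) :=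
  h.blocks.isBlockMin fun _ _ hxy => hxy

lemma Noncrossing.isBlockMin_int (h : Noncrossing slitPos π) :
    IsBlockMin (traceMin Sum.inr π : Fin m → Fin m) :=
  h.blocks.isBlockMin fun _ _ hxy => by simpa using hxy

/-- No cycle has exterior elements on both sides of the first element of a connected cycle. -/
lemma Noncrossing.lt_extMark_iff (h : Noncrossing slitPos π) {a x x' : Fin n}
    (ha : a ∈ extMarks π) (hx : π.SameCycle (Sum.inl x) (Sum.inl x')) : x < a ↔ x' < a := by
  obtain ⟨h1, y, h2⟩ := h.clockwise.mem_extMarks_iff.1 ha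
  have key : ∀ x x' : Fin n, π.SameCycle (Sum.inl x) (Sum.inl x') → x < a → x' < a := by
    intro x x' hx hxa
    by_contra hcon
    rcases (not_lt.1 hcon).eq_or_lt with he | hlt
    · have := traceMin_le (ι := Sum.inl) (π := π) (he ▸ hx.symm : π.SameCycle (Sum.inl a) (Sum.inl x))
      rw [h1] at this
      exact absurd hxa (not_lt.2 this)
    · have h3 := h.blocks (Sum.inl x) (Sum.inl a) (Sum.inl x') (Sum.inr y) hxa hlt (by simp; omega)
        hx h2
      have := traceMin_le (ι := Sum.inl) (π := π) h3.symm
      rw [h1] at this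
      exact absurd hxa (not_lt.2 this)
  exact ⟨key _ _ hx, key _ _ hx.symm⟩

lemma Noncrossing.lt_intMark_iff (h : Noncrossing slitPos π) {b y y' : Fin m}
    (hb : b ∈ intMarks π) (hy : π.SameCycle (Sum.inr y) (Sum.inr y')) : y < b ↔ y' < b := by
  obtain ⟨h1, x, h2⟩ := h.clockwise.mem_intMarks_iff.1 hb
  have key : ∀ y y' : Fin m, π.SameCycle (Sum.inr y) (Sum.inr y') → y < b → y' < b := by
    intro y y' hy hyb
    by_contra hcon
    rcases (not_lt.1 hcon).eq_or_lt with he | hlt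
    · have := traceMin_le (ι := Sum.inr) (π := π) (he ▸ hy.symm : π.SameCycle (Sum.inr b) (Sum.inr y))
      rw [h1] at this
      exact absurd hyb (not_lt.2 this)
    · have h3 := h.blocks (Sum.inl x) (Sum.inr y) (Sum.inr b) (Sum.inr y') (by simp; omega)
        (by simpa using hyb) (by simpa using hlt) h2 hy
      have := traceMin_le (ι := Sum.inr) (π := π) (h2.symm.trans h3)
      rw [h1] at this
      exact absurd hyb (not_lt.2 this)
  exact ⟨key _ _ hy, key _ _ hy.symm⟩

lemma Noncrossing.height_extWord (h : Noncrossing slitPos π) {a : Fin n} (ha : a ∈ extMarks π) :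
    height (extWord π) a = 0 := by
  obtain ⟨h1, y, h2⟩ := h.clockwise.mem_extMarks_iff.1 ha
  refine h.isBlockMin_ext.height_eq_zero fun x hax => ?_
  by_contra hcon
  have hne : a ≠ x := by
    rintro rfl
    exact hcon h1.ge
  have h3 := h.blocks (Sum.inl (traceMin Sum.inl π x)) (Sum.inl a) (Sum.inl x) (Sum.inr y)
    (not_le.1 hcon) (Fin.lt_def.1 (lt_of_le_of_ne hax hne)) (by simp; omega) (sameCycle_traceMin x).symm h2
  have h4 := traceMin_eq_iff.2 h3
  rw [traceMin_idem, h1] at h4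
  exact hcon h4.ge

lemma Noncrossing.height_intWord (h : Noncrossing slitPos π) {b : Fin m} (hb : b ∈ intMarks π) :
    height (intWord π) b = 0 := by
  obtain ⟨h1, x, h2⟩ := h.clockwise.mem_intMarks_iff.1 hb
  refine h.isBlockMin_int.height_eq_zero fun y hby => ?_
  by_contra hcon
  have hne : b ≠ y := by
    rintro rfl
    exact hcon h1.ge
  have h3 := h.blocks (Sum.inl x) (Sum.inr (traceMin Sum.inr π y)) (Sum.inr b) (Sum.inr y)
    (by simp; omega) (by simpa using hcon) (by simpa using lt_of_le_of_ne hby hne)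
    h2 (sameCycle_traceMin y).symm
  have h4 := traceMin_eq_iff.2 (h3.symm.trans h2)
  rw [traceMin_idem, h1] at h4
  exact hcon h4.ge

lemma Noncrossing.exists_intMark (h : Noncrossing slitPos π) {x : Fin n} {y : Fin m}
    (hxy : π.SameCycle (Sum.inl x) (Sum.inr y)) :
    traceMin Sum.inl π x ∈ extMarks π ∧ traceMin Sum.inr π y ∈ intMarks π ∧
      π.SameCycle (Sum.inl (traceMin Sum.inl π x)) (Sum.inr (traceMin Sum.inr π y)) := by
  have h1 : π.SameCycle (Sum.inl (traceMin Sum.inl π x)) (Sum.inr (traceMin Sum.inr π y)) :=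
    (sameCycle_traceMin x).symm.trans (hxy.trans (sameCycle_traceMin y))
  exact ⟨h.clockwise.mem_extMarks_iff.2 ⟨traceMin_idem x, _, h1⟩,
    h.clockwise.mem_intMarks_iff.2 ⟨traceMin_idem y, _, h1⟩, h1⟩

lemma Noncrossing.exists_mem_intMarks (h : Noncrossing slitPos π) {a : Fin n}
    (ha : a ∈ extMarks π) : ∃ b ∈ intMarks π, π.SameCycle (Sum.inl a) (Sum.inr b) := by
  obtain ⟨h1, y, h2⟩ := h.clockwise.mem_extMarks_iff.1 ha
  obtain ⟨h3, h4, h5⟩ := h.exists_intMark h2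
  rw [h1] at h5
  exact ⟨_, h4, h5⟩

lemma Noncrossing.exists_mem_extMarks (h : Noncrossing slitPos π) {b : Fin m}
    (hb : b ∈ intMarks π) : ∃ a ∈ extMarks π, π.SameCycle (Sum.inl a) (Sum.inr b) := by
  obtain ⟨h1, x, h2⟩ := h.clockwise.mem_intMarks_iff.1 hb
  obtain ⟨h3, h4, h5⟩ := h.exists_intMark h2
  rw [h1] at h5
  exact ⟨_, h3, h5⟩

lemma Noncrossing.extMarks_inj (h : Noncrossing slitPos π) {a a' : Fin n}
    (ha : a ∈ extMarks π) (ha' : a' ∈ extMarks π)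
    (hs : π.SameCycle (Sum.inl a) (Sum.inl a')) : a = a' := by
  rw [← (h.clockwise.mem_extMarks_iff.1 ha).1, ← (h.clockwise.mem_extMarks_iff.1 ha').1]
  exact traceMin_eq_iff.2 hs

lemma Noncrossing.intMarks_inj (h : Noncrossing slitPos π) {b b' : Fin m}
    (hb : b ∈ intMarks π) (hb' : b' ∈ intMarks π)
    (hs : π.SameCycle (Sum.inr b) (Sum.inr b')) : b = b' := by
  rw [← (h.clockwise.mem_intMarks_iff.1 hb).1, ← (h.clockwise.mem_intMarks_iff.1 hb').1]
  exact traceMin_eq_iff.2 hs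

/-- The connected cycles are met in opposite orders on the two sides of the slit. -/
lemma Noncrossing.marks_antitone (h : Noncrossing slitPos π) {a a' : Fin n} {b b' : Fin m}
    (ha : a ∈ extMarks π) (ha' : a' ∈ extMarks π)
    (hab : π.SameCycle (Sum.inl a) (Sum.inr b)) (hab' : π.SameCycle (Sum.inl a') (Sum.inr b')) :
    a < a' → b' < b := by
  intro hlt
  by_contra hcon
  rcases (not_lt.1 hcon).eq_or_lt with he | hlt'
  · rw [he] at hab
    exact hlt.ne (h.extMarks_inj ha ha' (hab.trans hab'.symm))
  · exact hlt.ne (h.extMarks_inj ha ha'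
      (h.blocks _ _ _ _ hlt (by simp; omega) (by simpa using hlt') hab hab'))

lemma Noncrossing.countBelow_eq_countAbove (h : Noncrossing slitPos π) {a : Fin n} {b : Fin m}
    (ha : a ∈ extMarks π) (hb : b ∈ intMarks π) (hab : π.SameCycle (Sum.inl a) (Sum.inr b)) :
    countBelow (extMarks π) a = countAbove (intMarks π) b := by
  choose f hf hfs using fun a (ha : a ∈ extMarks π) => h.exists_mem_intMarks ha
  refine Finset.card_bij (fun a ha => f a (Finset.mem_filter.1 ha).1) ?_ ?_ ?_
  · intro a' ha'
    have ha'' := Finset.mem_filter.1 ha'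
    exact Finset.mem_filter.2
      ⟨hf a' ha''.1, h.marks_antitone ha''.1 ha (hfs a' ha''.1) hab ha''.2⟩
  · intro a₁ h₁ a₂ h₂ he
    have h₁' := (Finset.mem_filter.1 h₁).1
    have h₂' := (Finset.mem_filter.1 h₂).1
    refine h.extMarks_inj h₁' h₂' ((hfs a₁ h₁').trans ?_)
    rw [he]
    exact (hfs a₂ h₂').symm
  · intro b' hb'
    rw [Finset.mem_filter] at hb'
    obtain ⟨a', ha', hs⟩ := h.exists_mem_extMarks hb'.1
    refine ⟨a', Finset.mem_filter.2 ⟨ha', ?_⟩,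
      h.intMarks_inj (hf a' ha') hb'.1 ((hfs a' ha').symm.trans hs)⟩
    rcases lt_trichotomy a' a with h1 | h1 | h1
    · exact h1
    · subst h1
      exact absurd (h.intMarks_inj hb hb'.1 (hab.symm.trans hs)) hb'.2.ne
    · exact absurd (h.marks_antitone ha ha' hab hs h1) (not_lt.2 hb'.2.le)

lemma Noncrossing.card_marks (h : Noncrossing slitPos π) :
    (extMarks π).card = (intMarks π).card := by
  choose f hf hfs using fun a (ha : a ∈ extMarks π) => h.exists_mem_intMarks ha
  refine Finset.card_bij (fun a ha => f a ha) (fun a ha => hf a ha) ?_ ?_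
  · intro a₁ h₁ a₂ h₂ he
    refine h.extMarks_inj h₁ h₂ ((hfs a₁ h₁).trans ?_)
    rw [he]
    exact (hfs a₂ h₂).symm
  · intro b' hb'
    obtain ⟨a', ha', hs⟩ := h.exists_mem_extMarks hb'
    exact ⟨a', ha', h.intMarks_inj (hf a' ha') hb' ((hfs a' ha').symm.trans hs)⟩

lemma Noncrossing.sameCycle_inl_inr_iff (h : Noncrossing slitPos π) {x : Fin n} {y : Fin m} :
    π.SameCycle (Sum.inl x) (Sum.inr y) ↔
      traceMin Sum.inl π x ∈ extMarks π ∧ traceMin Sum.inr π y ∈ intMarks π ∧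
      countBelow (extMarks π) (traceMin Sum.inl π x) =
        countAbove (intMarks π) (traceMin Sum.inr π y) := by
  constructor
  · intro hxy
    obtain ⟨h1, h2, h3⟩ := h.exists_intMark hxy
    exact ⟨h1, h2, h.countBelow_eq_countAbove h1 h2 h3⟩
  · rintro ⟨h1, h2, h3⟩
    obtain ⟨b, hb, hs⟩ := h.exists_mem_intMarks h1
    have h4 := h.countBelow_eq_countAbove h1 hb hs
    rw [h3] at h4
    have h5 := countAbove_inj h2 hb h4
    rw [← h5] at hs
    exact (sameCycle_traceMin x).trans (hs.trans (sameCycle_traceMin y).symm)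

/-- A noncrossing permutation of the slit annulus is determined by its words and marks. -/
lemma Noncrossing.eq_of_words (h : Noncrossing slitPos π) {π' : Perm (Pt n m)}
    (h' : Noncrossing slitPos π') (h1 : extWord π = extWord π') (h2 : extMarks π = extMarks π')
    (h3 : intWord π = intWord π') (h4 : intMarks π = intMarks π') : π = π' := by
  have e : (traceMin Sum.inl π : Fin n → Fin n) = traceMin Sum.inl π' := by
    ext x
    rw [← h.isBlockMin_ext.blockStart_blockWord, ← h'.isBlockMin_ext.blockStart_blockWord]
    exact congrArg (fun w => ((blockStart w x : Fin n) : ℕ)) h1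
  have i : (traceMin Sum.inr π : Fin m → Fin m) = traceMin Sum.inr π' := by
    ext x
    rw [← h.isBlockMin_int.blockStart_blockWord, ← h'.isBlockMin_int.blockStart_blockWord]
    exact congrArg (fun w => ((blockStart w x : Fin m) : ℕ)) h3
  have key : ∀ x y, π.SameCycle (Sum.inl x) (Sum.inr y) ↔ π'.SameCycle (Sum.inl x) (Sum.inr y) := by
    intro x y
    rw [h.sameCycle_inl_inr_iff, h'.sameCycle_inl_inr_iff, e, i, h2, h4]
  refine h.clockwise.eq_of_sameCycle_iff slitPos_injective h'.clockwise ?_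
  rintro (x | x) (y | y)
  · rw [← traceMin_eq_iff, ← traceMin_eq_iff, e]
  · exact key x y
  · rw [Perm.sameCycle_comm, key y x, Perm.sameCycle_comm]
  · rw [← traceMin_eq_iff, ← traceMin_eq_iff, i]

variable [NeZero n] [NeZero m]

/-- A permutation of the annulus that is noncrossing when the annulus is slit, and such that both
sides of the slit start with an element of a connected cycle. -/
structure IsRooted (π : Perm (Pt n m)) : Prop where
  nc : Noncrossing slitPos π
  ext : 0 ∈ extMarks π
  int : 0 ∈ intMarks π

lemma blockWord_pos {k : ℕ} {μ : Fin k → Fin k} {a : Fin k} (h : μ a = a) : 0 < blockWord μ a :=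
  Finset.card_pos.2 ⟨a, by simp [h]⟩

lemma IsRooted.isRootedWord_ext (h : IsRooted π) : IsRootedWord (extWord π) (extMarks π) where
  luk := h.nc.isBlockMin_ext.isLukasiewicz
  zero_mem := h.ext
  height_eq _ ha := h.nc.height_extWord ha
  pos _ ha := blockWord_pos (h.nc.clockwise.mem_extMarks_iff.1 ha).1

lemma IsRooted.isRootedWord_int (h : IsRooted π) : IsRootedWord (intWord π) (intMarks π) where
  luk := h.nc.isBlockMin_int.isLukasiewicz
  zero_mem := h.int
  height_eq _ ha := h.nc.height_intWord ha
  pos _ ha := blockWord_pos (h.nc.clockwise.mem_intMarks_iff.1 ha).1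

/-- Any two rooted words with equally many marks come from a noncrossing permutation. -/
lemma exists_isRooted {F : Fin n → ℕ} {A : Finset (Fin n)} {G : Fin m → ℕ} {B : Finset (Fin m)}
    (hF : IsRootedWord F A) (hG : IsRootedWord G B) (hAB : A.card = B.card) :
    ∃ π : Perm (Pt n m), IsRooted π ∧ extWord π = F ∧ extMarks π = A ∧ intWord π = G ∧
      intMarks π = B := by
  classical
  -- the labels of the blocks: a rank for a connected cycle, the first element for any other one
  let L : Pt n m → ℕ × ℕ := Sum.elim
    (fun x => if blockStart F x ∈ A then (0, countBelow A (blockStart F x))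
      else (1, (blockStart F x : ℕ)))
    (fun y => if blockStart G y ∈ B then (0, countAbove B (blockStart G y))
      else (2, (blockStart G y : ℕ)))
  obtain ⟨π, hcl, hs⟩ := exists_clockwise (X := Pt n m) slitPos_injective L
  have hee : ∀ x x', π.SameCycle (Sum.inl x) (Sum.inl x') ↔ blockStart F x = blockStart F x' := by
    intro x x'
    rw [hs]
    simp only [L, Sum.elim_inl]
    constructor
    · split_ifs with h1 h2 h2 <;> intro h <;> simp only [Prod.mk.injEq, true_and] at h
      · exact countBelow_inj h1 h2 h
      · omega
      · omega
      · exact Fin.ext h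
    · intro h; rw [h]
  have hii : ∀ x x', π.SameCycle (Sum.inr x) (Sum.inr x') ↔ blockStart G x = blockStart G x' := by
    intro x x'
    rw [hs]
    simp only [L, Sum.elim_inr]
    constructor
    · split_ifs with h1 h2 h2 <;> intro h <;> simp only [Prod.mk.injEq, true_and] at h
      · exact countAbove_inj h1 h2 h
      · omega
      · omega
      · exact Fin.ext h
    · intro h; rw [h]
  have hei : ∀ x y, π.SameCycle (Sum.inl x) (Sum.inr y) ↔ blockStart F x ∈ A ∧ blockStart G y ∈ B ∧
      countBelow A (blockStart F x) = countAbove B (blockStart G y) := by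
    intro x y
    rw [hs]
    simp only [L, Sum.elim_inr, Sum.elim_inl]
    split_ifs with h1 h2 h2 <;> simp [h1, h2]
  have hnc : Noncrossing slitPos π := by
    refine ⟨hcl, ?_⟩
    rintro (x | x) (y | y) (z | z) (w | w) hxy hyz hzw hxz hyw <;>
      simp only [slitPos_inl, slitPos_inr, add_lt_add_iff_left, Fin.val_fin_lt] at hxy hyz hzw <;>
      first | omega | skip
    · exact (hee _ _).2 (hF.luk.noncrossing hxy hyz hzw ((hee _ _).1 hxz) ((hee _ _).1 hyw))
    · exact (hee _ _).2 (hF.luk.blockStart_eq_of_between hxy hyz ((hee _ _).1 hxz)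
        (hF.height_eq _ ((hei _ _).1 hyw).1))
    · obtain ⟨a1, b1, e1⟩ := (hei _ _).1 hxz
      obtain ⟨a2, b2, e2⟩ := (hei _ _).1 hyw
      rw [hee]
      have l1 := hF.luk.le_blockStart (hF.height_eq _ a1) ((hF.luk.blockStart_le x).trans hxy.le)
      have l2 := hG.luk.le_blockStart (hG.height_eq _ b1) ((hG.luk.blockStart_le z).trans hzw.le)
      rcases l1.eq_or_lt with h | h
      · exact h
      · exfalso
        have m1 := countBelow_lt_of_lt a1 h
        rcases l2.eq_or_lt with h' | h'
        · rw [h'] at e1; omega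
        · have m2 := countAbove_lt_of_lt b2 h'
          omega
    · have h1 := hG.luk.blockStart_eq_of_between hyz hzw ((hii _ _).1 hyw)
        (hG.height_eq _ ((hei _ _).1 hxz).2.1)
      exact hxz.trans ((hii _ _).2 h1.symm)
    · exact (hii _ _).2 (hG.luk.noncrossing hxy hyz hzw ((hii _ _).1 hxz) ((hii _ _).1 hyw))
  have te : (traceMin Sum.inl π : Fin n → Fin n) = blockStart F :=
    funext (traceMin_eq_blockStart hF.luk hee)
  have ti : (traceMin Sum.inr π : Fin m → Fin m) = blockStart G :=
    funext (traceMin_eq_blockStart hG.luk hii)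
  have we : extWord π = F := by
    funext y; rw [extWord, te]; exact hF.luk.card_fiber y
  have wi : intWord π = G := by
    funext y; rw [intWord, ti]; exact hG.luk.card_fiber y
  have me : extMarks π = A := by
    ext x
    rw [hcl.mem_extMarks_iff, te]
    constructor
    · rintro ⟨h1, y, h2⟩
      rw [← h1]
      exact ((hei _ _).1 h2).1
    · intro hx
      have h1 := hF.luk.blockStart_eq_self (hF.pos x hx)
      obtain ⟨b, hb, h2⟩ := exists_countAbove_eq (A := B) (j := countBelow A x)
        (hAB ▸ countBelow_lt_card hx)
      have h3 := hG.luk.blockStart_eq_self (hG.pos b hb)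
      exact ⟨h1, b, (hei _ _).2 ⟨by rwa [h1], by rwa [h3], by rw [h1, h3, h2]⟩⟩
  have mi : intMarks π = B := by
    ext y
    rw [hcl.mem_intMarks_iff, ti]
    constructor
    · rintro ⟨h1, x, h2⟩
      rw [← h1]
      exact ((hei _ _).1 h2).2.1
    · intro hy
      have h1 := hG.luk.blockStart_eq_self (hG.pos y hy)
      obtain ⟨a, ha, h2⟩ := exists_countBelow_eq (A := A) (j := countAbove B y)
        (hAB ▸ countAbove_lt_card hy)
      have h3 := hF.luk.blockStart_eq_self (hF.pos a ha)
      exact ⟨h1, a, (hei _ _).2 ⟨by rwa [h3], by rwa [h1], by rw [h1, h3, h2]⟩⟩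
  exact ⟨π, ⟨hnc, me ▸ hF.zero_mem, mi ▸ hG.zero_mem⟩, we, me, wi, mi⟩

end rooted
end AnnularCSP
end

noncomputable section
namespace AnnularCSP

open Equiv

/-! ### Rotations of the two circles -/

section rotations
variable {n m : ℕ} [NeZero n] [NeZero m]

/-- The rotation of the exterior circle by `s` and of the interior circle by `t`. -/
def rot (s : Fin n) (t : Fin m) : Perm (Pt n m) :=
  Equiv.sumCongr (Equiv.addRight s) (Equiv.addRight t)

@[simp] lemma rot_inl (s : Fin n) (t : Fin m) (x : Fin n) :
    rot s t (Sum.inl x) = Sum.inl (x + s) := rfl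

@[simp] lemma rot_inr (s : Fin n) (t : Fin m) (y : Fin m) :
    rot s t (Sum.inr y) = Sum.inr (y + t) := rfl

lemma rot_mul_rot (s s' : Fin n) (t t' : Fin m) : rot s t * rot s' t' = rot (s + s') (t + t') := by
  ext (x | x)
  · simp [Perm.mul_apply]; abel
  · simp [Perm.mul_apply]; abel

lemma rot_zero_zero : rot (0 : Fin n) (0 : Fin m) = 1 := by
  ext (x | x) <;> simp

lemma rot_inv (s : Fin n) (t : Fin m) : (rot s t)⁻¹ = rot (-s) (-t) := by
  rw [inv_eq_iff_mul_eq_one, rot_mul_rot]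
  simp [rot_zero_zero]

/-- The permutation `π` after a rotation of the two circles. -/
def turn (s : Fin n) (t : Fin m) (π : Perm (Pt n m)) : Perm (Pt n m) :=
  rot s t * π * (rot s t)⁻¹

variable {π : Perm (Pt n m)}

lemma turn_turn (s s' : Fin n) (t t' : Fin m) (π : Perm (Pt n m)) :
    turn s t (turn s' t' π) = turn (s + s') (t + t') π := by
  simp only [turn, ← rot_mul_rot, mul_inv_rev, mul_assoc]

@[simp] lemma turn_zero (π : Perm (Pt n m)) : turn 0 0 π = π := by
  simp [turn, rot_zero_zero]

lemma turn_eq_iff {s : Fin n} {t : Fin m} {π π' : Perm (Pt n m)} :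
    turn s t π = π' ↔ π = turn (-s) (-t) π' := by
  constructor
  · rintro rfl; rw [turn_turn]; simp
  · rintro rfl; rw [turn_turn]; simp

lemma turn_apply_rot (s : Fin n) (t : Fin m) (x : Pt n m) :
    turn s t π (rot s t x) = rot s t (π x) := by
  simp [turn, Perm.mul_apply]

lemma sameCycle_turn (s : Fin n) (t : Fin m) (x y : Pt n m) :
    (turn s t π).SameCycle (rot s t x) (rot s t y) ↔ π.SameCycle x y := by
  rw [turn, Perm.sameCycle_conj]
  simp

lemma sameCycle_turn_inl (s : Fin n) (t : Fin m) (x y : Fin n) :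
    (turn s t π).SameCycle (Sum.inl x) (Sum.inl y) ↔
      π.SameCycle (Sum.inl (x - s)) (Sum.inl (y - s)) := by
  rw [← sameCycle_turn (π := π) s t (Sum.inl (x - s)) (Sum.inl (y - s))]
  simp

lemma sameCycle_turn_inr (s : Fin n) (t : Fin m) (x y : Fin m) :
    (turn s t π).SameCycle (Sum.inr x) (Sum.inr y) ↔
      π.SameCycle (Sum.inr (x - t)) (Sum.inr (y - t)) := by
  rw [← sameCycle_turn (π := π) s t (Sum.inr (x - t)) (Sum.inr (y - t))]
  simp

lemma sameCycle_turn_inl_inr (s : Fin n) (t : Fin m) (x : Fin n) (y : Fin m) :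
    (turn s t π).SameCycle (Sum.inl x) (Sum.inr y) ↔
      π.SameCycle (Sum.inl (x - s)) (Sum.inr (y - t)) := by
  rw [← sameCycle_turn (π := π) s t (Sum.inl (x - s)) (Sum.inr (y - t))]
  simp

lemma mem_extMarks_turn (s : Fin n) (t : Fin m) (x : Fin n) :
    x ∈ extMarks (turn s t π) ↔ x - s ∈ extMarks π := by
  simp only [mem_extMarks]
  constructor
  · rintro ⟨y, hy⟩
    refine ⟨y - t, (rot s t).injective ?_⟩
    rw [← turn_apply_rot]
    simpa using hy
  · rintro ⟨y, hy⟩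
    refine ⟨y + t, ?_⟩
    have := turn_apply_rot (π := π) s t (Sum.inr y)
    rw [hy] at this
    simpa using this

lemma mem_intMarks_turn (s : Fin n) (t : Fin m) (y : Fin m) :
    y ∈ intMarks (turn s t π) ↔ y - t ∈ intMarks π := by
  simp only [mem_intMarks]
  constructor
  · rintro ⟨x, hx⟩
    refine ⟨x - s, (rot s t).injective ?_⟩
    rw [← turn_apply_rot]
    simpa using hx
  · rintro ⟨x, hx⟩
    refine ⟨x + s, ?_⟩
    have := turn_apply_rot (π := π) s t (Sum.inl x)
    rw [hx] at this
    simpa using this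

lemma turn_eq_permCongr (s : Fin n) (t : Fin m) : turn s t π = (rot s t).permCongr π := by
  ext x
  simp [turn, Perm.mul_apply, Perm.inv_def]

lemma noncrossing_turn_iff (s : Fin n) (t : Fin m) :
    Noncrossing slitPos (turn s t π) ↔ Noncrossing (fun x => slitPos (rot s t x)) π := by
  rw [turn_eq_permCongr, noncrossing_permCongr_iff]

lemma finRotate_pow_apply {k : ℕ} [NeZero k] (a : ℕ) (x : Fin k) :
    (finRotate k ^ a) x = x + Fin.ofNat k a := by
  induction a with
  | zero => simp
  | succ a ih =>
    rw [pow_succ', Perm.mul_apply, ih, finRotate_apply, add_assoc]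
    congr 1
    ext
    simp [Fin.val_add]

lemma slit_val (a b : ℕ) (x : Pt n m) :
    ((slit n m a b x : Fin (n + m)) : ℕ) = slitPos (rot (Fin.ofNat n a) (Fin.ofNat m b) x) := by
  rcases x with x | x <;> simp [slit, finRotate_pow_apply]

lemma isAnnularNoncrossing_iff :
    IsAnnularNoncrossing π ↔ ∃ s t, Noncrossing slitPos (turn s t π) := by
  simp only [noncrossing_turn_iff]
  constructor
  · rintro ⟨a, b, h⟩
    rw [isDiskNoncrossing_iff, noncrossing_permCongr_iff] at h
    simp only [slit_val] at h
    exact ⟨_, _, h⟩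
  · rintro ⟨s, t, h⟩
    refine ⟨s, t, ?_⟩
    rw [isDiskNoncrossing_iff, noncrossing_permCongr_iff]
    simp only [slit_val, Fin.ofNat_val_eq_self]
    exact h

lemma fin_val_sub {k : ℕ} (x a : Fin k) :
    ((x - a : Fin k) : ℕ) = if a ≤ x then (x : ℕ) - a else x + k - a := by
  have hx := x.2
  have ha := a.2
  rw [Fin.sub_def]
  simp only [Fin.le_def]
  split_ifs with h
  · rw [show k - (a : ℕ) + x = (x - a) + k by omega, Nat.add_mod_right, Nat.mod_eq_of_lt (by omega)]
  · rw [Nat.mod_eq_of_lt (by omega)]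
    omega

/-! ### Moving the slit -/

/-- If the points are coloured such that cycles are monochromatic, a change of the positions which
keeps the order within each colour and does not interlace two colours preserves noncrossing
permutations. -/
lemma Noncrossing.of_colouring {X : Type*} {pos pos' : X → ℕ} {σ : Perm X} {C : Type*} (col : X → C)
    (h : Noncrossing pos σ) (hcol : ∀ x y, σ.SameCycle x y → col x = col y)
    (hmono : ∀ x y, col x = col y → pos' x < pos' y → pos x < pos y)
    (hsep : ∀ x y z w, pos' x < pos' y → pos' y < pos' z → pos' z < pos' w → col x = col z →
      col y = col w → col x = col y) : Noncrossing pos' σ := by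
  constructor
  · intro x y hxy hc
    apply h.clockwise x y hxy
    have e1 := hcol _ _ hxy
    have e2 := hcol _ _ (sameCycle_apply_self σ x)
    rcases hc with ⟨a, b⟩ | ⟨a, b⟩ | ⟨a, b⟩
    · exact Or.inl ⟨hmono _ _ e1 a, hmono _ _ (e1.symm.trans e2) b⟩
    · exact Or.inr (Or.inl ⟨hmono _ _ (e1.symm.trans e2) a, hmono _ _ e2.symm b⟩)
    · exact Or.inr (Or.inr ⟨hmono _ _ e2.symm a, hmono _ _ e1 b⟩)
  · intro x y z w hxy hyz hzw hxz hyw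
    have e1 := hcol _ _ hxz
    have e2 := hcol _ _ hyw
    have e3 := hsep x y z w hxy hyz hzw e1 e2
    exact h.blocks x y z w (hmono _ _ e3 hxy) (hmono _ _ (e3.symm.trans e1) hyz)
      (hmono _ _ (e1.symm.trans (e3.trans e2)) hzw) hxz hyw

/-- The slit may be moved to start just before the connected cycle that begins at `a` and to end
just before the first interior element `b` of the preceding connected cycle. -/
lemma Noncrossing.move_slit (h : Noncrossing slitPos π) {a : Fin n} {b : Fin m}
    (ha : a ∈ extMarks π) (hb : b ∈ intMarks π)
    (hab : countBelow (extMarks π) a = countAbove (intMarks π) b + 1 ∨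
      countBelow (extMarks π) a = 0 ∧ countAbove (intMarks π) b + 1 = (intMarks π).card) :
    Noncrossing slitPos (turn (-a) (-b) π) := by
  rw [noncrossing_turn_iff]
  have hpl : ∀ x : Fin n, (slitPos (rot (-a) (-b) (Sum.inl x)) : ℕ) =
      if a ≤ x then (x : ℕ) - a else x + n - a := by
    intro x
    rw [rot_inl, slitPos_inl, ← sub_eq_add_neg, fin_val_sub]
  have hpr : ∀ y : Fin m, (slitPos (rot (-a) (-b) (Sum.inr y)) : ℕ) =
      n + if b ≤ y then (y : ℕ) - b else y + m - b := by
    intro y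
    rw [rot_inr, slitPos_inr, ← sub_eq_add_neg, fin_val_sub]
  have ha2 := a.2
  have hb2 := b.2
  rcases hab with hab | ⟨ha0, hb0⟩
  · -- two colours: the cycles before `a` and the cycles from `a` on
    have hmix : ∀ x y, π.SameCycle (Sum.inl x) (Sum.inr y) → (x < a ↔ ¬ y < b) := by
      intro x y hxy
      obtain ⟨h1, h2, h3⟩ := h.exists_intMark hxy
      have h4 := h.countBelow_eq_countAbove h1 h2 h3
      rw [h.lt_extMark_iff ha (sameCycle_traceMin x), h.lt_intMark_iff hb (sameCycle_traceMin y)]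
      constructor
      · intro hlt hlt'
        have := countBelow_lt_of_lt h1 hlt
        have := countAbove_lt_of_lt hb hlt'
        omega
      · intro hge
        by_contra hge'
        have h5 : countBelow (extMarks π) a ≤ countBelow (extMarks π) (traceMin Sum.inl π x) := by
          rcases (not_lt.1 hge').eq_or_lt with e | e
          · rw [← e]
          · exact (countBelow_lt_of_lt ha e).le
        have h6 : countAbove (intMarks π) (traceMin Sum.inr π y) ≤ countAbove (intMarks π) b := by
          rcases (not_lt.1 hge).eq_or_lt with e | e
          · rw [← e]
          · exact (countAbove_lt_of_lt h2 e).le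
        omega
    refine h.of_colouring (Sum.elim (fun x => x < a) (fun y => ¬ y < b)) ?_ ?_ ?_
    · rintro (x | x) (y | y) hxy
      · exact propext (h.lt_extMark_iff ha hxy)
      · exact propext (hmix x y hxy)
      · exact propext (hmix y x hxy.symm).symm
      · exact propext (not_congr (h.lt_intMark_iff hb hxy))
    · rintro (x | x) (y | y) hc hlt <;>
        simp only [hpl, hpr, Sum.elim_inl, Sum.elim_inr, eq_iff_iff, slitPos_inl, slitPos_inr,
          Fin.le_def, Fin.lt_def] at hc hlt ⊢ <;> split_ifs at hlt <;> omega
    · -- the cycles before `a` now occupy an interval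
      have hint : ∀ x, Sum.elim (fun x => x < a) (fun y => ¬ y < b) x ↔
          n - a ≤ slitPos (rot (-a) (-b) x) ∧ slitPos (rot (-a) (-b) x) < n + m - b := by
        rintro (x | x) <;>
          simp only [hpl, hpr, Sum.elim_inl, Sum.elim_inr, Fin.le_def, Fin.lt_def] <;>
          split_ifs <;> omega
      intro x y z w hxy hyz hzw hxz hyw
      simp only [eq_iff_iff, hint] at hxz hyw ⊢
      omega
  · -- `a` is the first exterior mark and `b` the first interior mark
    have hamin : ∀ a' ∈ extMarks π, a ≤ a' := by
      intro a' ha'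
      by_contra hcon
      have := countBelow_lt_of_lt ha' (not_le.1 hcon)
      omega
    have hbmin : ∀ b' ∈ intMarks π, b ≤ b' := by
      intro b' hb'
      by_contra hcon
      have h1 := countAbove_lt_of_lt hb (not_le.1 hcon)
      have h2 := countAbove_lt_card hb'
      omega
    have hmix : ∀ x y, π.SameCycle (Sum.inl x) (Sum.inr y) → ¬ x < a ∧ ¬ y < b := by
      intro x y hxy
      obtain ⟨h1, h2, h3⟩ := h.exists_intMark hxy
      rw [h.lt_extMark_iff ha (sameCycle_traceMin x), h.lt_intMark_iff hb (sameCycle_traceMin y)]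
      exact ⟨not_lt.2 (hamin _ h1), not_lt.2 (hbmin _ h2)⟩
    refine h.of_colouring (Sum.elim (fun x => if x < a then 0 else 1)
      (fun y => if y < b then 2 else 1) : Pt n m → ℕ) ?_ ?_ ?_
    · rintro (x | x) (y | y) hxy
      · simp only [Sum.elim_inl, h.lt_extMark_iff ha hxy]
      · simp [hmix x y hxy]
      · simp [hmix y x hxy.symm]
      · simp only [Sum.elim_inr, h.lt_intMark_iff hb hxy]
    · rintro (x | x) (y | y) hc hlt <;>
        simp only [hpl, hpr, Sum.elim_inl, Sum.elim_inr, slitPos_inl, slitPos_inr,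
          Fin.le_def, Fin.lt_def] at hc hlt ⊢ <;> split_ifs at hlt hc <;> omega
    · have hint : ∀ x : Pt n m, (Sum.elim (fun x => if x < a then 0 else 1)
          (fun y => if y < b then 2 else 1) : Pt n m → ℕ) x =
          if n - a ≤ slitPos (rot (-a) (-b) x) ∧ slitPos (rot (-a) (-b) x) < n then 0
          else if n + m - b ≤ slitPos (rot (-a) (-b) x) then 2 else 1 := by
        rintro (x | x) <;>
          simp only [hpl, hpr, Sum.elim_inl, Sum.elim_inr, Fin.le_def, Fin.lt_def] <;>
          split_ifs <;> omega
      have hub : ∀ x : Pt n m, slitPos (rot (-a) (-b) x) < n + m := by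
        rintro (x | x) <;> simp only [hpl, hpr, Fin.le_def] <;> split_ifs <;> omega
      intro x y z w hxy hyz hzw hxz hyw
      have := hub w
      simp only [hint] at hxz hyw ⊢
      split_ifs at hxz hyw ⊢ <;> omega

end rotations
end AnnularCSP
end

noncomputable section
namespace AnnularCSP

open Equiv

/-! ### Words and cycle types under rotations -/

section shift

/-- The word of block sizes, read from another starting point `a` that no block straddles. -/
lemma blockWord_traceMin_shift {X : Type*} {k : ℕ} [NeZero k] {ι : Fin k → X} {π π' : Perm X}
    {a : Fin k}
    (hs : ∀ x y, π'.SameCycle (ι x) (ι y) ↔ π.SameCycle (ι (x + a)) (ι (y + a)))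
    (hlt : ∀ x y, π.SameCycle (ι x) (ι y) → (x < a ↔ y < a)) (x : Fin k) :
    blockWord (traceMin ι π') x = blockWord (traceMin ι π) (x + a) := by
  have key : ∀ x, traceMin ι π' x = traceMin ι π (x + a) - a := by
    intro x
    apply le_antisymm
    · apply traceMin_le
      rw [hs, sub_add_cancel]
      exact sameCycle_traceMin _
    · have h1 := (hs _ _).1 (sameCycle_traceMin (ι := ι) (π := π') x)
      have h2 := traceMin_le h1
      have h3 := hlt _ _ ((sameCycle_traceMin (ι := ι) (π := π) (x + a)).symm.trans h1)
      set u := traceMin ι π (x + a)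
      set v := traceMin ι π' x
      have h4 := fin_val_sub (v + a) a
      rw [add_sub_cancel_right] at h4
      have h5 := fin_val_sub u a
      have h6 := u.2
      have h7 := (v + a).2
      rw [Fin.le_def] at h2 ⊢
      rw [Fin.lt_def, Fin.lt_def] at h3
      rw [h4, h5]
      simp only [Fin.le_def]
      split_ifs <;> omega
  refine Finset.card_equiv (Equiv.addRight a) fun z => ?_
  simp only [Finset.mem_filter, Finset.mem_univ, true_and, Equiv.coe_addRight, key]
  exact sub_eq_iff_eq_add

variable {n m : ℕ} [NeZero n] [NeZero m] {π : Perm (Pt n m)}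

lemma Noncrossing.extWord_turn (h : Noncrossing slitPos π) {a : Fin n} (ha : a ∈ extMarks π)
    (t : Fin m) (x : Fin n) : extWord (turn (-a) t π) x = extWord π (x + a) :=
  blockWord_traceMin_shift (fun x y => by rw [sameCycle_turn_inl]; simp)
    (fun _ _ hxy => h.lt_extMark_iff ha hxy) x

lemma Noncrossing.intWord_turn (h : Noncrossing slitPos π) {b : Fin m} (hb : b ∈ intMarks π)
    (s : Fin n) (y : Fin m) : intWord (turn s (-b) π) y = intWord π (y + b) :=
  blockWord_traceMin_shift (fun x y => by rw [sameCycle_turn_inr]; simp)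
    (fun _ _ hxy => h.lt_intMark_iff hb hxy) y

lemma IsRooted.periodic_of_turn_eq (h : IsRooted π) {s : Fin n} {t : Fin m}
    (hfix : turn s (-t) π = π) :
    ((∀ x, extWord π (x + s) = extWord π x) ∧ ∀ x, x + s ∈ extMarks π ↔ x ∈ extMarks π) ∧
      (∀ y, intWord π (y + t) = intWord π y) ∧ ∀ y, y + t ∈ intMarks π ↔ y ∈ intMarks π := by
  have hfix' : turn (-s) t π = π := by
    have h1 := turn_eq_iff.1 hfix
    rw [neg_neg] at h1
    exact h1.symm
  have hA : ∀ x, x + s ∈ extMarks π ↔ x ∈ extMarks π := by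
    intro x
    conv_lhs => rw [← hfix, mem_extMarks_turn]
    simp
  have hB : ∀ y, y + t ∈ intMarks π ↔ y ∈ intMarks π := by
    intro y
    conv_rhs => rw [← hfix, mem_intMarks_turn]
    simp
  have hs : s ∈ extMarks π := by simpa using (hA 0).2 h.ext
  have ht : t ∈ intMarks π := by simpa using (hB 0).2 h.int
  refine ⟨⟨fun x => ?_, hA⟩, fun y => ?_, hB⟩
  · rw [← h.nc.extWord_turn hs t, hfix']
  · rw [← h.nc.intWord_turn ht s, hfix]

lemma IsRooted.turn_eq_of_periodic (h : IsRooted π) {s : Fin n} {t : Fin m}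
    (hF : ∀ x, extWord π (x + s) = extWord π x) (hA : ∀ x, x + s ∈ extMarks π ↔ x ∈ extMarks π)
    (hG : ∀ y, intWord π (y + t) = intWord π y) (hB : ∀ y, y + t ∈ intMarks π ↔ y ∈ intMarks π)
    (hc : countBelow (extMarks π) s = countAbove (intMarks π) (-t) + 1 ∨
      countBelow (extMarks π) s = 0 ∧ countAbove (intMarks π) (-t) + 1 = (intMarks π).card) :
    turn s (-t) π = π := by
  have hs : s ∈ extMarks π := by simpa using (hA 0).2 h.ext
  have ht : -t ∈ intMarks π := by
    rw [← hB]; simpa using h.int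
  have hnc := h.nc.move_slit hs ht hc
  have : turn (-s) (- -t) π = π := by
    refine hnc.eq_of_words h.nc ?_ ?_ ?_ ?_
    · funext x
      rw [h.nc.extWord_turn hs, hF]
    · ext x
      rw [mem_extMarks_turn, sub_neg_eq_add, hA]
    · funext y
      rw [h.nc.intWord_turn ht, ← hG]
      simp
    · ext y
      rw [mem_intMarks_turn, ← hB]
      simp
  exact ((turn_eq_iff.1 this).trans (by simp)).symm

lemma countAbove_zero {k : ℕ} [NeZero k] {B : Finset (Fin k)} (hB : 0 ∈ B) :
    countAbove B 0 + 1 = B.card := by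
  rw [countAbove, ← Finset.card_erase_add_one hB]
  congr 2
  ext x
  simp only [Finset.mem_filter, Finset.mem_erase, Fin.pos_iff_ne_zero]
  tauto

/-- A slit next to the connected cycle that begins at `a` exists in only one way. -/
lemma IsRooted.eq_zero_of_turn (h : IsRooted π) {t : Fin m} (h' : IsRooted (turn 0 t π)) : t = 0 := by
  have hA : extMarks (turn 0 t π) = extMarks π := by
    ext x; rw [mem_extMarks_turn, sub_zero]
  obtain ⟨a₁, ha₁, hs₁⟩ := h.nc.exists_mem_extMarks h.int
  obtain ⟨a₂, ha₂, hs₂⟩ := h'.nc.exists_mem_extMarks h'.int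
  have c₁ := h.nc.countBelow_eq_countAbove ha₁ h.int hs₁
  have c₂ := h'.nc.countBelow_eq_countAbove ha₂ h'.int hs₂
  have e₁ := countAbove_zero h.int
  have e₂ := countAbove_zero h'.int
  rw [← h.nc.card_marks] at e₁
  rw [← h'.nc.card_marks] at e₂
  rw [hA] at c₂ ha₂ e₂
  have : a₁ = a₂ := countBelow_inj ha₁ ha₂ (by omega)
  subst this
  rw [sameCycle_turn_inl_inr, sub_zero] at hs₂
  have h3 := h'.int
  rw [mem_intMarks_turn] at h3
  have := h.nc.intMarks_inj h.int h3 (hs₁.symm.trans hs₂)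
  simpa using this.symm

/-- Every annular noncrossing permutation can be slit next to each of its connected cycles. -/
lemma exists_isRooted_turn (h : IsAnnularNoncrossing π) {a : Fin n} (ha : a ∈ extMarks π) :
    ∃ b : Fin m, IsRooted (turn (-a) (-b) π) := by
  obtain ⟨s, t, hnc⟩ := isAnnularNoncrossing_iff.1 h
  have ha' : a + s ∈ extMarks (turn s t π) := by rw [mem_extMarks_turn]; simpa using ha
  set σ := turn s t π with hσ
  have hcard := hnc.card_marks
  have hpos : 0 < (extMarks σ).card := Finset.card_pos.2 ⟨_, ha'⟩
  have hlt := countBelow_lt_card ha'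
  obtain ⟨b, hb, hab⟩ : ∃ b ∈ intMarks σ,
      countBelow (extMarks σ) (a + s) = countAbove (intMarks σ) b + 1 ∨
      countBelow (extMarks σ) (a + s) = 0 ∧ countAbove (intMarks σ) b + 1 = (intMarks σ).card := by
    rcases Nat.eq_zero_or_pos (countBelow (extMarks σ) (a + s)) with h0 | h0
    · obtain ⟨b, hb, he⟩ := exists_countAbove_eq (A := intMarks σ) (j := (intMarks σ).card - 1)
        (by omega)
      exact ⟨b, hb, Or.inr ⟨h0, by omega⟩⟩
    · obtain ⟨b, hb, he⟩ := exists_countAbove_eq (A := intMarks σ)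
        (j := countBelow (extMarks σ) (a + s) - 1) (by omega)
      exact ⟨b, hb, Or.inl (by omega)⟩
  have h1 := hnc.move_slit ha' hb hab
  refine ⟨b - t, ?_⟩
  have e : turn (-(a + s)) (-b) σ = turn (-a) (-(b - t)) π := by
    rw [hσ, turn_turn]
    congr 1 <;> abel
  rw [← e]
  refine ⟨h1, ?_, ?_⟩
  · rw [mem_extMarks_turn]; simpa using ha'
  · rw [mem_intMarks_turn]; simpa using hb

end shift

/-! ### Cycle types -/

section types
variable {n m : ℕ} {π : Perm (Pt n m)}

/-- The cycle of `x`. -/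
def cycleSet (π : Perm (Pt n m)) (x : Pt n m) : Finset (Pt n m) :=
  Finset.univ.filter fun y => π.SameCycle x y

lemma mem_cycleSet {x y : Pt n m} : y ∈ cycleSet π x ↔ π.SameCycle x y := by simp [cycleSet]

lemma cycleSet_eq_iff {x y : Pt n m} : cycleSet π x = cycleSet π y ↔ π.SameCycle x y := by
  constructor
  · intro h
    have : y ∈ cycleSet π y := mem_cycleSet.2 (Perm.SameCycle.refl _ _)
    rw [← h] at this
    exact mem_cycleSet.1 this
  · intro h
    ext z
    rw [mem_cycleSet, mem_cycleSet]
    exact ⟨fun h' => h.symm.trans h', fun h' => h.trans h'⟩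

lemma mem_cycles {B : Finset (Pt n m)} : B ∈ cycles π ↔ ∃ x, cycleSet π x = B := by
  simp [cycles, cycleSet]

lemma map_val_image {α β γ : Type*} [DecidableEq β] {s : Finset α} {f : α → β} (g : β → γ)
    (hf : Set.InjOn f s) : (s.image f).val.map g = s.val.map fun x => g (f x) := by
  rw [Finset.image_val_of_injOn hf, Multiset.map_map]
  rfl

lemma card_toLeft_cycleSet {a : Fin n} (ha : traceMin Sum.inl π a = a) :
    (cycleSet π (Sum.inl a)).toLeft.card = extWord π a := by
  unfold extWord blockWord
  congr 1
  ext x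
  simp only [Finset.mem_toLeft, mem_cycleSet, Finset.mem_filter, Finset.mem_univ, true_and]
  conv_rhs => rw [← ha]
  rw [traceMin_eq_iff, Perm.sameCycle_comm]

lemma card_toRight_cycleSet {b : Fin m} (hb : traceMin Sum.inr π b = b) :
    (cycleSet π (Sum.inr b)).toRight.card = intWord π b := by
  unfold intWord blockWord
  congr 1
  ext x
  simp only [Finset.mem_toRight, mem_cycleSet, Finset.mem_filter, Finset.mem_univ, true_and]
  conv_rhs => rw [← hb]
  rw [traceMin_eq_iff, Perm.sameCycle_comm]

lemma blockWord_pos_iff {k : ℕ} {μ : Fin k → Fin k} (h : ∀ x, μ (μ x) = μ x) {a : Fin k} :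
    0 < blockWord μ a ↔ μ a = a := by
  constructor
  · intro hp
    obtain ⟨x, hx⟩ := Finset.card_pos.1 hp
    have := (Finset.mem_filter.1 hx).2
    rw [← this, h]
  · exact blockWord_pos

/-- A word together with a set of marked positions. -/
abbrev MarkedWord (k : ℕ) : Type := (Fin k → ℕ) × Finset (Fin k)

/-- The multiset of the nonzero letters at the positions that are not marked. -/
def offType {k : ℕ} (w : MarkedWord k) : Multiset ℕ :=
  (Finset.univ.filter fun x => x ∉ w.2 ∧ 0 < w.1 x).val.map w.1

/-- The multiset of the letters at the marked positions. -/
def onType {k : ℕ} (w : MarkedWord k) : Multiset ℕ := w.2.val.map w.1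

lemma Noncrossing.connCycles_eq_ext (h : Noncrossing slitPos π) :
    connCycles π = (extMarks π).image fun a => cycleSet π (Sum.inl a) := by
  ext B
  simp only [connCycles, Finset.mem_filter, mem_cycles, Finset.mem_image]
  constructor
  · rintro ⟨⟨x, rfl⟩, ⟨x', hx'⟩, ⟨y', hy'⟩⟩
    rw [Finset.mem_toLeft, mem_cycleSet] at hx'
    rw [Finset.mem_toRight, mem_cycleSet] at hy'
    obtain ⟨h1, -, -⟩ := h.exists_intMark (hx'.symm.trans hy')
    exact ⟨_, h1, cycleSet_eq_iff.2 (hx'.trans (sameCycle_traceMin x')).symm⟩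
  · rintro ⟨a, ha, rfl⟩
    obtain ⟨-, y, hy⟩ := h.clockwise.mem_extMarks_iff.1 ha
    exact ⟨⟨_, rfl⟩, ⟨a, by simp [mem_cycleSet, Perm.SameCycle.refl]⟩,
      ⟨y, by simpa [mem_cycleSet] using hy⟩⟩

lemma Noncrossing.connCycles_eq_int (h : Noncrossing slitPos π) :
    connCycles π = (intMarks π).image fun b => cycleSet π (Sum.inr b) := by
  ext B
  simp only [connCycles, Finset.mem_filter, mem_cycles, Finset.mem_image]
  constructor
  · rintro ⟨⟨x, rfl⟩, ⟨x', hx'⟩, ⟨y', hy'⟩⟩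
    rw [Finset.mem_toLeft, mem_cycleSet] at hx'
    rw [Finset.mem_toRight, mem_cycleSet] at hy'
    obtain ⟨-, h1, -⟩ := h.exists_intMark (hx'.symm.trans hy')
    exact ⟨_, h1, cycleSet_eq_iff.2 (hy'.trans (sameCycle_traceMin y')).symm⟩
  · rintro ⟨b, hb, rfl⟩
    obtain ⟨-, x, hx⟩ := h.clockwise.mem_intMarks_iff.1 hb
    exact ⟨⟨_, rfl⟩, ⟨x, by simpa [mem_cycleSet] using hx.symm⟩,
      ⟨b, by simp [mem_cycleSet, Perm.SameCycle.refl]⟩⟩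

lemma Noncrossing.connExtType_eq (h : Noncrossing slitPos π) :
    connExtType π = onType (extWord π, extMarks π) := by
  rw [connExtType, h.connCycles_eq_ext, map_val_image]
  · refine Multiset.map_congr rfl fun a ha => ?_
    exact card_toLeft_cycleSet (h.clockwise.mem_extMarks_iff.1 ha).1
  · intro a ha b hb hab
    exact h.extMarks_inj ha hb (cycleSet_eq_iff.1 hab)

lemma Noncrossing.connIntType_eq (h : Noncrossing slitPos π) :
    connIntType π = onType (intWord π, intMarks π) := by
  rw [connIntType, h.connCycles_eq_int, map_val_image]
  · refine Multiset.map_congr rfl fun a ha => ?_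
    exact card_toRight_cycleSet (h.clockwise.mem_intMarks_iff.1 ha).1
  · intro a ha b hb hab
    exact h.intMarks_inj ha hb (cycleSet_eq_iff.1 hab)

lemma Noncrossing.card_extMarks (h : Noncrossing slitPos π) :
    (extMarks π).card = (connCycles π).card := by
  rw [h.connCycles_eq_ext, Finset.card_image_of_injOn]
  intro a ha b hb hab
  exact h.extMarks_inj ha hb (cycleSet_eq_iff.1 hab)

lemma Noncrossing.extType_eq (h : Noncrossing slitPos π) :
    extType π = offType (extWord π, extMarks π) := by
  have hE : extCycles π = (Finset.univ.filter fun x => x ∉ extMarks π ∧ 0 < extWord π x).image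
      fun a => cycleSet π (Sum.inl a) := by
    ext B
    simp only [extCycles, Finset.mem_filter, mem_cycles, Finset.mem_image, Finset.mem_univ,
      true_and]
    constructor
    · rintro ⟨⟨x | x, rfl⟩, hx⟩
      · refine ⟨traceMin Sum.inl π x, ⟨?_, (blockWord_pos_iff traceMin_idem).2 (traceMin_idem x)⟩,
          cycleSet_eq_iff.2 (sameCycle_traceMin x).symm⟩
        intro hm
        obtain ⟨-, y, hy⟩ := h.clockwise.mem_extMarks_iff.1 hm
        have : y ∈ (cycleSet π (Sum.inl x)).toRight := by
          rw [Finset.mem_toRight, mem_cycleSet]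
          exact (sameCycle_traceMin x).trans hy
        rw [hx] at this
        simp at this
      · exfalso
        have : x ∈ (cycleSet π (Sum.inr x)).toRight := by
          rw [Finset.mem_toRight, mem_cycleSet]
        rw [hx] at this
        simp at this
    · rintro ⟨a, ⟨ha, hpos⟩, rfl⟩
      refine ⟨⟨_, rfl⟩, ?_⟩
      rw [Finset.eq_empty_iff_forall_notMem]
      intro y hy
      rw [Finset.mem_toRight, mem_cycleSet] at hy
      exact ha (h.clockwise.mem_extMarks_iff.2
        ⟨(blockWord_pos_iff traceMin_idem).1 hpos, y, hy⟩)
  have hE' : ∀ B ∈ extCycles π, B.card = B.toLeft.card := by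
    intro B hB
    rw [← B.card_toLeft_add_card_toRight, (Finset.mem_filter.1 hB).2]
    simp
  rw [extType, Multiset.map_congr rfl hE', hE, map_val_image, offType]
  · refine Multiset.map_congr rfl fun a ha => ?_
    have ha' : a ∉ extMarks π ∧ 0 < extWord π a := by simpa using ha
    exact card_toLeft_cycleSet ((blockWord_pos_iff traceMin_idem).1 ha'.2)
  · intro a ha b hb hab
    have ha' := (blockWord_pos_iff traceMin_idem).1 (Finset.mem_filter.1 ha).2.2
    have hb' := (blockWord_pos_iff traceMin_idem).1 (Finset.mem_filter.1 hb).2.2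
    rw [← ha', ← hb']
    exact traceMin_eq_iff.2 (cycleSet_eq_iff.1 hab)

lemma Noncrossing.intType_eq (h : Noncrossing slitPos π) :
    intType π = offType (intWord π, intMarks π) := by
  have hE : intCycles π = (Finset.univ.filter fun x => x ∉ intMarks π ∧ 0 < intWord π x).image
      fun a => cycleSet π (Sum.inr a) := by
    ext B
    simp only [intCycles, Finset.mem_filter, mem_cycles, Finset.mem_image, Finset.mem_univ,
      true_and]
    constructor
    · rintro ⟨⟨x | x, rfl⟩, hx⟩
      · exfalso
        have : x ∈ (cycleSet π (Sum.inl x)).toLeft := by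
          rw [Finset.mem_toLeft, mem_cycleSet]
        rw [hx] at this
        simp at this
      · refine ⟨traceMin Sum.inr π x, ⟨?_, (blockWord_pos_iff traceMin_idem).2 (traceMin_idem x)⟩,
          cycleSet_eq_iff.2 (sameCycle_traceMin x).symm⟩
        intro hm
        obtain ⟨-, y, hy⟩ := h.clockwise.mem_intMarks_iff.1 hm
        have : y ∈ (cycleSet π (Sum.inr x)).toLeft := by
          rw [Finset.mem_toLeft, mem_cycleSet]
          exact (sameCycle_traceMin x).trans hy.symm
        rw [hx] at this
        simp at this
    · rintro ⟨a, ⟨ha, hpos⟩, rfl⟩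
      refine ⟨⟨_, rfl⟩, ?_⟩
      rw [Finset.eq_empty_iff_forall_notMem]
      intro y hy
      rw [Finset.mem_toLeft, mem_cycleSet] at hy
      exact ha (h.clockwise.mem_intMarks_iff.2
        ⟨(blockWord_pos_iff traceMin_idem).1 hpos, y, hy.symm⟩)
  have hE' : ∀ B ∈ intCycles π, B.card = B.toRight.card := by
    intro B hB
    rw [← B.card_toLeft_add_card_toRight, (Finset.mem_filter.1 hB).2]
    simp
  rw [intType, Multiset.map_congr rfl hE', hE, map_val_image, offType]
  · refine Multiset.map_congr rfl fun a ha => ?_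
    have ha' : a ∉ intMarks π ∧ 0 < intWord π a := by simpa using ha
    exact card_toRight_cycleSet ((blockWord_pos_iff traceMin_idem).1 ha'.2)
  · intro a ha b hb hab
    have ha' := (blockWord_pos_iff traceMin_idem).1 (Finset.mem_filter.1 ha).2.2
    have hb' := (blockWord_pos_iff traceMin_idem).1 (Finset.mem_filter.1 hb).2.2
    rw [← ha', ← hb']
    exact traceMin_eq_iff.2 (cycleSet_eq_iff.1 hab)

variable [NeZero n] [NeZero m]

/-- Rotations act on sets of points. -/
def rotSet (s : Fin n) (t : Fin m) : Finset (Pt n m) ↪ Finset (Pt n m) :=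
  (Finset.mapEmbedding (rot s t).toEmbedding).toEmbedding

lemma rotSet_apply (s : Fin n) (t : Fin m) (B : Finset (Pt n m)) :
    rotSet s t B = B.map (rot s t).toEmbedding := rfl

lemma toLeft_rotSet (s : Fin n) (t : Fin m) (B : Finset (Pt n m)) :
    (rotSet s t B).toLeft = B.toLeft.map (Equiv.addRight s).toEmbedding := by
  ext x
  simp only [rotSet_apply, Finset.mem_toLeft, Finset.mem_map_equiv, ← Perm.inv_def, rot_inv]
  simp

lemma toRight_rotSet (s : Fin n) (t : Fin m) (B : Finset (Pt n m)) :
    (rotSet s t B).toRight = B.toRight.map (Equiv.addRight t).toEmbedding := by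
  ext x
  simp only [rotSet_apply, Finset.mem_toRight, Finset.mem_map_equiv, ← Perm.inv_def, rot_inv]
  simp

lemma cycles_turn (s : Fin n) (t : Fin m) :
    cycles (turn s t π) = (cycles π).map (rotSet s t) := by
  have key : ∀ x, cycleSet (turn s t π) (rot s t x) = rotSet s t (cycleSet π x) := by
    intro x
    ext y
    obtain ⟨y, rfl⟩ := (rot s t).surjective y
    rw [mem_cycleSet, sameCycle_turn, rotSet_apply]
    simp [mem_cycleSet]
  ext B
  simp only [Finset.mem_map, mem_cycles]
  constructor
  · rintro ⟨x, rfl⟩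
    obtain ⟨x, rfl⟩ := (rot s t).surjective x
    exact ⟨_, ⟨x, rfl⟩, (key x).symm⟩
  · rintro ⟨_, ⟨x, rfl⟩, rfl⟩
    exact ⟨_, key x⟩

lemma extCycles_turn (s : Fin n) (t : Fin m) :
    extCycles (turn s t π) = (extCycles π).map (rotSet s t) := by
  rw [extCycles, cycles_turn, Finset.filter_map, extCycles]
  congr 1
  refine Finset.filter_congr fun B _ => ?_
  simp [toRight_rotSet]

lemma intCycles_turn (s : Fin n) (t : Fin m) :
    intCycles (turn s t π) = (intCycles π).map (rotSet s t) := by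
  rw [intCycles, cycles_turn, Finset.filter_map, intCycles]
  congr 1
  refine Finset.filter_congr fun B _ => ?_
  simp [toLeft_rotSet]

lemma connCycles_turn (s : Fin n) (t : Fin m) :
    connCycles (turn s t π) = (connCycles π).map (rotSet s t) := by
  rw [connCycles, cycles_turn, Finset.filter_map, connCycles]
  congr 1
  refine Finset.filter_congr fun B _ => ?_
  simp [toLeft_rotSet, toRight_rotSet]

lemma extType_turn (s : Fin n) (t : Fin m) : extType (turn s t π) = extType π := by
  rw [extType, extCycles_turn, Finset.map_val, Multiset.map_map]
  exact Multiset.map_congr rfl fun B _ => Finset.card_map _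

lemma intType_turn (s : Fin n) (t : Fin m) : intType (turn s t π) = intType π := by
  rw [intType, intCycles_turn, Finset.map_val, Multiset.map_map]
  exact Multiset.map_congr rfl fun B _ => Finset.card_map _

lemma connExtType_turn (s : Fin n) (t : Fin m) : connExtType (turn s t π) = connExtType π := by
  simp [connExtType, connCycles_turn, toLeft_rotSet]

lemma connIntType_turn (s : Fin n) (t : Fin m) : connIntType (turn s t π) = connIntType π := by
  simp [connIntType, connCycles_turn, toRight_rotSet]

lemma isAnnularNoncrossing_turn (s : Fin n) (t : Fin m) :
    IsAnnularNoncrossing (turn s t π) ↔ IsAnnularNoncrossing π := by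
  simp only [isAnnularNoncrossing_iff, turn_turn]
  constructor
  · rintro ⟨a, b, h⟩; exact ⟨_, _, h⟩
  · rintro ⟨a, b, h⟩; exact ⟨a - s, b - t, by simpa using h⟩

lemma card_extMarks (h : IsAnnularNoncrossing π) : (extMarks π).card = (connCycles π).card := by
  obtain ⟨s, t, hnc⟩ := isAnnularNoncrossing_iff.1 h
  have h1 := hnc.card_extMarks
  rw [connCycles_turn, Finset.card_map] at h1
  rw [← h1]
  refine Finset.card_equiv (Equiv.addRight s) fun x => ?_
  rw [mem_extMarks_turn]
  simp

end types
end AnnularCSP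
end

noncomputable section
namespace AnnularCSP

open Equiv

/-! ### Periodic words -/

section periodic
variable {d k : ℕ}

/-- The `d`-fold repetition of a marked word. -/
def unroll (d : ℕ) (w : MarkedWord k) : MarkedWord (d * k) :=
  (fun x => w.1 x.modNat, Finset.univ.filter fun x => x.modNat ∈ w.2)

lemma card_filter_modNat (p : Fin k → Prop) [DecidablePred p] :
    (Finset.univ.filter fun x : Fin (d * k) => p x.modNat).card =
      d * (Finset.univ.filter p).card := by
  have : ((Finset.univ : Finset (Fin d)) ×ˢ (Finset.univ.filter p)).card =
      d * (Finset.univ.filter p).card := by simp [Finset.card_product]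
  rw [← this]
  refine (Finset.card_equiv finProdFinEquiv fun x => ?_).symm
  have h : (finProdFinEquiv x).modNat = x.2 :=
    congrArg Prod.snd (finProdFinEquiv.symm_apply_apply x)
  simp [h]

lemma map_filter_modNat (p : Fin k → Prop) [DecidablePred p] (g : Fin k → ℕ) :
    (Finset.univ.filter fun x : Fin (d * k) => p x.modNat).val.map (fun x => g x.modNat) =
      d • (Finset.univ.filter p).val.map g := by
  ext a
  rw [Multiset.count_nsmul, Multiset.count_map, Multiset.count_map]
  have h1 := card_filter_modNat (d := d) fun x => p x ∧ a = g x
  rw [← Finset.filter_filter, ← Finset.filter_filter] at h1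
  exact h1

lemma offType_unroll (w : MarkedWord k) : offType (unroll d w) = d • offType w := by
  rw [offType, offType, ← map_filter_modNat]
  simp [unroll]

lemma onType_unroll (w : MarkedWord k) : onType (unroll d w) = d • onType w := by
  have h := map_filter_modNat (d := d) (fun x => x ∈ w.2) w.1
  simpa [onType, unroll] using h

lemma card_unroll (w : MarkedWord k) : (unroll d w).2.card = d * w.2.card := by
  have h := card_filter_modNat (d := d) (fun x => x ∈ w.2)
  rw [unroll]
  convert h
  ext x; simp

lemma height_eq_sum_range {n : ℕ} (φ : ℕ → ℕ) {x : ℕ} (hx : x ≤ n) :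
    height (fun i : Fin n => φ i) x = ∑ i ∈ Finset.range x, (φ i : ℤ) - x := by
  unfold height
  congr 1
  refine Finset.sum_bij (fun i _ => (i : ℕ)) ?_ ?_ ?_ ?_
  · intro i hi
    simpa using hi
  · intro i _ j _ h
    exact Fin.ext h
  · intro i hi
    have := Finset.mem_range.1 hi
    exact ⟨⟨i, by omega⟩, by simpa using this, rfl⟩
  · intro i _
    rfl

lemma unroll_injective [NeZero d] : Function.Injective (unroll d : MarkedWord k → MarkedWord (d * k)) := by
  have hd := Nat.pos_of_neZero d
  have emb : ∀ a : Fin k, ∃ a' : Fin (d * k), a'.modNat = a := by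
    intro a
    have := a.2
    have hle : k ≤ d * k := Nat.le_mul_of_pos_left k hd
    exact ⟨⟨a, by omega⟩, by ext; simp [Fin.modNat, Nat.mod_eq_of_lt a.2]⟩
  intro w w' h
  have h1 := congrArg Prod.fst h
  have h2 := congrArg Prod.snd h
  ext x
  · obtain ⟨x', rfl⟩ := emb x
    exact congrFun h1 x'
  · obtain ⟨x', rfl⟩ := emb x
    have := Finset.ext_iff.1 h2 x'
    simpa [unroll] using this

variable [NeZero k]

/-- The periodic extension of a word. -/
def periodicExt (F : Fin k → ℕ) (i : ℕ) : ℕ := F ⟨i % k, Nat.mod_lt _ (Nat.pos_of_neZero k)⟩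

/-- The height function of the periodic extension. -/
def periodicHeight (F : Fin k → ℕ) (x : ℕ) : ℤ :=
  ∑ i ∈ Finset.range x, (periodicExt F i : ℤ) - x

lemma periodicHeight_add (F : Fin k → ℕ) (x : ℕ) :
    periodicHeight F (k + x) = periodicHeight F k + periodicHeight F x := by
  unfold periodicHeight
  rw [Finset.sum_range_add]
  have : ∀ i, periodicExt F (k + i) = periodicExt F i := by
    intro i; simp [periodicExt]
  simp only [this]
  push_cast
  ring

lemma periodicHeight_mul_add (F : Fin k → ℕ) (j x : ℕ) :
    periodicHeight F (j * k + x) = j * periodicHeight F k + periodicHeight F x := by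
  induction j with
  | zero => simp
  | succ j ih =>
    rw [show (j + 1) * k + x = k + (j * k + x) by ring, periodicHeight_add, ih]
    push_cast
    ring

lemma height_unroll (w : MarkedWord k) {x : ℕ} (hx : x ≤ d * k) :
    height (unroll d w).1 x = periodicHeight w.1 x :=
  height_eq_sum_range (periodicExt w.1) hx

lemma height_eq_periodicHeight (F : Fin k → ℕ) {x : ℕ} (hx : x ≤ k) :
    height F x = periodicHeight F x := by
  rw [periodicHeight, ← height_eq_sum_range (periodicExt F) hx]
  congr 1
  funext i
  simp [periodicExt, Nat.mod_eq_of_lt i.2]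

lemma periodicHeight_mod (F : Fin k → ℕ) (h : periodicHeight F k = 0) (x : ℕ) :
    periodicHeight F x = height F (x % k) := by
  rw [height_eq_periodicHeight F (Nat.mod_lt _ (Nat.pos_of_neZero k)).le]
  conv_lhs => rw [← Nat.div_add_mod' x k, periodicHeight_mul_add, h, mul_zero, zero_add]

variable [NeZero d]

lemma isRootedWord_unroll_iff (w : MarkedWord k) :
    IsRootedWord (unroll d w).1 (unroll d w).2 ↔ IsRootedWord w.1 w.2 := by
  have hd := Nat.pos_of_neZero d
  have hk := Nat.pos_of_neZero k
  have hle : k ≤ d * k := Nat.le_mul_of_pos_left k hd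
  have hz : (0 : Fin (d * k)).modNat = (0 : Fin k) := by ext; simp [Fin.modNat]
  have hmem : ∀ x, x ∈ (unroll d w).2 ↔ x.modNat ∈ w.2 := by intro x; simp [unroll]
  constructor
  · rintro ⟨⟨h1, h2⟩, h3, h4, h5⟩
    have hk0 : periodicHeight w.1 k = 0 := by
      rw [height_unroll w le_rfl] at h2
      have := periodicHeight_mul_add w.1 d 0
      rw [add_zero, h2] at this
      have h6 : periodicHeight w.1 0 = 0 := by simp [periodicHeight]
      rw [h6, add_zero] at this
      rcases mul_eq_zero.1 this.symm with h | h
      · have : d = 0 := by exact_mod_cast h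
        omega
      · exact h
    have emb : ∀ a : Fin k, ∃ a' : Fin (d * k), (a' : ℕ) = a ∧ a'.modNat = a := by
      intro a
      have := a.2
      exact ⟨⟨a, by omega⟩, rfl, by ext; simp [Fin.modNat, Nat.mod_eq_of_lt a.2]⟩
    refine ⟨⟨fun x hx => ?_, ?_⟩, ?_, ?_, ?_⟩
    · rw [height_eq_periodicHeight _ hx, ← height_unroll (d := d) w (hx.trans hle)]
      exact h1 x (hx.trans hle)
    · rw [height_eq_periodicHeight _ le_rfl, hk0]
    · rw [hmem, hz] at h3
      exact h3
    · intro a ha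
      obtain ⟨a', e1, e2⟩ := emb a
      rw [height_eq_periodicHeight _ a.2.le, ← e1, ← height_unroll (d := d) w a'.2.le]
      exact h4 a' ((hmem _).2 (e2 ▸ ha))
    · intro a ha
      obtain ⟨a', e1, e2⟩ := emb a
      have := h5 a' ((hmem _).2 (e2 ▸ ha))
      rw [← e2]
      exact this
  · rintro ⟨⟨h1, h2⟩, h3, h4, h5⟩
    have hk0 : periodicHeight w.1 k = 0 := by rw [← height_eq_periodicHeight _ le_rfl, h2]
    refine ⟨⟨fun x hx => ?_, ?_⟩, ?_, ?_, ?_⟩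
    · rw [height_unroll w hx, periodicHeight_mod _ hk0]
      exact h1 _ (Nat.mod_lt _ hk).le
    · rw [height_unroll w le_rfl, periodicHeight_mod _ hk0, Nat.mul_mod_left, height_zero]
    · rw [hmem, hz]
      exact h3
    · intro a ha
      rw [height_unroll w a.2.le, periodicHeight_mod _ hk0]
      exact h4 _ ((hmem _).1 ha)
    · intro a ha
      exact h5 _ ((hmem _).1 ha)

/-- The rotation by one period. -/
def period (d k : ℕ) [NeZero d] [NeZero k] : Fin (d * k) := Fin.ofNat (d * k) k

lemma modNat_add_period (x : Fin (d * k)) : (x + period d k).modNat = x.modNat := by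
  ext
  simp [Fin.modNat, period, Fin.val_add]

lemma eq_modNat_of_periodic {M : Type*} (f : Fin (d * k) → M) (hf : ∀ x, f (x + period d k) = f x)
    {x y : Fin (d * k)} (hxy : x.modNat = y.modNat) : f x = f y := by
  have key : ∀ (j r : ℕ) (h : j * k + r < d * k) (h' : r < d * k),
      f ⟨j * k + r, h⟩ = f ⟨r, h'⟩ := by
    intro j
    induction j with
    | zero => intro r h h'; congr 2; simp
    | succ j ih =>
      intro r h h'
      have h1 : j * k + r < d * k := lt_of_le_of_lt (by rw [add_mul]; omega) h
      rw [← ih r h1 h', ← hf ⟨j * k + r, h1⟩]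
      congr 1
      ext
      have e : (j + 1) * k + r = j * k + r + k := by ring
      simp only [Fin.val_add, period, Fin.val_ofNat, Nat.add_mod_mod]
      rw [e, Nat.mod_eq_of_lt (e ▸ h)]
  have key' : ∀ x : Fin (d * k), f x = f ⟨x % k, lt_of_le_of_lt (Nat.mod_le _ _) x.2⟩ := by
    intro x
    rw [← key (x / k) (x % k) (by rw [Nat.div_add_mod']; exact x.2)]
    congr 1
    ext
    exact (Nat.div_add_mod' _ _).symm
  rw [key' x, key' y]
  congr 2
  exact congrArg Fin.val hxy

lemma exists_unroll_eq {F : Fin (d * k) → ℕ} {A : Finset (Fin (d * k))}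
    (hF : ∀ x, F (x + period d k) = F x) (hA : ∀ x, x + period d k ∈ A ↔ x ∈ A) :
    ∃ w : MarkedWord k, unroll d w = (F, A) := by
  have hd := Nat.pos_of_neZero d
  have hle : k ≤ d * k := Nat.le_mul_of_pos_left k hd
  have hm : ∀ x : Fin (d * k), (⟨x.modNat, by have := x.modNat.2; omega⟩ : Fin (d * k)).modNat =
      x.modNat := by
    intro x; ext; simp [Fin.modNat]
  refine ⟨(fun x => F ⟨x, by omega⟩, Finset.univ.filter fun x => ⟨x, by omega⟩ ∈ A), ?_⟩
  refine Prod.ext ?_ ?_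
  · funext x
    exact eq_modNat_of_periodic F hF (hm x)
  · ext x
    simp only [unroll, Finset.mem_filter, Finset.mem_univ, true_and]
    exact iff_of_eq (eq_modNat_of_periodic (fun x => x ∈ A) (fun x => propext (hA x)) (hm x))

lemma unroll_periodic (w : MarkedWord k) :
    (∀ x, (unroll d w).1 (x + period d k) = (unroll d w).1 x) ∧
      ∀ x, x + period d k ∈ (unroll d w).2 ↔ x ∈ (unroll d w).2 := by
  simp [unroll, modNat_add_period]

lemma val_period (hd : 2 ≤ d) : (period d k : ℕ) = k := by
  have hk := Nat.pos_of_neZero k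
  simp only [period, Fin.val_ofNat]
  exact Nat.mod_eq_of_lt (by nlinarith)

lemma countBelow_unroll (hd : 2 ≤ d) (w : MarkedWord k) :
    countBelow (unroll d w).2 (period d k) = w.2.card := by
  have hle : k ≤ d * k := Nat.le_mul_of_pos_left k (by omega)
  refine (Finset.card_bij (fun (x : Fin k) _ => (⟨x, lt_of_lt_of_le x.2 hle⟩ : Fin (d * k))) ?_ ?_ ?_).symm
  · intro x hx
    have : (⟨x, by omega⟩ : Fin (d * k)).modNat = x := by
      ext; simp [Fin.modNat, Nat.mod_eq_of_lt x.2]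
    simp [unroll, Fin.lt_def, val_period hd, this, hx]
  · intro x _ y _ h
    exact Fin.ext (congrArg (fun z : Fin (d * k) => (z : ℕ)) h)
  · intro x hx
    simp only [unroll, Finset.mem_filter, Finset.mem_univ, true_and, Fin.lt_def,
      val_period hd] at hx
    refine ⟨x.modNat, hx.1, ?_⟩
    ext
    simp [Fin.modNat, Nat.mod_eq_of_lt hx.2]

lemma val_neg_period (hd : 2 ≤ d) : ((-period d k : Fin (d * k)) : ℕ) = d * k - k := by
  have hk := Nat.pos_of_neZero k
  have h1 : k < d * k := by nlinarith
  have h2 := fin_val_sub (0 : Fin (d * k)) (period d k)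
  rw [zero_sub] at h2
  rw [h2, if_neg, val_period hd]
  · simp
  · rw [Fin.le_def, val_period hd]
    simp only [Fin.val_zero]
    omega

lemma countAbove_unroll (hd : 2 ≤ d) (w : MarkedWord k) (h0 : 0 ∈ w.2) :
    countAbove (unroll d w).2 (-period d k) + 1 = w.2.card := by
  have hk := Nat.pos_of_neZero k
  have h1 : k < d * k := by nlinarith
  rw [← Finset.card_erase_add_one h0]
  congr 1
  refine (Finset.card_bij (fun (x : Fin k) _ => (⟨d * k - k + x, by have := x.2; omega⟩ : Fin (d * k)))
    ?_ ?_ ?_).symm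
  · intro x hx
    have hm : (⟨d * k - k + x, by omega⟩ : Fin (d * k)).modNat = x := by
      ext
      simp only [Fin.modNat, Fin.val_mk]
      rw [← Nat.sub_one_mul, mul_comm, Nat.mul_add_mod, Nat.mod_eq_of_lt x.2]
    rw [Finset.mem_erase] at hx
    have : 0 < (x : ℕ) := Nat.pos_of_ne_zero fun h => hx.1 (Fin.ext (by simpa using h))
    simp only [unroll, Finset.mem_filter, Finset.mem_univ, true_and, Fin.lt_def,
      val_neg_period hd, hm]
    exact ⟨hx.2, by omega⟩
  · intro x _ y _ h
    have := congrArg (fun z : Fin (d * k) => (z : ℕ)) h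
    simp only at this
    exact Fin.ext (by omega)
  · intro x hx
    simp only [unroll, Finset.mem_filter, Finset.mem_univ, true_and, Fin.lt_def,
      val_neg_period hd] at hx
    have hx2 := x.2
    have hm : ((x.modNat : Fin k) : ℕ) = x - (d * k - k) := by
      simp only [Fin.modNat]
      conv_lhs => rw [show (x : ℕ) = (d * k - k) + (x - (d * k - k)) by omega]
      rw [← Nat.sub_one_mul, mul_comm, Nat.mul_add_mod, Nat.mod_eq_of_lt]
      have : k * (d - 1) = d * k - k := by rw [mul_comm, Nat.sub_one_mul]
      omega
    refine ⟨x.modNat, Finset.mem_erase.2 ⟨?_, hx.1⟩, ?_⟩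
    · intro h
      rw [h] at hm
      simp at hm
      omega
    · ext
      simp only [hm]
      omega

end periodic
end AnnularCSP
end

noncomputable section
namespace AnnularCSP

open Equiv

/-! ### Counting the fixed points of a rotation -/

section fixed
variable {d k l : ℕ} [NeZero d] [NeZero k] [NeZero l]

/-- The annular noncrossing permutations with `c ≥ 1` connected cycles that are fixed by a rotation
of order `d`, and whose cycle types have given properties. -/
def fixedSet (d k l : ℕ) [NeZero d] [NeZero k] [NeZero l] (c : ℕ)
    (P Q : Multiset ℕ → Multiset ℕ → Prop) : Set (Perm (Pt (d * k) (d * l))) :=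
  {π | IsAnnularNoncrossing π ∧ (connCycles π).card = c ∧ P (extType π) (connExtType π) ∧
    Q (intType π) (connIntType π) ∧ turn (period d k) (-period d l) π = π}

/-- The rooted words whose `d`-fold repetition has `c` marks and types with a given property. -/
def wordSet (d k : ℕ) [NeZero k] (c : ℕ) (P : Multiset ℕ → Multiset ℕ → Prop) :
    Set (MarkedWord k) :=
  {w | IsRootedWord w.1 w.2 ∧ d * w.2.card = c ∧ P (d • offType w) (d • onType w)}

lemma turn_period_eq_iff {π : Perm (Pt (d * k) (d * l))} (h : IsRooted π) :
    turn (period d k) (-period d l) π = π ↔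
      ∃ (w : MarkedWord k) (v : MarkedWord l), unroll d w = (extWord π, extMarks π) ∧
        unroll d v = (intWord π, intMarks π) := by
  constructor
  · intro hfix
    obtain ⟨⟨h1, h2⟩, h3, h4⟩ := h.periodic_of_turn_eq hfix
    obtain ⟨w, hw⟩ := exists_unroll_eq h1 h2
    obtain ⟨v, hv⟩ := exists_unroll_eq h3 h4
    exact ⟨w, v, hw, hv⟩
  · rintro ⟨w, v, hw, hv⟩
    obtain ⟨p1, p2⟩ := unroll_periodic (d := d) w
    obtain ⟨p3, p4⟩ := unroll_periodic (d := d) v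
    have hcard := h.nc.card_marks
    have hv0 : IsRootedWord v.1 v.2 := by
      rw [← isRootedWord_unroll_iff (d := d), hv]
      exact h.isRootedWord_int
    have c1 := card_unroll (d := d) w
    have c2 := card_unroll (d := d) v
    rw [hw] at p1 p2 c1
    rw [hv] at p3 p4 c2
    simp only at c1 c2
    refine h.turn_eq_of_periodic p1 p2 p3 p4 ?_
    have hd := Nat.pos_of_neZero d
    rcases Nat.eq_or_lt_of_le hd with h1 | h2
    · right
      have e1 : period d k = 0 := by
        ext; simp [period, ← h1]
      have e2 : period d l = 0 := by
        ext; simp [period, ← h1]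
      rw [e1, e2, neg_zero]
      refine ⟨?_, countAbove_zero h.int⟩
      simp [countBelow]
    · left
      have b1 := countBelow_unroll (d := d) h2 w
      have b2 := countAbove_unroll (d := d) h2 v hv0.zero_mem
      rw [hw] at b1
      rw [hv] at b2
      simp only at b1 b2
      rw [b1, b2]
      rw [c1, c2] at hcard
      exact Nat.eq_of_mul_eq_mul_left hd hcard

/-- A fixed permutation with a marked connected cycle is determined by the position of the slit next to
that cycle and the two periodic words. -/
theorem card_fixedSet (c : ℕ) (P Q : Multiset ℕ → Multiset ℕ → Prop) :
    c * (fixedSet d k l c P Q).ncard =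
      (d * k) * (d * l) * ((wordSet d k c P).ncard * (wordSet d l c Q).ncard) := by
  classical
  let S : Finset (Perm (Pt (d * k) (d * l))) := Finset.univ.filter (· ∈ fixedSet d k l c P Q)
  let Y : Finset (Σ _ : Perm (Pt (d * k) (d * l)), Fin (d * k)) := S.sigma extMarks
  have hY : Y.card = c * (fixedSet d k l c P Q).ncard := by
    rw [Finset.card_sigma, Finset.sum_congr rfl (g := fun _ => c), Finset.sum_const, smul_eq_mul,
      mul_comm]
    · congr 1
      rw [← Set.ncard_coe_finset]
      congr 1
      ext π
      simp [S]
    · intro π hπ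
      have h : π ∈ fixedSet d k l c P Q := by simpa [S] using hπ
      rw [card_extMarks h.1, h.2.1]
  rw [← hY]
  -- the rooted permutation with given words
  have hglue : ∀ (w : wordSet d k c P) (v : wordSet d l c Q), ∃ π : Perm (Pt (d * k) (d * l)),
      IsRooted π ∧ unroll d w.1 = (extWord π, extMarks π) ∧
        unroll d v.1 = (intWord π, intMarks π) := by
    rintro ⟨w, hw1, hw2, hw3⟩ ⟨v, hv1, hv2, hv3⟩
    obtain ⟨π, h, e1, e2, e3, e4⟩ := exists_isRooted
      ((isRootedWord_unroll_iff (d := d) w).2 hw1) ((isRootedWord_unroll_iff (d := d) v).2 hv1)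
      (by rw [card_unroll, card_unroll, hw2, hv2])
    exact ⟨π, h, by rw [e1, e2], by rw [e3, e4]⟩
  choose glue hroot hext hint using hglue
  have hmem : ∀ (a : Fin (d * k)) (b : Fin (d * l)) (w : wordSet d k c P) (v : wordSet d l c Q),
      turn a b (glue w v) ∈ fixedSet d k l c P Q := by
    intro a b w v
    have h := hroot w v
    have hc := h.nc.card_extMarks
    refine ⟨(isAnnularNoncrossing_turn a b).2 (isAnnularNoncrossing_iff.2 ⟨0, 0, by
      rw [turn_zero]; exact h.nc⟩), ?_, ?_, ?_, ?_⟩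
    · rw [connCycles_turn, Finset.card_map, ← hc, ← w.2.2.1, ← card_unroll, hext w v]
    · rw [extType_turn, connExtType_turn, h.nc.extType_eq, h.nc.connExtType_eq, ← hext w v,
        offType_unroll, onType_unroll]
      exact w.2.2.2
    · rw [intType_turn, connIntType_turn, h.nc.intType_eq, h.nc.connIntType_eq, ← hint w v,
        offType_unroll, onType_unroll]
      exact v.2.2.2
    · have h1 := (turn_period_eq_iff h).2 ⟨_, _, hext w v, hint w v⟩
      conv_rhs => rw [← h1]
      rw [turn_turn, turn_turn, add_comm, add_comm b]
  let f : (Fin (d * k) × Fin (d * l)) × (wordSet d k c P × wordSet d l c Q) → Y := fun x =>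
    ⟨⟨turn x.1.1 x.1.2 (glue x.2.1 x.2.2), x.1.1⟩, by
      rw [Finset.mem_sigma]
      refine ⟨by simpa [S] using hmem _ _ _ _, ?_⟩
      rw [mem_extMarks_turn, sub_self]
      exact (hroot _ _).ext⟩
  have hf : Function.Bijective f := by
    constructor
    · rintro ⟨⟨a, b⟩, w, v⟩ ⟨⟨a', b'⟩, w', v'⟩ h
      have h0 := congrArg Subtype.val h
      simp only [f, Sigma.mk.injEq, heq_eq_eq] at h0
      obtain ⟨h1, rfl⟩ := h0
      have h2 : glue w' v' = turn 0 (b - b') (glue w v) := by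
        have := turn_eq_iff.1 h1.symm
        rw [this, turn_turn]
        congr 1 <;> abel
      have h3 : b - b' = 0 := (hroot w v).eq_zero_of_turn (h2 ▸ hroot w' v')
      rw [h3, turn_zero] at h2
      have e1 := hext w v
      have e2 := hint w v
      rw [← h2, ← hext w' v'] at e1
      rw [← h2, ← hint w' v'] at e2
      rw [sub_eq_zero.1 h3, Subtype.ext (unroll_injective e1), Subtype.ext (unroll_injective e2)]
    · rintro ⟨⟨π, a⟩, hπ⟩
      rw [Finset.mem_sigma] at hπ
      obtain ⟨hπS, ha⟩ := hπ
      simp only at hπS ha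
      have hπF : π ∈ fixedSet d k l c P Q := by simpa [S] using hπS
      obtain ⟨g1, g2, g3, g4, g5⟩ := hπF
      obtain ⟨b, hb⟩ := exists_isRooted_turn g1 ha
      set σ := turn (-a) (-b) π with hσ
      have hπσ : π = turn a b σ := by rw [hσ, turn_turn]; simp
      have hfix : turn (period d k) (-period d l) σ = σ := by
        conv_rhs => rw [hσ, ← g5]
        rw [hσ, turn_turn, turn_turn, add_comm, add_comm (-b)]
      obtain ⟨w, v, hw, hv⟩ := (turn_period_eq_iff hb).1 hfix
      have hc := hb.nc.card_extMarks
      have hc' := hb.nc.card_marks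
      rw [hπσ, connCycles_turn, Finset.card_map] at g2
      rw [hπσ, extType_turn, connExtType_turn, hb.nc.extType_eq, hb.nc.connExtType_eq, ← hw,
        offType_unroll, onType_unroll] at g3
      rw [hπσ, intType_turn, connIntType_turn, hb.nc.intType_eq, hb.nc.connIntType_eq, ← hv,
        offType_unroll, onType_unroll] at g4
      have hwm : w ∈ wordSet d k c P := by
        refine ⟨?_, ?_, g3⟩
        · rw [← isRootedWord_unroll_iff (d := d), hw]; exact hb.isRootedWord_ext
        · rw [← card_unroll, hw, hc, g2]
      have hvm : v ∈ wordSet d l c Q := by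
        refine ⟨?_, ?_, g4⟩
        · rw [← isRootedWord_unroll_iff (d := d), hv]; exact hb.isRootedWord_int
        · rw [← card_unroll, hv]; simp only; rw [← hc', hc, g2]
      refine ⟨⟨⟨a, b⟩, ⟨w, hwm⟩, ⟨v, hvm⟩⟩, ?_⟩
      have e : glue ⟨w, hwm⟩ ⟨v, hvm⟩ = σ := by
        have e1 := (hext ⟨w, hwm⟩ ⟨v, hvm⟩).symm.trans hw
        have e2 := (hint ⟨w, hwm⟩ ⟨v, hvm⟩).symm.trans hv
        rw [Prod.mk.injEq] at e1 e2
        exact (hroot _ _).nc.eq_of_words hb.nc e1.1 e1.2 e2.1 e2.2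
      apply Subtype.ext
      simp only [f, e, hπσ]
  have := Nat.card_congr (Equiv.ofBijective f hf)
  rw [Nat.card_prod, Nat.card_prod, Nat.card_prod, Nat.card_coe_set_eq, Nat.card_coe_set_eq,
    Nat.card_fin, Nat.card_fin, Nat.card_eq_fintype_card, Fintype.card_coe] at this
  exact this.symm

end fixed
end AnnularCSP
end

noncomputable section
namespace AnnularCSP

open Equiv

/-! ### Removing the marked letters from a rooted word -/

section removal
variable {n : ℕ}

/-- The multiset of the nonzero letters of a word. -/
def letterType (f : Fin n → ℕ) : Multiset ℕ := (Finset.univ.filter fun x => 0 < f x).val.map f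

lemma sum_letterType (f : Fin n → ℕ) : (letterType f).sum = ∑ x, f x := by
  rw [letterType]
  change ∑ x ∈ _, f x = _
  rw [Finset.sum_filter_of_ne]
  intro x _ h
  omega

/-- The word that remains when the marked letters are set to zero. -/
def offWord (w : MarkedWord n) (x : Fin n) : ℕ := if x ∈ w.2 then 0 else w.1 x

lemma offType_eq_letterType (w : MarkedWord n) : offType w = letterType (offWord w) := by
  have : (Finset.univ.filter fun x => x ∉ w.2 ∧ 0 < w.1 x) =
      Finset.univ.filter fun x => 0 < offWord w x := by
    refine Finset.filter_congr fun x _ => ?_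
    unfold offWord
    split_ifs with h <;> simp [h]
  rw [offType, letterType, this]
  refine Multiset.map_congr rfl fun x hx => ?_
  have hx' : 0 < offWord w x := by simpa using hx
  unfold offWord at hx' ⊢
  split_ifs at hx' ⊢ with h
  · omega
  · rfl

lemma height_add_sum_marks (w : MarkedWord n) (x : ℕ) :
    height w.1 x = height (offWord w) x + ∑ a ∈ w.2.filter (fun a : Fin n => (a : ℕ) < x), (w.1 a : ℤ) := by
  have h : ∀ i, (w.1 i : ℤ) = offWord w i + if i ∈ w.2 then (w.1 i : ℤ) else 0 := by
    intro i
    unfold offWord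
    split_ifs <;> simp
  unfold height
  rw [Finset.sum_congr rfl fun i _ => h i, Finset.sum_add_distrib, ← Finset.sum_filter,
    Finset.filter_filter]
  have : (Finset.univ.filter fun a : Fin n => (a : ℕ) < x ∧ a ∈ w.2) =
      w.2.filter fun a : Fin n => (a : ℕ) < x := by
    ext; simp [and_comm]
  rw [this]
  ring

/-- Words whose path ends at its minimum and starts with a step down. -/
structure IsGood [NeZero n] (f : Fin n → ℕ) : Prop where
  zero : f 0 = 0
  min : ∀ x ≤ n, height f n ≤ height f x

/-- The path of `f` steps below its previous minimum after `x`. -/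
def IsRecord (f : Fin n → ℕ) (x : Fin n) : Prop := f x = 0 ∧ ∀ y ≤ (x : ℕ), height f x ≤ height f y

lemma IsRecord.height_lt {f : Fin n → ℕ} {x y : Fin n} (hx : IsRecord f x) (hy : IsRecord f y)
    (h : x < y) : height f y < height f x := by
  have h1 := hy.2 (x + 1) h
  rw [height_succ, hx.1] at h1
  push_cast at h1
  omega

lemma IsRecord.lt_iff {f : Fin n → ℕ} {x y : Fin n} (hx : IsRecord f x) (hy : IsRecord f y) :
    x < y ↔ height f y < height f x := by
  refine ⟨hx.height_lt hy, fun h => ?_⟩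
  rcases lt_trichotomy x y with h1 | h1 | h1
  · exact h1
  · rw [h1] at h; omega
  · have := hy.height_lt hx h1; omega

lemma IsRecord.eq_of_height_eq {f : Fin n → ℕ} {x y : Fin n} (hx : IsRecord f x)
    (hy : IsRecord f y) (h : height f x = height f y) : x = y := by
  rcases lt_trichotomy x y with h1 | h1 | h1
  · have := hx.height_lt hy h1; omega
  · exact h1
  · have := hy.height_lt hx h1; omega

lemma exists_isRecord (f : Fin n → ℕ) {j : ℕ} (hj : height f n < -j) :
    ∃ x, IsRecord f x ∧ height f x = -j := by
  classical
  have hex : ∃ y, y ≤ n ∧ height f y < -j := ⟨n, le_rfl, hj⟩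
  obtain ⟨h1, h2⟩ := Nat.find_spec hex
  have hmin := fun m hm => Nat.find_min hex (m := m) hm
  set y := Nat.find hex
  have hy0 : y ≠ 0 := by
    intro h
    rw [h, height_zero] at h2
    omega
  have h3 := height_succ f ⟨y - 1, by omega⟩
  simp only [Nat.sub_add_cancel (Nat.one_le_iff_ne_zero.2 hy0)] at h3
  have hb : ∀ z < y, -(j : ℤ) ≤ height f z := fun z hz => by
    by_contra hcon
    exact hmin z hz ⟨by omega, not_le.1 hcon⟩
  have h4 := hb (y - 1) (by omega)
  have h5 : height f (y - 1) = -j := by omega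
  refine ⟨⟨y - 1, by omega⟩, ⟨by omega, fun z hz => ?_⟩, h5⟩
  simp only at hz ⊢
  rw [h5]
  exact hb z (by omega)

variable {c : ℕ}

lemma sum_filter_orderEmb {A : Finset (Fin n)} (hA : A.card = c) (g : Fin n → ℤ) (x : ℕ) :
    ∑ a ∈ A.filter (fun a : Fin n => (a : ℕ) < x), g a =
      ∑ i ∈ Finset.univ.filter (fun i : Fin c => (A.orderEmbOfFin hA i : ℕ) < x), g (A.orderEmbOfFin hA i) := by
  have : A.filter (fun a : Fin n => (a : ℕ) < x) = (Finset.univ.filter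
      (fun i => (A.orderEmbOfFin hA i : ℕ) < x)).map (A.orderEmbOfFin hA).toEmbedding := by
    ext a
    simp only [Finset.mem_filter, Finset.mem_map, Finset.mem_univ, true_and]
    constructor
    · rintro ⟨h1, h2⟩
      have : a ∈ Set.range (A.orderEmbOfFin hA) := by
        rw [Finset.range_orderEmbOfFin]; exact h1
      obtain ⟨i, rfl⟩ := this
      exact ⟨i, h2, rfl⟩
    · rintro ⟨i, h, rfl⟩
      exact ⟨Finset.orderEmbOfFin_mem A hA i, h⟩
  rw [this, Finset.sum_map]
  rfl

lemma onType_eq_map_orderEmb (w : MarkedWord n) (hA : w.2.card = c) :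
    onType w = Finset.univ.val.map fun i => w.1 (w.2.orderEmbOfFin hA i) := by
  rw [onType]
  conv_lhs => rw [← Finset.map_orderEmbOfFin_univ w.2 hA]
  rw [Finset.map_val, Multiset.map_map]
  rfl

variable [NeZero n]

lemma IsRootedWord.isGood_offWord {w : MarkedWord n} (h : IsRootedWord w.1 w.2) :
    IsGood (offWord w) := by
  constructor
  · simp [offWord, h.zero_mem]
  · intro x hx
    have h1 := height_add_sum_marks w x
    have h2 := height_add_sum_marks w n
    rw [h.luk.last] at h2
    have h3 := h.luk.nonneg x hx
    have h4 : ∑ a ∈ w.2.filter (fun a : Fin n => (a : ℕ) < x), (w.1 a : ℤ) ≤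
        ∑ a ∈ w.2.filter (fun a : Fin n => (a : ℕ) < n), (w.1 a : ℤ) := by
      apply Finset.sum_le_sum_of_subset_of_nonneg
      · intro a ha
        rw [Finset.mem_filter] at ha ⊢
        exact ⟨ha.1, a.2⟩
      · intros; positivity
    omega

lemma IsRootedWord.isRecord {w : MarkedWord n} (h : IsRootedWord w.1 w.2) {a : Fin n}
    (ha : a ∈ w.2) : IsRecord (offWord w) a := by
  constructor
  · simp [offWord, ha]
  · intro y hy
    have h1 := height_add_sum_marks w y
    have h2 := height_add_sum_marks w a
    rw [h.height_eq a ha] at h2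
    have h3 := h.luk.nonneg y (hy.trans a.2.le)
    have h4 : ∑ b ∈ w.2.filter (fun b : Fin n => (b : ℕ) < y), (w.1 b : ℤ) ≤
        ∑ b ∈ w.2.filter (fun b : Fin n => (b : ℕ) < a), (w.1 b : ℤ) := by
      apply Finset.sum_le_sum_of_subset_of_nonneg
      · intro b hb
        rw [Finset.mem_filter] at hb ⊢
        exact ⟨hb.1, lt_of_lt_of_le hb.2 hy⟩
      · intros; positivity
    omega

/-- The `i`-th marked letter occurs where the path of the remaining word leaves the level given by the
previous marked letters. -/
lemma IsRootedWord.height_orderEmb {w : MarkedWord n} (h : IsRootedWord w.1 w.2)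
    (hA : w.2.card = c) (i : Fin c) : height (offWord w) (w.2.orderEmbOfFin hA i) =
      -∑ j ∈ Finset.univ.filter (· < i), (w.1 (w.2.orderEmbOfFin hA j) : ℤ) := by
  have h2 := height_add_sum_marks w (w.2.orderEmbOfFin hA i)
  rw [h.height_eq _ (Finset.orderEmbOfFin_mem _ _ _), sum_filter_orderEmb hA] at h2
  have : (Finset.univ.filter fun j : Fin c => (w.2.orderEmbOfFin hA j : ℕ) < w.2.orderEmbOfFin hA i) =
      Finset.univ.filter (· < i) := by
    refine Finset.filter_congr fun j _ => ?_
    rw [Fin.val_fin_lt, OrderEmbedding.lt_iff_lt]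
  rw [this] at h2
  omega

/-- Rooted words correspond to pairs of a good word (the letters that are not marked) and a sequence
of positive numbers (the marked letters). -/
theorem ncard_rootedWords (hc : 1 ≤ c) (P : Multiset ℕ → Multiset ℕ → Prop) :
    {w : MarkedWord n | IsRootedWord w.1 w.2 ∧ w.2.card = c ∧ P (offType w) (onType w)}.ncard =
    {p : (Fin n → ℕ) × (Fin c → ℕ) | IsGood p.1 ∧ (∀ i, 0 < p.2 i) ∧
      ∑ x, p.1 x + ∑ i, p.2 i = n ∧ P (letterType p.1) (Finset.univ.val.map p.2)}.ncard := by
  classical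
  refine Set.ncard_congr (fun w hw => (offWord w, fun i => w.1 (w.2.orderEmbOfFin hw.2.1 i)))
    ?_ ?_ ?_
  · rintro w ⟨h1, h2, h3⟩
    refine ⟨h1.isGood_offWord, fun i => h1.pos _ (Finset.orderEmbOfFin_mem _ _ _), ?_, ?_⟩
    · have h4 := height_add_sum_marks w n
      rw [h1.luk.last, height_last, sum_filter_orderEmb h2] at h4
      have : (Finset.univ.filter fun i : Fin c => (w.2.orderEmbOfFin h2 i : ℕ) < n) = Finset.univ := by
        ext i; simp
      rw [this] at h4
      zify
      omega
    · simp only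
      rw [← offType_eq_letterType, ← onType_eq_map_orderEmb]
      exact h3
  · rintro w w' ⟨h1, h2, h3⟩ ⟨h1', h2', h3'⟩ he
    simp only [Prod.mk.injEq] at he
    obtain ⟨e1, e2⟩ := he
    have key : ∀ i, w.2.orderEmbOfFin h2 i = w'.2.orderEmbOfFin h2' i := by
      intro i
      refine (h1.isRecord (Finset.orderEmbOfFin_mem _ _ _)).eq_of_height_eq
        (e1 ▸ h1'.isRecord (Finset.orderEmbOfFin_mem _ _ _)) ?_
      rw [h1.height_orderEmb h2, e1, h1'.height_orderEmb h2']
      congr 1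
      exact Finset.sum_congr rfl fun j _ => by rw [congrFun e2 j]
    have hA : w.2 = w'.2 := by
      rw [← Finset.map_orderEmbOfFin_univ w.2 h2, ← Finset.map_orderEmbOfFin_univ w'.2 h2']
      congr 1
      ext i
      simp [key]
    refine Prod.ext ?_ hA
    funext x
    by_cases hx : x ∈ w.2
    · have : x ∈ Set.range (w.2.orderEmbOfFin h2) := by
        rw [Finset.range_orderEmbOfFin]; exact hx
      obtain ⟨i, rfl⟩ := this
      have := congrFun e2 i
      rw [this, key]
    · have h4 := congrFun e1 x
      unfold offWord at h4
      rw [if_neg hx, if_neg (hA ▸ hx)] at h4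
      exact h4
  · rintro ⟨f, l⟩ ⟨hf, hl, hsum, hP⟩
    simp only at hf hl hsum hP
    have hn : height f n = -∑ i, (l i : ℤ) := by
      rw [height_last]
      zify at hsum
      omega
    -- the level at which the `i`-th marked letter is inserted
    let p : Fin c → ℕ := fun i => ∑ j ∈ Finset.univ.filter (· < i), l j
    have hsucc : ∀ i : Fin c, Finset.univ.filter (· < i) ⊂ (Finset.univ : Finset (Fin c)) := by
      intro i
      rw [Finset.ssubset_univ_iff]
      intro h
      have := Finset.mem_univ i
      rw [← h] at this
      simp at this
    have hp : ∀ i, height f n < -(p i : ℤ) := by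
      intro i
      rw [hn]
      have : p i < ∑ i, l i := Finset.sum_lt_sum_of_subset (hsucc i).subset (Finset.mem_univ i)
        (by simp) (hl i) (fun _ _ _ => Nat.zero_le _)
      zify at this
      omega
    choose e he1 he2 using fun i => exists_isRecord f (hp i)
    have hpmono : StrictMono p := by
      intro i i' h
      refine Finset.sum_lt_sum_of_subset (i := i) ?_ (by simpa using h) (by simp) (hl i)
        (fun _ _ _ => Nat.zero_le _)
      intro j hj
      simp only [Finset.mem_filter, Finset.mem_univ, true_and] at hj ⊢
      exact hj.trans h
    have hemono : StrictMono e := by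
      intro i i' h
      rw [(he1 i).lt_iff (he1 i'), he2, he2]
      have := hpmono h
      omega
    let A : Finset (Fin n) := Finset.univ.image e
    have hA : A.card = c := by
      rw [Finset.card_image_of_injective _ hemono.injective, Finset.card_univ, Fintype.card_fin]
    let F : Fin n → ℕ := fun x => if x ∈ A then Function.extend e l 0 x else f x
    have hFe : ∀ i, F (e i) = l i := by
      intro i
      simp only [F]
      rw [if_pos (Finset.mem_image_of_mem _ (Finset.mem_univ _)), hemono.injective.extend_apply]
    have hemb : ∀ i, A.orderEmbOfFin hA i = e i := by
      have := Finset.orderEmbOfFin_unique hA (f := e)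
        (fun i => Finset.mem_image_of_mem _ (Finset.mem_univ _)) hemono
      intro i; rw [this]
    have hoff : offWord (F, A) = f := by
      funext x
      unfold offWord
      simp only [F]
      split_ifs with hx
      · obtain ⟨i, -, rfl⟩ := Finset.mem_image.1 hx
        exact (he1 i).1.symm
      · rfl
    have hheight : ∀ x, height F x = height f x +
        ∑ i ∈ Finset.univ.filter (fun i => (e i : ℕ) < x), (l i : ℤ) := by
      intro x
      have := height_add_sum_marks (F, A) x
      rw [hoff, sum_filter_orderEmb hA] at this
      simp only [hemb, hFe] at this
      exact this
    have hat : ∀ i, height F (e i) = 0 := by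
      intro i
      rw [hheight, he2]
      have : (Finset.univ.filter fun j => (e j : ℕ) < e i) = Finset.univ.filter (· < i) := by
        refine Finset.filter_congr fun j _ => ?_
        rw [Fin.val_fin_lt, hemono.lt_iff_lt]
      rw [this]
      simp [p]
    have hroot : IsRootedWord F A := by
      refine ⟨⟨fun x hx => ?_, ?_⟩, ?_, ?_, ?_⟩
      · rw [hheight]
        by_cases hall : ∀ i, (e i : ℕ) < x
        · have : (Finset.univ.filter fun i => (e i : ℕ) < x) = Finset.univ := by
            ext i; simp [hall i]
          rw [this]
          have := hf.min x hx
          omega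
        · push Not at hall
          obtain ⟨i, hi, hmin⟩ := Finset.exists_min_image
            (Finset.univ.filter fun i => x ≤ (e i : ℕ)) id (by
              obtain ⟨i, hi⟩ := hall
              exact ⟨i, by simpa using hi⟩)
          simp only [Finset.mem_filter, Finset.mem_univ, true_and, id] at hi hmin
          have : (Finset.univ.filter fun j => (e j : ℕ) < x) = Finset.univ.filter (· < i) := by
            refine Finset.filter_congr fun j _ => ⟨fun h => ?_, fun h => ?_⟩
            · by_contra hcon
              have h1 := hemono.monotone (not_lt.1 hcon)
              rw [Fin.le_def] at h1
              omega
            · by_contra hcon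
              exact absurd (hmin j (not_lt.1 hcon)) (not_le.2 h)
          rw [this]
          have h1 := (he1 i).2 x hi
          rw [he2] at h1
          simp only [p] at h1
          push_cast at h1
          omega
      · rw [hheight, hn]
        have : (Finset.univ.filter fun i => (e i : ℕ) < n) = Finset.univ := by
          ext i; simp
        rw [this]
        simp
      · have h0 : e ⟨0, hc⟩ = 0 := by
          refine (he1 _).eq_of_height_eq ⟨hf.zero, fun y hy => ?_⟩ ?_
          · have : y = 0 := by simpa using hy
            rw [this]; simp
          · rw [he2]
            simp only [Fin.val_zero, height_zero, p, neg_eq_zero, Nat.cast_eq_zero]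
            apply Finset.sum_eq_zero
            intro j hj
            simp [Fin.lt_def] at hj
        rw [← h0]
        exact Finset.mem_image_of_mem _ (Finset.mem_univ _)
      · intro a ha
        obtain ⟨i, -, rfl⟩ := Finset.mem_image.1 ha
        exact hat i
      · intro a ha
        obtain ⟨i, -, rfl⟩ := Finset.mem_image.1 ha
        rw [hFe]; exact hl i
    have hlist : (fun i => F (A.orderEmbOfFin hA i)) = l := by
      funext i; rw [hemb, hFe]
    refine ⟨(F, A), ⟨hroot, hA, ?_⟩, ?_⟩
    · rw [offType_eq_letterType, hoff, onType_eq_map_orderEmb _ hA]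
      simp only
      rw [hlist]
      exact hP
    · simp only [hoff, hlist]

/-! ### The cycle lemma -/

/-- The running minimum of the periodic height function. -/
def runningMin (f : Fin n → ℕ) : ℕ → ℤ
  | 0 => periodicHeight f 0
  | x + 1 => min (runningMin f x) (periodicHeight f (x + 1))

lemma runningMin_le (f : Fin n → ℕ) {x y : ℕ} (h : y ≤ x) :
    runningMin f x ≤ periodicHeight f y := by
  induction x with
  | zero => rw [Nat.le_zero.1 h]; exact le_rfl
  | succ x ih =>
    rcases h.lt_or_eq with h | h
    · exact (min_le_left _ _).trans (ih (Nat.lt_succ_iff.1 h))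
    · rw [h]; exact min_le_right _ _

lemma exists_runningMin_eq (f : Fin n → ℕ) (x : ℕ) :
    ∃ y ≤ x, runningMin f x = periodicHeight f y := by
  induction x with
  | zero => exact ⟨0, le_rfl, rfl⟩
  | succ x ih =>
    obtain ⟨y, hy, he⟩ := ih
    rcases min_choice (runningMin f x) (periodicHeight f (x + 1)) with h | h
    · exact ⟨y, by omega, h.trans he⟩
    · exact ⟨x + 1, le_rfl, h⟩

lemma periodicHeight_succ (f : Fin n → ℕ) (x : ℕ) :
    periodicHeight f (x + 1) = periodicHeight f x + periodicExt f x - 1 := by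
  unfold periodicHeight
  rw [Finset.sum_range_succ]
  push_cast
  ring

lemma height_rotate (f : Fin n → ℕ) (u : Fin n) {x : ℕ} (hx : x ≤ n) :
    height (fun i => f (i + u)) x = periodicHeight f (u + x) - periodicHeight f u := by
  rw [height_eq_periodicHeight _ hx]
  unfold periodicHeight
  rw [Finset.sum_range_add]
  have : ∀ i, periodicExt (fun i => f (i + u)) i = periodicExt f (u + i) := by
    intro i
    exact congrArg f (Fin.ext (by simp [Fin.val_add, add_comm]))
  simp only [this]
  push_cast
  ring

/-- The rotation of `f` by `u` is good exactly if the running minimum drops after `u` (in the second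
period, when the minimum does not depend on the starting point any more). -/
lemma isGood_rotate_iff (f : Fin n → ℕ) (hf : ∑ x, f x < n) (u : Fin n) :
    IsGood (fun i => f (i + u)) ↔ runningMin f (n + u) - runningMin f (n + u + 1) = 1 := by
  have hN : periodicHeight f n < 0 := by
    rw [← height_eq_periodicHeight f le_rfl, height_last]
    zify at hf
    omega
  have hadd := periodicHeight_add f
  have hext : periodicExt f (n + u) = f u := by
    exact congrArg f (Fin.ext (by simp [Nat.mod_eq_of_lt u.2]))
  have hs := periodicHeight_succ f (n + u)
  have hM : runningMin f (n + u + 1) = min (runningMin f (n + u)) (periodicHeight f (n + u + 1)) := rfl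
  have hle := runningMin_le f (le_refl (n + (u : ℕ)))
  have hmin : (∀ x ≤ n, periodicHeight f (n + u) ≤ periodicHeight f (u + x)) ↔
      runningMin f (n + u) = periodicHeight f (n + u) := by
    constructor
    · intro h
      obtain ⟨y, hy, he⟩ := exists_runningMin_eq f (n + u)
      rcases le_or_gt (u : ℕ) y with h1 | h1
      · have := h (y - u) (by omega)
        rw [show (u : ℕ) + (y - u) = y by omega] at this
        omega
      · have := h (n + y - u) (by omega)
        rw [show (u : ℕ) + (n + y - u) = n + y by omega] at this
        have h2 := hadd y
        omega
    · intro h x hx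
      rw [← h]
      exact runningMin_le f (by omega)
  have hgood : IsGood (fun i => f (i + u)) ↔
      f u = 0 ∧ ∀ x ≤ n, periodicHeight f (n + u) ≤ periodicHeight f (u + x) := by
    constructor
    · rintro ⟨h1, h2⟩
      refine ⟨by simpa using h1, fun x hx => ?_⟩
      have := h2 x hx
      rw [height_rotate f u hx, height_rotate f u le_rfl, add_comm (u : ℕ) n] at this
      omega
    · rintro ⟨h1, h2⟩
      refine ⟨by simpa using h1, fun x hx => ?_⟩
      have := h2 x hx
      rw [height_rotate f u hx, height_rotate f u le_rfl, add_comm (u : ℕ) n]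
      omega
  rw [hgood, hmin]
  omega

lemma card_isGood_rotate (f : Fin n → ℕ) (hf : ∑ x, f x < n) [DecidablePred (IsGood (n := n))] :
    (Finset.univ.filter fun u : Fin n => IsGood fun i => f (i + u)).card = n - ∑ x, f x := by
  have hN : periodicHeight f n = ∑ x, (f x : ℤ) - n := by
    rw [← height_eq_periodicHeight f le_rfl, height_last]
  have hadd := periodicHeight_add f
  have hn := Nat.pos_of_neZero n
  -- the running minimum drops by zero or one at each step
  have hstep : ∀ u : Fin n, ((if IsGood fun i => f (i + u) then 1 else 0 : ℕ) : ℤ) =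
      runningMin f (n + u) - runningMin f (n + u + 1) := by
    intro u
    have h1 := isGood_rotate_iff f hf u
    have hs := periodicHeight_succ f (n + u)
    have hM : runningMin f (n + u + 1) =
      min (runningMin f (n + u)) (periodicHeight f (n + u + 1)) := rfl
    have hle := runningMin_le f (le_refl (n + (u : ℕ)))
    split_ifs with h
    · rw [h1] at h; rw [h]; rfl
    · rw [h1] at h; push_cast; omega
  have hperiod : runningMin f (n + n) = runningMin f n + periodicHeight f n := by
    zify at hf
    apply le_antisymm
    · obtain ⟨y, hy, he⟩ := exists_runningMin_eq f n
      have h2 := runningMin_le f (show n + y ≤ n + n by omega)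
      have h3 := hadd y
      omega
    · obtain ⟨y, hy, he⟩ := exists_runningMin_eq f (n + n)
      rw [he]
      rcases le_or_gt n y with h | h
      · have h2 := runningMin_le f (show y - n ≤ n by omega)
        have h3 := hadd (y - n)
        rw [show n + (y - n) = y by omega] at h3
        omega
      · have h2 := runningMin_le f h.le
        omega
  rw [Finset.card_filter, ← Nat.cast_inj (R := ℤ), Nat.cast_sum, Finset.sum_congr rfl fun u _ => hstep u,
    Fin.sum_univ_eq_sum_range (fun u => runningMin f (n + u) - runningMin f (n + u + 1)) n]
  have := Finset.sum_range_sub' (fun u => runningMin f (n + u)) n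
  simp only [← add_assoc] at this
  rw [this, add_zero, hperiod, hN, Nat.cast_sub hf.le]
  push_cast
  ring

lemma letterType_rotate (f : Fin n → ℕ) (u : Fin n) :
    letterType (fun i => f (i + u)) = letterType f := by
  unfold letterType
  have : (Finset.univ.filter fun x => 0 < f x) =
      (Finset.univ.filter fun x => 0 < f (x + u)).map (Equiv.addRight u).toEmbedding := by
    ext x
    simp
  rw [this, Finset.map_val, Multiset.map_map]
  rfl

lemma finite_setOf_sum_eq {ι : Type*} [Fintype ι] (N : ℕ) : {f : ι → ℕ | ∑ x, f x = N}.Finite := by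
  classical
  refine (Set.finite_Iic (fun _ : ι => N)).subset fun f hf x => ?_
  rw [← (hf : ∑ x, f x = N)]
  exact Finset.single_le_sum (fun _ _ => Nat.zero_le _) (Finset.mem_univ x)

/-- The cycle lemma, for words with a given multiset of nonzero letters. -/
theorem cycle_lemma (P : Multiset ℕ → Prop) {N : ℕ} (hN : N < n) :
    n * {f : Fin n → ℕ | IsGood f ∧ ∑ x, f x = N ∧ P (letterType f)}.ncard =
      (n - N) * {f : Fin n → ℕ | ∑ x, f x = N ∧ P (letterType f)}.ncard := by
  classical
  have hfin : {f : Fin n → ℕ | ∑ x, f x = N ∧ P (letterType f)}.Finite :=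
    (finite_setOf_sum_eq N).subset fun f hf => hf.1
  set S := hfin.toFinset with hS
  have hmem : ∀ f, f ∈ S ↔ ∑ x, f x = N ∧ P (letterType f) := by intro f; simp [hS]
  have h1 : {f : Fin n → ℕ | ∑ x, f x = N ∧ P (letterType f)}.ncard = S.card := by
    rw [← Set.ncard_coe_finset]; congr 1; ext f; simp [hmem]
  have h2 : {f : Fin n → ℕ | IsGood f ∧ ∑ x, f x = N ∧ P (letterType f)}.ncard =
      (S.filter IsGood).card := by
    rw [← Set.ncard_coe_finset]; congr 1; ext f; simp [hmem, and_comm]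
  rw [h1, h2]
  have h3 := Finset.sum_card_bipartiteAbove_eq_sum_card_bipartiteBelow
    (s := (Finset.univ : Finset (Fin n))) (t := S)
    (fun u f => IsGood fun i => f (i + u))
  have h4 : ∀ u ∈ (Finset.univ : Finset (Fin n)),
      (Finset.bipartiteAbove (fun u f => IsGood fun i => f (i + u)) S u).card =
        (S.filter IsGood).card := by
    intro u _
    unfold Finset.bipartiteAbove
    refine Finset.card_equiv ((Equiv.addRight u).symm.arrowCongr (Equiv.refl ℕ)) fun f => ?_
    have e : ((Equiv.addRight u).symm.arrowCongr (Equiv.refl ℕ)) f = fun i => f (i + u) := rfl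
    rw [e, Finset.mem_filter, Finset.mem_filter, hmem, hmem, letterType_rotate]
    rw [Fintype.sum_equiv (Equiv.addRight u) (fun i => f (i + u)) f fun x => rfl]
  have h5 : ∀ f ∈ S, (Finset.bipartiteBelow (fun u f => IsGood fun i => f (i + u))
      (Finset.univ : Finset (Fin n)) f).card = n - N := by
    intro f hf
    have := (hmem f).1 hf
    unfold Finset.bipartiteBelow
    rw [card_isGood_rotate f (by omega), this.1]
  rw [Finset.sum_congr rfl h4, Finset.sum_congr rfl h5] at h3
  simp only [Finset.sum_const, Finset.card_univ, Fintype.card_fin, smul_eq_mul] at h3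
  rw [h3, mul_comm]

end removal
end AnnularCSP
end

noncomputable section
namespace AnnularCSP

open Equiv

/-! ### Counting words and sequences -/

section counting

lemma ncard_eq_sum_ncard_fiber {α : Type*} {S : Set α} (hS : S.Finite) (f : α → ℕ) {N : ℕ}
    (hN : ∀ x ∈ S, f x < N) : S.ncard = ∑ i ∈ Finset.range N, {x | x ∈ S ∧ f x = i}.ncard := by
  classical
  rw [Set.ncard_eq_toFinset_card S hS, Finset.card_eq_sum_card_fiberwise (f := f)
    (t := Finset.range N) fun x hx => by simpa using hN x (by simpa using hx)]
  refine Finset.sum_congr rfl fun i _ => ?_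
  rw [← Set.ncard_coe_finset]
  congr 1
  ext x
  simp

/-- The functions with a given multiset of values form one orbit under permutation of the
arguments; the stabilizer permutes the fibres. -/
theorem ncard_map_eq {ι : Type*} [Fintype ι] {M : Multiset ℕ} (hM : M.card = Fintype.card ι) :
    {f : ι → ℕ | Finset.univ.val.map f = M}.ncard * ∏ i ∈ M.toFinset, (M.count i).factorial =
      (Fintype.card ι).factorial := by
  classical
  obtain ⟨f₀, hf₀⟩ : ∃ f₀ : ι → ℕ, Finset.univ.val.map f₀ = M := by
    let e := Fintype.equivFinOfCardEq hM.symm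
    refine ⟨fun x => M.toList.get (Fin.cast (by simp) (e x)), ?_⟩
    have h1 : (Finset.univ : Finset ι).val.map e = (Finset.univ : Finset (Fin M.card)).val := by
      simp
    have h2 : (Finset.univ : Finset (Fin M.card)).val.map
        (fun i => M.toList.get (Fin.cast (by simp) i)) = M := by
      have h3 : List.ofFn (fun i : Fin M.card => M.toList.get (Fin.cast (by simp) i)) =
          M.toList := by
        apply List.ext_get <;> simp
      conv_rhs => rw [← M.coe_toList, ← h3]
      rw [Fin.univ_def, List.ofFn_eq_map]
      rfl
    rw [← h1, Multiset.map_map] at h2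
    exact h2
  have hcount : ∀ (f : ι → ℕ) (i : ℕ), (Finset.univ.val.map f).count i =
      Fintype.card {x // f x = i} := by
    intro f i
    rw [Multiset.count_map, Fintype.card_subtype, Finset.card_def, Finset.filter_val]
    congr 1
    exact Multiset.filter_congr fun x _ => eq_comm
  have hfin : {f : ι → ℕ | Finset.univ.val.map f = M}.Finite := by
    refine Set.Finite.subset (Set.finite_Iic (fun _ : ι => M.sum)) fun f hf x => ?_
    rw [← (hf : Finset.univ.val.map f = M)]
    exact Finset.single_le_sum (f := f) (fun _ _ => Nat.zero_le _) (Finset.mem_univ x)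
  have hstab := DomMulAct.stabilizer_card' f₀
  have himg : Finset.univ.image f₀ = M.toFinset := by
    rw [← hf₀]; rfl
  rw [himg, Fintype.card_subtype] at hstab
  have hprod : ∏ i ∈ M.toFinset, (Fintype.card {x // f₀ x = i}).factorial =
      ∏ i ∈ M.toFinset, (M.count i).factorial :=
    Finset.prod_congr rfl fun i _ => by rw [← hcount f₀ i, hf₀]
  rw [hprod] at hstab
  rw [Set.ncard_eq_toFinset_card _ hfin, ← Fintype.card_perm, ← Finset.card_univ,
    Finset.card_eq_sum_card_fiberwise (f := fun g : Perm ι => f₀ ∘ g) (t := hfin.toFinset),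
    ← smul_eq_mul, ← Finset.sum_const]
  · refine Finset.sum_congr rfl fun f hf => ?_
    have hf' : Finset.univ.val.map f = M := by simpa using hf
    have e : ∀ i, Nonempty ({x // f x = i} ≃ {x // f₀ x = i}) := fun i =>
      Fintype.card_eq.1 (by rw [← hcount, ← hcount, hf', hf₀])
    obtain ⟨g, hg⟩ : ∃ g : Perm ι, f₀ ∘ g = f :=
      ⟨Equiv.ofFiberEquiv fun i => (e i).some, by
        funext x; exact Equiv.ofFiberEquiv_map _ _⟩
    rw [← hstab]
    refine Finset.card_equiv (Equiv.mulRight g) fun h => ?_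
    simp only [Finset.mem_filter, Finset.mem_univ, true_and, Equiv.coe_mulRight, Perm.coe_mul]
    rw [← hg, ← Function.comp_assoc]
    exact ⟨fun h1 => by rw [h1], fun h1 => by
      funext x
      have := congrFun h1 (g.symm x)
      simpa using this⟩
  · intro g _
    have h1 : (Finset.univ : Finset ι).val.map g = (Finset.univ : Finset ι).val := by
      simp
    have : Finset.univ.val.map (f₀ ∘ g) = M := by
      rw [← Multiset.map_map, h1, hf₀]
    simpa using this

lemma univ_map_eq_letterType_add {n : ℕ} (f : Fin n → ℕ) :
    Finset.univ.val.map f = letterType f + Multiset.replicate (n - (letterType f).card) 0 := by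
  have h1 := Multiset.filter_add_not (fun x => 0 < f x) (Finset.univ : Finset (Fin n)).val
  conv_lhs => rw [← h1, Multiset.map_add]
  have h2 : letterType f = (Multiset.filter (fun x => 0 < f x) Finset.univ.val).map f := by
    rw [letterType, Finset.filter_val]
  rw [← h2]
  congr 1
  have h3 : (Multiset.filter (fun x => ¬ 0 < f x) (Finset.univ : Finset (Fin n)).val).card =
      n - (letterType f).card := by
    have := congrArg Multiset.card h1
    rw [Multiset.card_add, Finset.card_val, Finset.card_univ, Fintype.card_fin] at this
    rw [h2, Multiset.card_map]
    omega
  rw [← h3, ← Multiset.card_map f, Multiset.eq_replicate_card]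
  intro b hb
  rw [Multiset.mem_map] at hb
  obtain ⟨x, hx, rfl⟩ := hb
  simpa using (Multiset.mem_filter.1 hx).2

lemma zero_notMem_letterType {n : ℕ} (f : Fin n → ℕ) : 0 ∉ letterType f := by
  intro h
  obtain ⟨x, hx, h0⟩ := Multiset.mem_map.1 h
  rw [Finset.mem_val, Finset.mem_filter] at hx
  omega

lemma card_letterType_le {n : ℕ} (f : Fin n → ℕ) : (letterType f).card ≤ n := by
  rw [letterType, Multiset.card_map, Finset.card_val]
  exact (Finset.card_le_univ _).trans (by simp)

/-- The number of words with given nonzero letters. -/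
theorem ncard_letterType_eq {n : ℕ} {α : Multiset ℕ} (h0 : 0 ∉ α) (hα : α.card ≤ n) :
    {f : Fin n → ℕ | letterType f = α}.ncard *
      ((n - α.card).factorial * ∏ i ∈ α.toFinset, (α.count i).factorial) = n.factorial := by
  classical
  have h1 : {f : Fin n → ℕ | letterType f = α} = {f : Fin n → ℕ | Finset.univ.val.map f =
      α + Multiset.replicate (n - α.card) 0} := by
    ext f
    constructor
    · rintro (h : letterType f = α)
      rw [Set.mem_ofPred_eq, univ_map_eq_letterType_add, h]
    · rintro (h : _ = _)
      have h2 := congrArg (Multiset.filter (fun i => 0 < i)) h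
      rw [univ_map_eq_letterType_add, Multiset.filter_add, Multiset.filter_add] at h2
      have h3 : ∀ k, Multiset.filter (fun i => 0 < i) (Multiset.replicate k 0) = 0 := by
        intro k
        rw [Multiset.filter_eq_nil]
        intro a ha
        rw [Multiset.eq_of_mem_replicate ha]
        simp
      have h4 : ∀ β : Multiset ℕ, 0 ∉ β → Multiset.filter (fun i => 0 < i) β = β := by
        intro β hβ
        rw [Multiset.filter_eq_self]
        intro a ha
        exact Nat.pos_of_ne_zero fun h => hβ (h ▸ ha)
      rw [h3, h3, h4 _ (zero_notMem_letterType f), h4 _ h0, add_zero, add_zero] at h2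
      exact h2
  have h2 := ncard_map_eq (ι := Fin n) (M := α + Multiset.replicate (n - α.card) 0)
    (by simp; omega)
  rw [← h1, Fintype.card_fin] at h2
  rw [← h2]
  congr 1
  have h3 : ∏ i ∈ (α + Multiset.replicate (n - α.card) 0).toFinset,
      ((α + Multiset.replicate (n - α.card) 0).count i).factorial =
      ∏ i ∈ insert 0 α.toFinset, ((α + Multiset.replicate (n - α.card) 0).count i).factorial := by
    apply Finset.prod_subset
    · intro i hi
      simp only [Multiset.toFinset_add, Finset.mem_union, Multiset.mem_toFinset,
        Finset.mem_insert] at hi ⊢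
      rcases hi with h | h
      · exact Or.inr h
      · exact Or.inl (Multiset.eq_of_mem_replicate h)
    · intro i _ hi
      rw [Multiset.mem_toFinset] at hi
      rw [Multiset.count_eq_zero.2 hi]
      rfl
  rw [h3, Finset.prod_insert (by simpa using h0)]
  congr 1
  · rw [Multiset.count_add, Multiset.count_eq_zero.2 h0, Multiset.count_replicate_self, zero_add]
  · refine Finset.prod_congr rfl fun i hi => ?_
    rw [Multiset.mem_toFinset] at hi
    have hi0 : i ≠ 0 := fun h => h0 (h ▸ hi)
    have : (Multiset.replicate (n - α.card) 0).count i = 0 :=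
      Multiset.count_eq_zero.2 fun h => hi0 (Multiset.eq_of_mem_replicate h)
    rw [Multiset.count_add, this, add_zero]

/-- The number of functions with a given support and a given sum. -/
lemma ncard_support_sum {ι : Type*} [Fintype ι] [DecidableEq ι] (A : Finset ι) (j : ℕ) :
    {f : ι → ℕ | (∀ x, 0 < f x ↔ x ∈ A) ∧ ∑ x, f x = A.card + j}.ncard = A.card.multichoose j := by
  rw [← Finset.card_finsuppAntidiag_nat_eq_multichoose, ← Set.ncard_coe_finset (A.finsuppAntidiag j)]
  have hsum : ∀ g : ι →₀ ℕ, ∑ x, (if x ∈ A then g x + 1 else 0) = A.card + A.sum g := by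
    intro g
    rw [Finset.sum_ite_mem, Finset.univ_inter, Finset.sum_add_distrib]
    simp [add_comm]
  symm
  refine Set.ncard_congr (fun (g : ι →₀ ℕ) _ x => if x ∈ A then g x + 1 else 0) ?_ ?_ ?_
  · intro g hg
    rw [Finset.mem_coe, Finset.mem_finsuppAntidiag] at hg
    refine ⟨fun x => by by_cases h : x ∈ A <;> simp [h], ?_⟩
    rw [hsum g, hg.1]
  · intro g g' hg hg' h
    rw [Finset.mem_coe, Finset.mem_finsuppAntidiag] at hg hg'
    ext x
    have h1 := congrFun h x
    by_cases hx : x ∈ A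
    · simpa [hx] using h1
    · rw [Finsupp.notMem_support_iff.1 fun h => hx (hg.2 h),
        Finsupp.notMem_support_iff.1 fun h => hx (hg'.2 h)]
  · rintro f ⟨h1, h2⟩
    let g : ι →₀ ℕ := Finsupp.equivFunOnFinite.symm fun x => f x - 1
    have hsub : g.support ⊆ A := by
      intro x hx
      rw [Finsupp.mem_support_iff] at hx
      rw [← h1]
      have : f x - 1 ≠ 0 := hx
      omega
    have hf : (fun x => if x ∈ A then g x + 1 else 0) = f := by
      funext x
      have h3 := h1 x
      split_ifs with h
      · have : 0 < f x := h3.2 h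
        change f x - 1 + 1 = f x
        omega
      · have : ¬ 0 < f x := fun h4 => h (h3.1 h4)
        omega
    refine ⟨g, ?_, hf⟩
    rw [Finset.mem_coe, Finset.mem_finsuppAntidiag]
    refine ⟨?_, hsub⟩
    have h4 := hsum g
    have h5 : ∑ x, f x = ∑ x, (if x ∈ A then g x + 1 else 0) :=
      Finset.sum_congr rfl fun x _ => (congrFun hf x).symm
    omega

lemma ncard_pos_sum (c j : ℕ) :
    {l : Fin c → ℕ | (∀ i, 0 < l i) ∧ ∑ i, l i = c + j}.ncard = c.multichoose j := by
  have := ncard_support_sum (Finset.univ : Finset (Fin c)) j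
  simpa using this

/-- The number of words with given number and given sum of the nonzero letters. -/
theorem ncard_card_letterType_eq (n r j : ℕ) :
    {f : Fin n → ℕ | ∑ x, f x = r + j ∧ (letterType f).card = r}.ncard =
      n.choose r * r.multichoose j := by
  classical
  set S := {f : Fin n → ℕ | ∑ x, f x = r + j ∧ (letterType f).card = r}
  have hS : S.Finite := (finite_setOf_sum_eq (r + j)).subset fun f hf => hf.1
  rw [Set.ncard_eq_toFinset_card S hS, Finset.card_eq_sum_card_fiberwise
    (f := fun f => Finset.univ.filter fun x => 0 < f x)
    (t := Finset.powersetCard r (Finset.univ : Finset (Fin n)))]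
  · have : ∀ A ∈ Finset.powersetCard r (Finset.univ : Finset (Fin n)),
        (hS.toFinset.filter fun f => (Finset.univ.filter fun x => 0 < f x) = A).card =
          r.multichoose j := by
      intro A hA
      have hcard := (Finset.mem_powersetCard.1 hA).2
      rw [← hcard, ← ncard_support_sum, ← Set.ncard_coe_finset]
      congr 1
      ext f
      simp only [Finset.coe_filter, Set.Finite.mem_toFinset, Set.mem_ofPred_eq, S, letterType,
        Multiset.card_map, Finset.card_val]
      constructor
      · rintro ⟨⟨h1, h2⟩, h3⟩
        refine ⟨fun x => by rw [← h3]; simp, by rw [hcard]; exact h1⟩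
      · rintro ⟨h1, h2⟩
        have h3 : (Finset.univ.filter fun x => 0 < f x) = A := by ext x; simp [h1]
        refine ⟨⟨by rw [← hcard]; exact h2, by rw [h3, hcard]⟩, h3⟩
    rw [Finset.sum_congr rfl this, Finset.sum_const, Finset.card_powersetCard, smul_eq_mul,
      Finset.card_univ, Fintype.card_fin]
  · intro f hf
    have hf' : f ∈ S := by simpa using hf
    have := hf'.2
    rw [letterType, Multiset.card_map, Finset.card_val] at this
    rw [Finset.mem_coe, Finset.mem_powersetCard]
    exact ⟨Finset.subset_univ _, this⟩

/-- The Vandermonde identity for multisets. -/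
lemma multichoose_add (a b k : ℕ) : (a + b).multichoose k =
    ∑ i ∈ Finset.range (k + 1), a.multichoose i * b.multichoose (k - i) := by
  induction a generalizing k with
  | zero =>
    rw [Finset.sum_range_succ', Finset.sum_eq_zero]
    · simp
    · intro i _; simp
  | succ a iha =>
    induction k with
    | zero => simp
    | succ k ihk =>
      have h1 := iha (k + 1)
      rw [Finset.sum_range_succ'] at h1
      rw [Finset.sum_range_succ', show a + 1 + b = a + b + 1 by ring, Nat.multichoose_succ_succ, h1,
        show a + b + 1 = a + 1 + b by ring, ihk, add_right_comm, ← Finset.sum_add_distrib]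
      congr 1
      · refine Finset.sum_congr rfl fun i _ => ?_
        rw [Nat.multichoose_succ_succ, show k + 1 - (i + 1) = k - i by omega]
        ring
      · simp

lemma multichoose_succ_left (c j : ℕ) : (c + 1).multichoose j = (c + j).choose c := by
  rw [Nat.multichoose_eq, show c + 1 + j - 1 = c + j by omega, ← Nat.choose_symm_add]

lemma add_mul_multichoose {c : ℕ} (hc : 1 ≤ c) (j : ℕ) :
    (c + j) * c.multichoose j = c * (c + j).choose c := by
  obtain ⟨c, rfl⟩ := Nat.exists_eq_add_of_le' hc
  rw [multichoose_succ_left, show c + 1 + j = c + j + 1 by ring, Nat.add_one_mul_choose_eq]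
  ring

end counting

/-! ### Counting rooted words -/

section rooted
variable {n c : ℕ}

lemma card_offType_le_sum (w : MarkedWord n) : (offType w).card ≤ (offType w).sum := by
  rw [offType_eq_letterType]
  have := Multiset.card_nsmul_le_sum (s := letterType (offWord w)) (a := 1) fun x hx =>
    Nat.pos_of_ne_zero fun h => zero_notMem_letterType _ (h ▸ hx)
  simpa using this

lemma card_offType_le (w : MarkedWord n) : (offType w).card ≤ n := by
  rw [offType_eq_letterType]
  exact card_letterType_le _

variable [NeZero n]

lemma finite_rooted (c : ℕ) (P : Multiset ℕ → Multiset ℕ → Prop) :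
    {w : MarkedWord n | IsRootedWord w.1 w.2 ∧ w.2.card = c ∧ P (offType w) (onType w)}.Finite := by
  classical
  refine Set.Finite.subset ((finite_setOf_sum_eq n).prod (Set.finite_univ (α := Finset (Fin n)))) ?_
  rintro ⟨F, A⟩ ⟨h, -⟩
  refine ⟨?_, trivial⟩
  have := h.luk.last
  rw [height_last] at this
  change ∑ x, F x = n
  zify
  simp only at this
  omega

/-- Rooted words whose unmarked letters add up to `N`: the unmarked letters, counted by the cycle
lemma, and the marked letters can be chosen independently. -/
theorem ncard_rooted_of_sum (hc : 1 ≤ c) (N : ℕ) (A B : Multiset ℕ → Prop) :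
    n * {w : MarkedWord n | IsRootedWord w.1 w.2 ∧ w.2.card = c ∧
        ((offType w).sum = N ∧ A (offType w)) ∧ B (onType w)}.ncard =
      (n - N) * ({f : Fin n → ℕ | ∑ x, f x = N ∧ A (letterType f)}.ncard *
        {l : Fin c → ℕ | (∀ i, 0 < l i) ∧ ∑ i, l i = n - N ∧ B (Finset.univ.val.map l)}.ncard) := by
  rw [ncard_rootedWords hc fun a b => (a.sum = N ∧ A a) ∧ B b]
  rcases lt_or_ge N n with hN | hN
  · rw [← mul_assoc, ← cycle_lemma A hN, mul_assoc, ← Set.ncard_prod]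
    congr 2
    ext ⟨f, l⟩
    simp only [Set.mem_ofPred_eq, Set.mem_prod, sum_letterType]
    constructor
    · rintro ⟨h1, h2, h3, ⟨h4, h5⟩, h6⟩
      exact ⟨⟨h1, h4, h5⟩, h2, by omega, h6⟩
    · rintro ⟨⟨h1, h4, h5⟩, h2, h3, h6⟩
      exact ⟨h1, h2, by omega, ⟨h4, h5⟩, h6⟩
  · rw [Nat.sub_eq_zero_of_le hN, zero_mul]
    convert mul_zero n
    rw [← Set.ncard_empty]
    congr 1
    rw [Set.eq_empty_iff_forall_notMem]
    rintro ⟨f, l⟩ ⟨h1, h2, h3, ⟨h4, h5⟩, h6⟩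
    have h7 := Finset.single_le_sum (f := l) (fun _ _ => Nat.zero_le _) (Finset.mem_univ ⟨0, hc⟩)
    have h8 := h2 ⟨0, hc⟩
    simp only [sum_letterType] at h4 h7 h8 h3
    omega

/-- Rooted words with given letters. -/
theorem ncard_rooted_types (hc : 1 ≤ c) {α lam : Multiset ℕ} (hα : 0 ∉ α) (hlam : 0 ∉ lam)
    (hcard : lam.card = c) (hle : α.card ≤ n) (hsum : α.sum + lam.sum = n) :
    n * {w : MarkedWord n | IsRootedWord w.1 w.2 ∧ w.2.card = c ∧
        offType w = α ∧ onType w = lam}.ncard *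
      (((n - α.card).factorial * ∏ i ∈ α.toFinset, (α.count i).factorial) *
        ∏ i ∈ lam.toFinset, (lam.count i).factorial) =
      (n - α.sum) * (n.factorial * c.factorial) := by
  have h := ncard_rooted_of_sum (n := n) hc α.sum (· = α) (· = lam)
  have e1 : {w : MarkedWord n | IsRootedWord w.1 w.2 ∧ w.2.card = c ∧
      ((offType w).sum = α.sum ∧ offType w = α) ∧ onType w = lam} =
      {w : MarkedWord n | IsRootedWord w.1 w.2 ∧ w.2.card = c ∧
        offType w = α ∧ onType w = lam} := by
    ext w
    simp only [Set.mem_ofPred_eq]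
    exact ⟨fun ⟨h1, h2, h3, h4⟩ => ⟨h1, h2, h3.2, h4⟩,
      fun ⟨h1, h2, h3, h4⟩ => ⟨h1, h2, ⟨by rw [h3], h3⟩, h4⟩⟩
  have e2 : {f : Fin n → ℕ | ∑ x, f x = α.sum ∧ letterType f = α} =
      {f : Fin n → ℕ | letterType f = α} := by
    ext f
    simp only [Set.mem_ofPred_eq]
    exact ⟨fun h => h.2, fun h => ⟨by rw [← sum_letterType, h], h⟩⟩
  have e3 : {l : Fin c → ℕ | (∀ i, 0 < l i) ∧ ∑ i, l i = n - α.sum ∧ Finset.univ.val.map l = lam} =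
      {l : Fin c → ℕ | Finset.univ.val.map l = lam} := by
    ext l
    simp only [Set.mem_ofPred_eq]
    refine ⟨fun h => h.2.2, fun h => ⟨fun i => ?_, ?_, h⟩⟩
    · refine Nat.pos_of_ne_zero fun h0 => hlam ?_
      rw [← h, ← h0]
      exact Multiset.mem_map_of_mem l (Finset.mem_univ i)
    · have : (Finset.univ.val.map l).sum = ∑ i, l i := rfl
      rw [← this, h]
      omega
  rw [e1, e2, e3] at h
  have h2 := ncard_letterType_eq hα hle
  have h3 := ncard_map_eq (ι := Fin c) (M := lam) (by simpa using hcard)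
  rw [Fintype.card_fin] at h3
  rw [h, ← h2, ← h3]
  ring

/-- Rooted words with given number and given sum of the unmarked nonzero letters. -/
theorem ncard_rooted_card_sum (hc : 1 ≤ c) (r j : ℕ) :
    n * {w : MarkedWord n | IsRootedWord w.1 w.2 ∧ w.2.card = c ∧
        (offType w).card = r ∧ (offType w).sum = r + j}.ncard =
      c * (n - (r + j)).choose c * (n.choose r * r.multichoose j) := by
  have h := ncard_rooted_of_sum (n := n) hc (r + j) (fun a => a.card = r) (fun _ => True)
  have e1 : {w : MarkedWord n | IsRootedWord w.1 w.2 ∧ w.2.card = c ∧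
        ((offType w).sum = r + j ∧ (offType w).card = r) ∧ True} =
      {w : MarkedWord n | IsRootedWord w.1 w.2 ∧ w.2.card = c ∧
        (offType w).card = r ∧ (offType w).sum = r + j} := by
    ext w
    simp only [Set.mem_ofPred_eq, and_true]
    rw [and_comm (a := (offType w).sum = r + j)]
  rw [e1, ncard_card_letterType_eq] at h
  simp only [and_true] at h
  rw [h]
  rcases le_or_gt c (n - (r + j)) with h1 | h1
  · obtain ⟨i, hi⟩ := Nat.exists_eq_add_of_le h1
    rw [hi, ncard_pos_sum, ← add_mul_multichoose hc]
    ring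
  · rw [Nat.choose_eq_zero_of_lt h1]
    have : {l : Fin c → ℕ | (∀ i, 0 < l i) ∧ ∑ i, l i = n - (r + j)} = ∅ := by
      rw [Set.eq_empty_iff_forall_notMem]
      rintro l ⟨h2, h3⟩
      have h4 : ∑ i : Fin c, 1 ≤ ∑ i, l i := Finset.sum_le_sum fun i _ => h2 i
      simp at h4
      omega
    rw [this]
    simp

lemma IsRootedWord.sum_offType_le {w : MarkedWord n} (h : IsRootedWord w.1 w.2) :
    (offType w).sum ≤ n := by
  have h1 := h.luk.last
  rw [height_add_sum_marks, height_last] at h1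
  rw [offType_eq_letterType, sum_letterType]
  have h2 : 0 ≤ ∑ a ∈ w.2.filter (fun a : Fin n => (a : ℕ) < n), (w.1 a : ℤ) :=
    Finset.sum_nonneg fun _ _ => by positivity
  zify
  omega

/-- Rooted words with a given number of unmarked nonzero letters. -/
theorem ncard_rooted_card (hc : 1 ≤ c) (r : ℕ) :
    n * {w : MarkedWord n | IsRootedWord w.1 w.2 ∧ w.2.card = c ∧ (offType w).card = r}.ncard =
      c * (n.choose r * n.choose (r + c)) := by
  rw [ncard_eq_sum_ncard_fiber (finite_rooted c fun a _ => a.card = r)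
    (fun w => (offType w).sum - r) (N := n - r + 1), Finset.mul_sum]
  · have h1 : ∀ j ∈ Finset.range (n - r + 1),
        n * {w : MarkedWord n | w ∈ {w : MarkedWord n | IsRootedWord w.1 w.2 ∧ w.2.card = c ∧
          (offType w).card = r} ∧ (offType w).sum - r = j}.ncard =
        c * n.choose r * (r.multichoose j * (n - r - j).choose c) := by
      intro j _
      have := ncard_rooted_card_sum (n := n) hc r j
      rw [← Nat.sub_sub] at this
      rw [show c * n.choose r * (r.multichoose j * (n - r - j).choose c) =
        c * (n - r - j).choose c * (n.choose r * r.multichoose j) by ring, ← this]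
      congr 2
      ext w
      simp only [Set.mem_ofPred_eq]
      have h2 := card_offType_le_sum w
      constructor
      · rintro ⟨⟨h3, h4, h5⟩, h6⟩
        exact ⟨h3, h4, h5, by omega⟩
      · rintro ⟨h3, h4, h5, h6⟩
        exact ⟨⟨h3, h4, h5⟩, by omega⟩
    rw [Finset.sum_congr rfl h1, ← Finset.mul_sum, mul_assoc]
    congr 2
    rcases le_or_gt (r + c) n with h2 | h2
    · obtain ⟨K, hK⟩ := Nat.exists_eq_add_of_le h2
      have h3 : n.choose (r + c) = (r + (c + 1)).multichoose K := by
        rw [← add_assoc, multichoose_succ_left, hK]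
      rw [h3, multichoose_add]
      symm
      rw [← Finset.sum_subset (s₁ := Finset.range (K + 1)) (s₂ := Finset.range (n - r + 1))]
      · refine Finset.sum_congr rfl fun i hi => ?_
        rw [Finset.mem_range] at hi
        rw [multichoose_succ_left, show c + (K - i) = n - r - i by omega]
      · intro i; simp only [Finset.mem_range]; omega
      · intro i hi hi'
        rw [Finset.mem_range] at hi hi'
        rw [Nat.choose_eq_zero_of_lt (by omega), mul_zero]
    · rw [Nat.choose_eq_zero_of_lt h2]
      apply Finset.sum_eq_zero
      intro i _
      rcases le_or_gt r n with h3 | h3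
      · rw [Nat.choose_eq_zero_of_lt (by omega), mul_zero]
      · rw [Nat.choose_eq_zero_of_lt (by omega), mul_zero]
  · rintro w ⟨h1, h2, h3⟩
    have := h1.sum_offType_le
    omega

/-- Rooted words with a given number of marks. -/
theorem ncard_rooted (hc : 1 ≤ c) :
    n * {w : MarkedWord n | IsRootedWord w.1 w.2 ∧ w.2.card = c}.ncard =
      c * (2 * n).choose (n + c) := by
  have hfin := finite_rooted (n := n) c fun _ _ => True
  simp only [and_true] at hfin
  rw [ncard_eq_sum_ncard_fiber hfin (fun w => (offType w).card) (N := n + 1), Finset.mul_sum]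
  · have h1 : ∀ r ∈ Finset.range (n + 1),
        n * {w : MarkedWord n | w ∈ {w : MarkedWord n | IsRootedWord w.1 w.2 ∧ w.2.card = c} ∧
          (offType w).card = r}.ncard = c * (n.choose (n - r) * n.choose (r + c)) := by
      intro r hr
      rw [Finset.mem_range] at hr
      rw [Nat.choose_symm (by omega), ← ncard_rooted_card hc]
      congr 2
      ext w
      simp only [Set.mem_ofPred_eq, and_assoc]
    rw [Finset.sum_congr rfl h1, ← Finset.mul_sum, two_mul, Nat.add_choose_eq,
      Finset.Nat.sum_antidiagonal_eq_sum_range_succ_mk]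
    congr 1
    rw [← Finset.sum_range_reflect]
    rw [← Finset.sum_subset (s₁ := Finset.range (n + 1)) (s₂ := Finset.range (n + c).succ)]
    · refine Finset.sum_congr rfl fun i hi => ?_
      rw [Finset.mem_range] at hi
      congr 2 <;> omega
    · intro i; simp only [Finset.mem_range]; omega
    · intro i hi hi'
      rw [Finset.mem_range] at hi hi'
      rw [Nat.choose_eq_zero_of_lt (by omega), zero_mul]
  · intro w _
    have := card_offType_le w
    omega

/-- The sum over the number of connected cycles telescopes. -/
theorem sum_mul_choose_mul_choose (a b K : ℕ) (hK : a < K) :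
    2 * (a + b) * ∑ c ∈ Finset.range K, c * ((2 * a).choose (a + c) * (2 * b).choose (b + c)) =
      a * b * ((2 * a).choose a * (2 * b).choose b) := by
  let G : ℕ → ℤ := fun c => (a + c : ℤ) * (b + c) * ((2 * a).choose (a + c) * (2 * b).choose (b + c))
  have hstep : ∀ c : ℕ, 2 * (a + b : ℤ) * (c * ((2 * a).choose (a + c) * (2 * b).choose (b + c))) =
      G c - G (c + 1) := by
    intro c
    have h : ∀ a : ℕ, ((2 * a).choose (a + c) : ℤ) * (a - c) =
        (2 * a).choose (a + (c + 1)) * (a + (c + 1)) := by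
      intro a
      rcases le_or_gt c a with h | h
      · have := Nat.choose_succ_right_eq (2 * a) (a + c)
        rw [show 2 * a - (a + c) = a - c by omega] at this
        zify [h] at this
        rw [← add_assoc, ← this]
        ring
      · rw [Nat.choose_eq_zero_of_lt (by omega : 2 * a < a + c),
          Nat.choose_eq_zero_of_lt (by omega : 2 * a < a + (c + 1))]
        simp
    have h1 := h a
    have h2 := h b
    simp only [G]
    push_cast at h1 h2 ⊢
    linear_combination (-((2 * b).choose (b + c) : ℤ) * (b - c)) * h1 -
      ((2 * a).choose (a + (c + 1)) : ℤ) * (a + (c + 1)) * h2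
  zify
  rw [Finset.mul_sum, Finset.sum_congr rfl fun c _ => hstep c]
  rw [Finset.sum_range_sub']
  simp only [G]
  rw [Nat.choose_eq_zero_of_lt (by omega : 2 * a < a + K)]
  simp

end rooted
end AnnularCSP
end

noncomputable section
namespace AnnularCSP

open Polynomial

/-! ### Orders and leading coefficients of rational functions -/

/-- The rational function `f` has order `v` at `ζ`, and `(q - ζ)⁻ᵛ f` has the (nonzero) value `a`
at `ζ`. -/
def HasLead (ζ : ℂ) (f : RatFunc ℂ) (v : ℤ) (a : ℂ) : Prop :=
  ∃ p r : ℂ[X], p.eval ζ ≠ 0 ∧ r.eval ζ ≠ 0 ∧ p.eval ζ / r.eval ζ = a ∧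
    f = algebraMap ℂ[X] (RatFunc ℂ) (X - C ζ) ^ v *
      (algebraMap ℂ[X] (RatFunc ℂ) p / algebraMap ℂ[X] (RatFunc ℂ) r)

lemma algebraMap_ne_zero_of_eval {ζ : ℂ} {p : ℂ[X]} (h : p.eval ζ ≠ 0) :
    algebraMap ℂ[X] (RatFunc ℂ) p ≠ 0 := by
  refine RatFunc.algebraMap_ne_zero ?_
  rintro rfl
  simp at h

lemma algebraMap_X_sub_C_ne_zero (ζ : ℂ) : algebraMap ℂ[X] (RatFunc ℂ) (X - C ζ) ≠ 0 :=
  RatFunc.algebraMap_ne_zero (X_sub_C_ne_zero ζ)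

namespace HasLead
variable {ζ : ℂ} {f g : RatFunc ℂ} {v w : ℤ} {a b : ℂ}

lemma lead_ne_zero (h : HasLead ζ f v a) : a ≠ 0 := by
  obtain ⟨p, r, hp, hr, rfl, -⟩ := h
  exact div_ne_zero hp hr

lemma of_polynomial {p : ℂ[X]} (hp : p.eval ζ ≠ 0) :
    HasLead ζ (algebraMap ℂ[X] (RatFunc ℂ) p) 0 (p.eval ζ) :=
  ⟨p, 1, hp, by simp, by simp, by simp⟩

lemma one (ζ : ℂ) : HasLead ζ 1 0 1 := by
  have := of_polynomial (ζ := ζ) (p := 1) (by simp)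
  simpa using this

lemma mul (hf : HasLead ζ f v a) (hg : HasLead ζ g w b) : HasLead ζ (f * g) (v + w) (a * b) := by
  obtain ⟨p, r, hp, hr, rfl, rfl⟩ := hf
  obtain ⟨p', r', hp', hr', rfl, rfl⟩ := hg
  refine ⟨p * p', r * r', by simp [hp, hp'], by simp [hr, hr'], by simp [div_mul_div_comm], ?_⟩
  rw [zpow_add₀ (algebraMap_X_sub_C_ne_zero ζ), map_mul, map_mul, ← div_mul_div_comm]
  ring

lemma inv (hf : HasLead ζ f v a) : HasLead ζ f⁻¹ (-v) a⁻¹ := by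
  obtain ⟨p, r, hp, hr, rfl, rfl⟩ := hf
  exact ⟨r, p, hr, hp, by simp, by rw [mul_inv, zpow_neg, inv_div]⟩

lemma div (hf : HasLead ζ f v a) (hg : HasLead ζ g w b) : HasLead ζ (f / g) (v - w) (a / b) := by
  rw [div_eq_mul_inv, div_eq_mul_inv, sub_eq_add_neg]
  exact hf.mul hg.inv

lemma pow (hf : HasLead ζ f v a) (k : ℕ) : HasLead ζ (f ^ k) (k * v) (a ^ k) := by
  induction k with
  | zero => simpa using one ζ
  | succ k ih =>
    rw [pow_succ, pow_succ]
    convert ih.mul hf using 1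
    push_cast
    ring

lemma prod {ι : Type*} {s : Finset ι} {f : ι → RatFunc ℂ} {v : ι → ℤ} {a : ι → ℂ}
    (h : ∀ i ∈ s, HasLead ζ (f i) (v i) (a i)) :
    HasLead ζ (∏ i ∈ s, f i) (∑ i ∈ s, v i) (∏ i ∈ s, a i) := by
  classical
  induction s using Finset.induction_on with
  | empty => simpa using one ζ
  | insert i s hi ih =>
    rw [Finset.prod_insert hi, Finset.prod_insert hi, Finset.sum_insert hi]
    exact (h i (Finset.mem_insert_self _ _)).mul
      (ih fun j hj => h j (Finset.mem_insert_of_mem hj))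

lemma congr (h : HasLead ζ f v a) (hv : v = w) (ha : a = b) : HasLead ζ f w b := hv ▸ ha ▸ h

/-- A polynomial of order zero takes the value of its leading coefficient. -/
lemma eval_eq {P : ℂ[X]} (h : HasLead ζ (algebraMap ℂ[X] (RatFunc ℂ) P) 0 a) : P.eval ζ = a := by
  obtain ⟨p, r, hp, hr, rfl, h⟩ := h
  rw [zpow_zero, one_mul, eq_div_iff (algebraMap_ne_zero_of_eval hr), ← map_mul] at h
  have := congrArg (eval ζ) (RatFunc.algebraMap_injective ℂ h)
  rw [eval_mul] at this
  rw [eq_div_iff hr, this]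

lemma eval_eq_zero {P : ℂ[X]} (h : HasLead ζ (algebraMap ℂ[X] (RatFunc ℂ) P) v a) (hv : 1 ≤ v) :
    P.eval ζ = 0 := by
  obtain ⟨p, r, hp, hr, rfl, h⟩ := h
  obtain ⟨k, rfl⟩ := Int.eq_ofNat_of_zero_le (by omega : 0 ≤ v)
  rw [zpow_natCast, ← mul_div_assoc, eq_div_iff (algebraMap_ne_zero_of_eval hr), ← map_mul,
    ← map_pow, ← map_mul] at h
  have := congrArg (eval ζ) (RatFunc.algebraMap_injective ℂ h)
  rw [eval_mul, eval_mul, eval_pow, eval_sub, eval_X, eval_C, sub_self, zero_pow (by omega),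
    zero_mul] at this
  exact (mul_eq_zero.1 this).resolve_right hr

end HasLead

/-- A rational function without poles is a polynomial. -/
theorem exists_polynomial_of_hasLead {f : RatFunc ℂ}
    (h : ∀ ζ, ∃ v a, 0 ≤ v ∧ HasLead ζ f v a) : ∃ P : ℂ[X], algebraMap ℂ[X] (RatFunc ℂ) P = f := by
  have hden : ∀ ζ, f.denom.eval ζ ≠ 0 := by
    intro ζ h0
    obtain ⟨v, a, hv, p, r, hp, hr, -, hf⟩ := h ζ
    obtain ⟨k, rfl⟩ := Int.eq_ofNat_of_zero_le hv
    have hd : algebraMap ℂ[X] (RatFunc ℂ) f.denom ≠ 0 :=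
      RatFunc.algebraMap_ne_zero f.denom_ne_zero
    rw [zpow_natCast, ← mul_div_assoc, eq_div_iff (algebraMap_ne_zero_of_eval hr)] at hf
    conv_lhs at hf => rw [← f.num_div_denom]
    rw [div_mul_eq_mul_div, div_eq_iff hd, ← map_mul, ← map_pow, ← map_mul, ← map_mul] at hf
    have h1 := congrArg (eval ζ) (RatFunc.algebraMap_injective ℂ hf)
    rw [eval_mul, eval_mul, h0, mul_zero] at h1
    have h2 := (mul_eq_zero.1 h1).resolve_right hr
    obtain ⟨x, y, hxy⟩ := f.isCoprime_num_denom
    have h3 := congrArg (eval ζ) hxy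
    simp [h0, h2] at h3
  have hdeg : f.denom.degree = 0 := by
    by_contra hne
    obtain ⟨ζ, hζ⟩ := IsAlgClosed.exists_root f.denom hne
    exact hden ζ hζ
  obtain ⟨c, hc⟩ : ∃ c, f.denom = C c := ⟨_, eq_C_of_degree_eq_zero hdeg⟩
  have hc0 : c ≠ 0 := by
    rintro rfl
    exact f.denom_ne_zero (by simp [hc])
  refine ⟨C c⁻¹ * f.num, ?_⟩
  conv_rhs => rw [← f.num_div_denom, hc]
  rw [map_mul, eq_div_iff (RatFunc.algebraMap_ne_zero (by simpa using hc0)), mul_comm, ← mul_assoc,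
    ← map_mul, ← C_mul, mul_inv_cancel₀ hc0, C_1, map_one, one_mul]

/-! ### Orders of the `q`-analogues -/

/-- The order of `1 - q ^ k` at a point of multiplicative order `d`. -/
def ordDvd (d k : ℕ) : ℤ := if d ∣ k then 1 else 0

/-- The leading coefficient of `1 - q ^ k` at `ζ`. -/
def leadNum (ζ : ℂ) (k : ℕ) : ℂ := if orderOf ζ ∣ k then -ζ⁻¹ * k else 1 - ζ ^ k

/-- The leading coefficient of `(1 - q) (1 - q ^ 2) ⋯ (1 - q ^ k)` at `ζ`. -/
def leadFact (ζ : ℂ) (k : ℕ) : ℂ := ∏ i ∈ Finset.range k, leadNum ζ (i + 1)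

/-- `(1 - q) (1 - q ^ 2) ⋯ (1 - q ^ k)`. -/
def qPoch (k : ℕ) : RatFunc ℂ := ∏ i ∈ Finset.range k, (1 - q ^ (i + 1))

lemma q_ne_zero : q ≠ 0 := RatFunc.X_ne_zero

lemma hasLead_one_sub (ζ : ℂ) {k : ℕ} (hk : 0 < k) :
    HasLead ζ (1 - q ^ k) (ordDvd (orderOf ζ) k) (leadNum ζ k) := by
  have hq : (1 - q ^ k : RatFunc ℂ) = algebraMap ℂ[X] (RatFunc ℂ) (1 - X ^ k) := by
    simp [q]
  unfold ordDvd leadNum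
  split_ifs with h
  · rw [orderOf_dvd_iff_pow_eq_one] at h
    have h0 : ζ ≠ 0 := by
      rintro rfl
      rw [zero_pow hk.ne'] at h
      exact zero_ne_one h
    have h1 := (Commute.all (X : ℂ[X]) (C ζ)).geom_sum₂_mul k
    have h2 : (1 - X ^ k : ℂ[X]) =
        (X - C ζ) * -∑ i ∈ Finset.range k, X ^ i * C ζ ^ (k - 1 - i) := by
      rw [mul_neg, mul_comm, h1, ← C_pow, h, C_1]
      ring
    have h3 : eval ζ (-∑ i ∈ Finset.range k, X ^ i * C ζ ^ (k - 1 - i)) = -ζ⁻¹ * k := by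
      rw [eval_neg, eval_finsetSum]
      simp only [eval_mul, eval_pow, eval_X, eval_C]
      rw [geom_sum₂_self]
      have : ζ ^ (k - 1) = ζ⁻¹ := by
        rw [← mul_left_inj' h0, inv_mul_cancel₀ h0, ← pow_succ, Nat.sub_add_cancel hk, h]
      rw [this]
      ring
    refine ⟨-∑ i ∈ Finset.range k, X ^ i * C ζ ^ (k - 1 - i), 1, ?_, by simp, ?_, ?_⟩
    · rw [h3]
      simp [h0, hk.ne']
    · rw [h3]; simp
    · rw [hq, h2, map_mul, zpow_one, map_one, div_one]
  · have h1 : eval ζ (1 - X ^ k : ℂ[X]) = 1 - ζ ^ k := by simp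
    rw [hq, ← h1]
    apply HasLead.of_polynomial
    rw [h1]
    intro h2
    exact h (orderOf_dvd_of_pow_eq_one (sub_eq_zero.1 h2).symm)

lemma hasLead_qPoch (ζ : ℂ) (k : ℕ) :
    HasLead ζ (qPoch k) ((k / orderOf ζ : ℕ) : ℤ) (leadFact ζ k) := by
  have h := HasLead.prod (s := Finset.range k) fun i _ => hasLead_one_sub ζ (Nat.succ_pos i)
  refine h.congr ?_ rfl
  induction k with
  | zero => simp
  | succ k ih =>
    rw [Finset.sum_range_succ, ih (HasLead.prod fun i _ => hasLead_one_sub ζ (Nat.succ_pos i)),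
      Nat.succ_div, ordDvd]
    push_cast
    rfl

lemma leadFact_ne_zero (ζ : ℂ) (k : ℕ) : leadFact ζ k ≠ 0 := (hasLead_qPoch ζ k).lead_ne_zero

lemma leadFact_mul {ζ : ℂ} (hd : 0 < orderOf ζ) (k : ℕ) :
    leadFact ζ (orderOf ζ * k) = leadFact ζ (orderOf ζ) ^ k * k.factorial := by
  set d := orderOf ζ with hdef
  induction k with
  | zero => simp [leadFact]
  | succ k ih =>
    have h1 : leadFact ζ (d * (k + 1)) =
        leadFact ζ (d * k) * ∏ i ∈ Finset.range d, leadNum ζ (d * k + i + 1) := by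
      rw [leadFact, mul_add, mul_one, Finset.prod_range_add]
      rfl
    have h2 : ∏ i ∈ Finset.range d, leadNum ζ (d * k + i + 1) = leadFact ζ d * (k + 1) := by
      obtain ⟨e, he⟩ := Nat.exists_eq_add_of_le' hd
      rw [leadFact, he, Finset.prod_range_succ, Finset.prod_range_succ, ← he, mul_assoc]
      congr 1
      · refine Finset.prod_congr rfl fun i hi => ?_
        rw [Finset.mem_range] at hi
        have h3 : ¬ d ∣ i + 1 := Nat.not_dvd_of_pos_of_lt (Nat.succ_pos i) (by omega)
        have h4 : ¬ d ∣ d * k + i + 1 := by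
          rw [add_assoc, Nat.dvd_add_right (dvd_mul_right d k)]; exact h3
        rw [leadNum, leadNum, if_neg h3, if_neg h4, add_assoc, pow_add, pow_mul, hdef,
          pow_orderOf_eq_one, one_pow, one_mul]
      · have h3 : d * k + e + 1 = d * (k + 1) := by rw [add_assoc, ← he]; ring
        rw [h3, leadNum, leadNum, if_pos (dvd_mul_right _ _), if_pos (dvd_refl _)]
        push_cast
        ring
    rw [h1, h2, ih, Nat.factorial_succ]
    push_cast
    ring

lemma qNum_eq (k : ℕ) : qNum k = (1 - q ^ k) / (1 - q ^ 1) := by rw [qNum, pow_one]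

lemma one_sub_q_ne_zero : (1 - q ^ 1 : RatFunc ℂ) ≠ 0 := by
  intro h
  have := hasLead_one_sub 0 one_pos
  rw [h] at this
  obtain ⟨p, r, hp, hr, -, h2⟩ := this
  have := mul_ne_zero (zpow_ne_zero (ordDvd (orderOf (0 : ℂ)) 1) (algebraMap_X_sub_C_ne_zero 0))
    (div_ne_zero (algebraMap_ne_zero_of_eval hp) (algebraMap_ne_zero_of_eval hr))
  exact this h2.symm

lemma qFact_eq (k : ℕ) : qFact k = qPoch k / (1 - q ^ 1) ^ k := by
  rw [qFact, qPoch, Finset.prod_congr rfl fun i _ => qNum_eq (i + 1), Finset.prod_div_distrib]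
  simp

lemma qPoch_ne_zero (k : ℕ) : qPoch k ≠ 0 := by
  obtain ⟨p, r, hp, hr, -, h2⟩ := hasLead_qPoch 0 k
  rw [h2]
  exact mul_ne_zero (zpow_ne_zero _ (algebraMap_X_sub_C_ne_zero 0))
    (div_ne_zero (algebraMap_ne_zero_of_eval hp) (algebraMap_ne_zero_of_eval hr))

lemma qBinom_eq {a b : ℕ} (h : b ≤ a) : qBinom a b = qPoch a / (qPoch b * qPoch (a - b)) := by
  have hu := pow_one q ▸ one_sub_q_ne_zero
  unfold qBinom
  split_ifs with h1 h2
  · have : a = b := by exact_mod_cast h1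
    rw [this, Nat.sub_self, qPoch, qPoch, Finset.prod_range_zero, mul_one]
    exact (div_self (qPoch_ne_zero b)).symm
  · obtain ⟨e, rfl⟩ := Nat.exists_eq_add_of_le h
    have e1 : ((b + e : ℕ) : ℤ).toNat = b + e := by omega
    have e2 : ((b : ℕ) : ℤ).toNat = b := by omega
    have e3 : (((b + e : ℕ) : ℤ) - b).toNat = e := by omega
    rw [e1, e2, e3, qFact_eq, qFact_eq, qFact_eq, Nat.add_sub_cancel_left, pow_add]
    have := qPoch_ne_zero b
    have := qPoch_ne_zero e
    field_simp
  · omega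

lemma qBinom_eq_zero {a b : ℤ} (h : a ≠ b) (h2 : ¬ (0 ≤ b ∧ b ≤ a)) : qBinom a b = 0 := by
  rw [qBinom, if_neg h, if_neg h2]

/-- The order of a `q`-binomial coefficient at a point of multiplicative order `d`. -/
def ordBinom (d a b : ℕ) : ℤ := (a / d : ℕ) - ((b / d : ℕ) + ((a - b) / d : ℕ))

lemma hasLead_qBinom (ζ : ℂ) {a b : ℕ} (h : b ≤ a) : HasLead ζ (qBinom a b)
    (ordBinom (orderOf ζ) a b) (leadFact ζ a / (leadFact ζ b * leadFact ζ (a - b))) := by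
  rw [qBinom_eq h]
  exact (hasLead_qPoch ζ a).div ((hasLead_qPoch ζ b).mul (hasLead_qPoch ζ (a - b)))

lemma ordBinom_nonneg (d : ℕ) {a b : ℕ} (h : b ≤ a) : 0 ≤ ordBinom d a b := by
  have : b / d + (a - b) / d ≤ (b + (a - b)) / d := Nat.div_add_div_le_add_div
  rw [Nat.add_sub_cancel' h] at this
  unfold ordBinom
  omega

lemma one_le_ordBinom {d a b : ℕ} (h : b ≤ a) (ha : d ∣ a) (hb : ¬ d ∣ b) :
    1 ≤ ordBinom d a b := by
  rcases Nat.eq_zero_or_pos d with rfl | hd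
  · have : a = 0 := by simpa using ha
    subst this
    exact absurd (by simpa using h) (by simpa using hb)
  obtain ⟨k, rfl⟩ := ha
  obtain ⟨e, he⟩ := Nat.exists_eq_add_of_le h
  have h1 := Nat.div_add_mod b d
  have h2 := Nat.div_add_mod e d
  have h3 : b % d ≠ 0 := fun h => hb (Nat.dvd_of_mod_eq_zero h)
  unfold ordBinom
  rw [he, Nat.add_sub_cancel_left, ← he, Nat.mul_div_cancel_left _ hd]
  have : b / d + e / d < k := by
    by_contra hcon
    have := Nat.mul_le_mul_left d (not_lt.1 hcon)
    rw [mul_add] at this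
    omega
  omega

lemma hasLead_qBinom_of_dvd {ζ : ℂ} (hd : 0 < orderOf ζ) {a b : ℕ} (h : b ≤ a) :
    HasLead ζ (qBinom (orderOf ζ * a : ℕ) (orderOf ζ * b : ℕ)) 0 (a.choose b) := by
  refine (hasLead_qBinom ζ (Nat.mul_le_mul_left _ h)).congr ?_ ?_
  · rw [ordBinom, ← Nat.mul_sub, Nat.mul_div_cancel_left _ hd, Nat.mul_div_cancel_left _ hd,
      Nat.mul_div_cancel_left _ hd]
    omega
  · have hK := leadFact_ne_zero ζ (orderOf ζ)
    rw [← Nat.mul_sub, leadFact_mul hd, leadFact_mul hd, leadFact_mul hd,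
      ← Nat.choose_mul_factorial_mul_factorial h]
    have h1 : (b.factorial : ℂ) ≠ 0 := by exact_mod_cast b.factorial_ne_zero
    have h2 : ((a - b).factorial : ℂ) ≠ 0 := by exact_mod_cast (a - b).factorial_ne_zero
    rw [div_eq_iff (by positivity)]
    push_cast
    obtain ⟨e, rfl⟩ := Nat.exists_eq_add_of_le h
    rw [Nat.add_sub_cancel_left, pow_add]
    ring

/-- The order of a `q`-multinomial coefficient at a point of multiplicative order `d`. -/
def ordMultinom (d : ℕ) (lam : Multiset ℕ) : ℤ :=
  (lam.card / d : ℕ) - ∑ i ∈ lam.toFinset, ((lam.count i / d : ℕ) : ℤ)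

lemma hasLead_qMultinom (ζ : ℂ) (lam : Multiset ℕ) : HasLead ζ (qMultinom lam.card lam)
    (ordMultinom (orderOf ζ) lam)
    (leadFact ζ lam.card / ∏ i ∈ lam.toFinset, leadFact ζ (lam.count i)) := by
  have h : qMultinom lam.card lam =
      qPoch lam.card / ∏ i ∈ lam.toFinset, qPoch (lam.count i) := by
    have hu := pow_one q ▸ one_sub_q_ne_zero
    rw [qMultinom, qFact_eq, Finset.prod_congr rfl fun i _ => qFact_eq (lam.count i),
      Finset.prod_div_distrib, Finset.prod_pow_eq_pow_sum, Multiset.toFinset_sum_count_eq]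
    have : ∏ i ∈ lam.toFinset, qPoch (lam.count i) ≠ 0 :=
      Finset.prod_ne_zero_iff.2 fun i _ => qPoch_ne_zero _
    field_simp
  rw [h]
  exact (hasLead_qPoch ζ _).div (HasLead.prod fun i _ => hasLead_qPoch ζ _)

lemma sum_count_div_le (d : ℕ) (lam : Multiset ℕ) :
    d * ∑ i ∈ lam.toFinset, lam.count i / d ≤ lam.card := by
  rw [← Multiset.toFinset_sum_count_eq lam, Finset.mul_sum]
  exact Finset.sum_le_sum fun i _ => Nat.mul_div_le _ _

lemma ordMultinom_nonneg (d : ℕ) (lam : Multiset ℕ) : 0 ≤ ordMultinom d lam := by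
  rcases Nat.eq_zero_or_pos d with rfl | hd
  · simp [ordMultinom]
  have h := (Nat.le_div_iff_mul_le hd).2 (mul_comm d _ ▸ sum_count_div_le d lam)
  zify at h
  unfold ordMultinom
  push_cast
  omega

lemma one_le_ordMultinom {d : ℕ} {lam : Multiset ℕ} (h : d ∣ lam.card)
    (hcount : ¬ ∀ i, d ∣ lam.count i) : 1 ≤ ordMultinom d lam := by
  rcases Nat.eq_zero_or_pos d with rfl | hd
  · have : lam = 0 := by simpa using h
    simp [this] at hcount
  obtain ⟨k, hk⟩ := h
  have h1 : d * ∑ i ∈ lam.toFinset, lam.count i / d < d * k := by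
    rw [← hk, ← Multiset.toFinset_sum_count_eq lam, Finset.mul_sum]
    push Not at hcount
    obtain ⟨i, hi⟩ := hcount
    refine Finset.sum_lt_sum (fun i _ => Nat.mul_div_le _ _) ⟨i, ?_, ?_⟩
    · rw [Multiset.mem_toFinset]
      by_contra hmem
      rw [Multiset.count_eq_zero.2 hmem] at hi
      simp at hi
    · exact lt_of_le_of_ne (Nat.mul_div_le _ _) fun h => hi ⟨_, h.symm⟩
  have h2 := Nat.lt_of_mul_lt_mul_left h1
  rw [ordMultinom, hk, Nat.mul_div_cancel_left _ hd]
  zify at h2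
  push_cast
  omega

lemma hasLead_qMultinom_of_dvd {ζ : ℂ} (hd : 0 < orderOf ζ) (lam : Multiset ℕ) :
    HasLead ζ (qMultinom (orderOf ζ • lam).card (orderOf ζ • lam)) 0
      (lam.card.factorial / ∏ i ∈ lam.toFinset, ((lam.count i).factorial : ℂ)) := by
  have hset : (orderOf ζ • lam).toFinset = lam.toFinset := Multiset.toFinset_nsmul _ _ hd.ne'
  refine (hasLead_qMultinom ζ _).congr ?_ ?_
  · rw [ordMultinom, hset, Multiset.card_nsmul, Nat.mul_div_cancel_left _ hd,
      ← Multiset.toFinset_sum_count_eq lam]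
    push_cast
    rw [← Finset.sum_sub_distrib]
    apply Finset.sum_eq_zero
    intro i _
    rw [Multiset.count_nsmul, ← Int.natCast_div, Nat.mul_div_cancel_left _ hd, sub_self]
  · have hK := leadFact_ne_zero ζ (orderOf ζ)
    rw [hset, Multiset.card_nsmul, leadFact_mul hd]
    have : ∀ i ∈ lam.toFinset, leadFact ζ ((orderOf ζ • lam).count i) =
        leadFact ζ (orderOf ζ) ^ lam.count i * (lam.count i).factorial := by
      intro i _
      rw [Multiset.count_nsmul, leadFact_mul hd]
    rw [Finset.prod_congr rfl this, Finset.prod_mul_distrib, Finset.prod_pow_eq_pow_sum,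
      Multiset.toFinset_sum_count_eq]
    rw [mul_div_mul_left _ _ (pow_ne_zero _ hK)]

end AnnularCSP
end

noncomputable section
namespace AnnularCSP

open Polynomial

/-! ### The two circles as factors of the sieving polynomial -/

lemma hasLead_q {ζ : ℂ} (h : ζ ≠ 0) : HasLead ζ q 0 ζ := by
  have := HasLead.of_polynomial (ζ := ζ) (p := X) (by simpa using h)
  simpa [q] using this

lemma hasLead_zero_q : HasLead 0 q 1 1 :=
  ⟨1, 1, by simp, by simp, by simp, by simp [q]⟩

lemma exists_hasLead_q_zpow (ζ : ℂ) {e : ℤ} (he : 0 ≤ e) :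
    ∃ v a, 0 ≤ v ∧ HasLead ζ (q ^ e) v a := by
  obtain ⟨k, rfl⟩ := Int.eq_ofNat_of_zero_le he
  rw [zpow_natCast]
  rcases eq_or_ne ζ 0 with rfl | h
  · exact ⟨_, _, by positivity, hasLead_zero_q.pow k⟩
  · exact ⟨_, _, by simp, (hasLead_q h).pow k⟩

lemma ne_zero_of_orderOf_pos {ζ : ℂ} (hd : 0 < orderOf ζ) : ζ ≠ 0 := by
  rintro rfl
  have := pow_orderOf_eq_one (0 : ℂ)
  rw [zero_pow hd.ne'] at this
  exact zero_ne_one this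

lemma hasLead_q_zpow_of_dvd {ζ : ℂ} (hd : 0 < orderOf ζ) {e : ℤ} (he : 0 ≤ e)
    (h : (orderOf ζ : ℤ) ∣ e) : HasLead ζ (q ^ e) 0 1 := by
  obtain ⟨k, rfl⟩ := Int.eq_ofNat_of_zero_le he
  rw [zpow_natCast]
  refine ((hasLead_q (ne_zero_of_orderOf_pos hd)).pow k).congr (by simp) ?_
  exact orderOf_dvd_iff_pow_eq_one.1 (Int.natCast_dvd_natCast.1 h)

/-- The factor common to all the generating functions, without its power of `q`. -/
def qBase (n m c : ℕ) : RatFunc ℂ := qNum (n * m) / (qNum n * qNum m) * (qNum (2 * c) / 2)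

lemma hasLead_qBase (ζ : ℂ) {n m c : ℕ} (hn : 0 < n) (hm : 0 < m) (hc : 0 < c) :
    HasLead ζ (qBase n m c)
      (ordDvd (orderOf ζ) (n * m) + ordDvd (orderOf ζ) (2 * c) -
        (ordDvd (orderOf ζ) n + ordDvd (orderOf ζ) m))
      (leadNum ζ (n * m) * leadNum ζ (2 * c) / (leadNum ζ n * leadNum ζ m) / 2) := by
  have h : qBase n m c =
      (1 - q ^ (n * m)) * (1 - q ^ (2 * c)) / ((1 - q ^ n) * (1 - q ^ m)) / 2 := by
    have hu := pow_one q ▸ one_sub_q_ne_zero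
    rw [qBase, qNum, qNum, qNum, qNum]
    by_cases h1 : 1 - q ^ n = 0
    · simp [h1]
    by_cases h2 : 1 - q ^ m = 0
    · simp [h2]
    field_simp
  have h2 : HasLead ζ 2 0 2 := by
    have h3 := HasLead.of_polynomial (ζ := ζ) (p := 2) (by simp)
    have h4 : algebraMap ℂ[X] (RatFunc ℂ) 2 = 2 := map_ofNat _ 2
    rw [h4, eval_ofNat] at h3
    exact h3
  rw [h]
  exact ((((hasLead_one_sub ζ (by positivity)).mul (hasLead_one_sub ζ (by positivity))).div
    ((hasLead_one_sub ζ hn).mul (hasLead_one_sub ζ hm))).div h2).congr (by ring) rfl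

lemma ordDvd_nonneg (d k : ℕ) : 0 ≤ ordDvd d k := by
  unfold ordDvd; split_ifs <;> simp

lemma ordDvd_of_dvd {d k : ℕ} (h : d ∣ k) : ordDvd d k = 1 := if_pos h

lemma ordDvd_of_not_dvd {d k : ℕ} (h : ¬ d ∣ k) : ordDvd d k = 0 := if_neg h

/-- The contribution of a circle with `n` points to the sieving phenomenon: `q ^ e * f` has no poles,
and at a root of unity of order `d` dividing `n`, it takes the value `n N / c`, where `N` counts the
rooted words with `d`-fold symmetry that satisfy `P`. When `N` is zero because of divisibility,
the order of `f` is positive, which compensates for the possible pole of `qBase n m c`. -/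
structure IsSide (n c : ℕ) (P : Multiset ℕ → Multiset ℕ → Prop) (e : ℤ) (f : RatFunc ℂ) :
    Prop where
  exp_nonneg : 0 ≤ e
  order : ∀ ζ, ∃ v a, 0 ≤ v ∧ HasLead ζ f v a
  sieving : ∀ (ζ : ℂ) (k : ℕ) [NeZero k], 0 < orderOf ζ → n = orderOf ζ * k →
    (∃ v a, 1 ≤ v ∧ HasLead ζ f v a ∧ (wordSet (orderOf ζ) k c P).ncard = 0) ∨
    (orderOf ζ ∣ c ∧ (orderOf ζ : ℤ) ∣ e ∧ ∃ a, HasLead ζ f 0 a ∧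
      (n * (wordSet (orderOf ζ) k c P).ncard : ℂ) = c * a)

/-- The factors of the two circles and the common factor combine to the sieving polynomial. -/
theorem exists_polynomial_of_isSide {n m c : ℕ} (hn : 0 < n) (hm : 0 < m) (hc : 0 < c)
    {P Q : Multiset ℕ → Multiset ℕ → Prop} {e₁ e₂ : ℤ} {f g : RatFunc ℂ}
    (hf : IsSide n c P e₁ f) (hg : IsSide m c Q e₂ g) :
    ∃ p : ℂ[X], algebraMap ℂ[X] (RatFunc ℂ) p =
        q ^ ((c : ℤ) * (c - 1) + e₁ + e₂) * qBase n m c * (f * g) ∧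
      ∀ (d k l : ℕ) [NeZero d] [NeZero k] [NeZero l] (ζ : ℂ), orderOf ζ = d → n = d * k →
        m = d * l → p.eval ζ = ((fixedSet d k l c P Q).ncard : ℂ) := by
  have hexp : 0 ≤ (c : ℤ) * (c - 1) + e₁ + e₂ := by
    have h1 := hf.exp_nonneg
    have h2 := hg.exp_nonneg
    have : 0 ≤ (c : ℤ) * (c - 1) := mul_nonneg (by omega) (by omega)
    omega
  -- the order of the common factor is at least `-1`, with equality only at roots of unity whose order
  -- divides `n` and `m` but not `c`
  have hbase : ∀ d, (¬ d ∣ n ∨ ¬ d ∣ m) → 0 ≤ ordDvd d (n * m) + ordDvd d (2 * c) -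
      (ordDvd d n + ordDvd d m) := by
    intro d h
    have h2 := ordDvd_nonneg d (2 * c)
    have h3 := ordDvd_nonneg d (n * m)
    by_cases hdn : d ∣ n
    · have := ordDvd_of_dvd (hdn.mul_right m)
      have := ordDvd_of_dvd hdn
      have := ordDvd_of_not_dvd (h.resolve_left (not_not.2 hdn))
      omega
    · have h1 := ordDvd_of_not_dvd hdn
      by_cases hdm : d ∣ m
      · have := ordDvd_of_dvd (hdm.mul_left n)
        have := ordDvd_of_dvd hdm
        omega
      · have := ordDvd_of_not_dvd hdm
        omega
  -- at the other roots of unity, either one of the two sides has a zero, or all three orders vanish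
  have hkey : ∀ (ζ : ℂ) (k l : ℕ) [NeZero k] [NeZero l], 0 < orderOf ζ → n = orderOf ζ * k →
      m = orderOf ζ * l → ∃ v a,
      HasLead ζ (q ^ ((c : ℤ) * (c - 1) + e₁ + e₂) * qBase n m c * (f * g)) v a ∧
      ((1 ≤ v ∧ (wordSet (orderOf ζ) k c P).ncard * (wordSet (orderOf ζ) l c Q).ncard = 0) ∨
        (v = 0 ∧ (c * a : ℂ) = n * m *
          ((wordSet (orderOf ζ) k c P).ncard * (wordSet (orderOf ζ) l c Q).ncard))) := by
    intro ζ k l _ _ hd hnk hml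
    have hb := hasLead_qBase ζ hn hm hc
    have d1 : orderOf ζ ∣ n := ⟨k, hnk⟩
    have d2 : orderOf ζ ∣ m := ⟨l, hml⟩
    rw [ordDvd_of_dvd (d1.mul_right m), ordDvd_of_dvd d1, ordDvd_of_dvd d2] at hb
    obtain ⟨u, x, hu, hx⟩ := exists_hasLead_q_zpow ζ hexp
    obtain ⟨v₁, a₁, hv₁, ha₁⟩ := hf.order ζ
    obtain ⟨v₂, a₂, hv₂, ha₂⟩ := hg.order ζ
    have h0 := ordDvd_nonneg (orderOf ζ) (2 * c)
    rcases hf.sieving ζ k hd hnk with ⟨w₁, b₁, hw₁, hb₁, z₁⟩ | ⟨c1, he1, b₁, hb₁, z₁⟩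
    · rcases hg.sieving ζ l hd hml with ⟨w₂, b₂, hw₂, hb₂, z₂⟩ | ⟨c2, he2, b₂, hb₂, z₂⟩
      · exact ⟨_, _, (hx.mul hb).mul (hb₁.mul hb₂), Or.inl ⟨by omega, by rw [z₁, zero_mul]⟩⟩
      · have h1 := ordDvd_of_dvd (c2.mul_left 2)
        exact ⟨_, _, (hx.mul hb).mul (hb₁.mul ha₂), Or.inl ⟨by omega, by rw [z₁, zero_mul]⟩⟩
    · have h1 := ordDvd_of_dvd (c1.mul_left 2)
      rcases hg.sieving ζ l hd hml with ⟨w₂, b₂, hw₂, hb₂, z₂⟩ | ⟨c2, he2, b₂, hb₂, z₂⟩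
      · exact ⟨_, _, (hx.mul hb).mul (ha₁.mul hb₂), Or.inl ⟨by omega, by rw [z₂, mul_zero]⟩⟩
      · have hq := hasLead_q_zpow_of_dvd hd hexp
          (((Int.natCast_dvd_natCast.2 c1).mul_right _ |>.add he1).add he2)
        refine ⟨_, _, (hq.mul hb).mul (hb₁.mul hb₂), Or.inr ⟨by omega, ?_⟩⟩
        have hlead : leadNum ζ (n * m) * leadNum ζ (2 * c) / (leadNum ζ n * leadNum ζ m) / 2 =
            c := by
          have hn' : (n : ℂ) ≠ 0 := by exact_mod_cast hn.ne'
          have hm' : (m : ℂ) ≠ 0 := by exact_mod_cast hm.ne'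
          have hζ := ne_zero_of_orderOf_pos hd
          rw [leadNum, leadNum, leadNum, leadNum, if_pos (d1.mul_right m), if_pos d1, if_pos d2,
            if_pos (c1.mul_left 2)]
          push_cast
          field_simp
        rw [hlead]
        linear_combination (-(m * (wordSet (orderOf ζ) l c Q).ncard : ℂ)) * z₁ - (c * b₁) * z₂
  obtain ⟨p, hp⟩ := exists_polynomial_of_hasLead
    (f := q ^ ((c : ℤ) * (c - 1) + e₁ + e₂) * qBase n m c * (f * g)) (by
      intro ζ
      by_cases h : orderOf ζ ∣ n ∧ orderOf ζ ∣ m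
      · obtain ⟨⟨k, hk⟩, ⟨l, hl⟩⟩ := h
        have hd : 0 < orderOf ζ := Nat.pos_of_ne_zero fun h => by simp [h] at hk; omega
        have : NeZero k := ⟨fun h => by simp [h] at hk; omega⟩
        have : NeZero l := ⟨fun h => by simp [h] at hl; omega⟩
        obtain ⟨v, a, h1, h2⟩ := hkey ζ k l hd hk hl
        exact ⟨v, a, by rcases h2 with h | h <;> omega, h1⟩
      · obtain ⟨u, x, hu, hx⟩ := exists_hasLead_q_zpow ζ hexp
        obtain ⟨v₁, a₁, hv₁, ha₁⟩ := hf.order ζ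
        obtain ⟨v₂, a₂, hv₂, ha₂⟩ := hg.order ζ
        have := hbase (orderOf ζ) (not_and_or.1 h)
        exact ⟨_, _, by omega, (hx.mul (hasLead_qBase ζ hn hm hc)).mul (ha₁.mul ha₂)⟩)
  refine ⟨p, hp, ?_⟩
  rintro d k l _ _ _ ζ rfl hnk hml
  obtain ⟨v, a, h1, h2⟩ := hkey ζ k l (Nat.pos_of_neZero _) hnk hml
  have hcard : c * (fixedSet (orderOf ζ) k l c P Q).ncard = n * m *
      ((wordSet (orderOf ζ) k c P).ncard * (wordSet (orderOf ζ) l c Q).ncard) := by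
    rw [card_fixedSet, ← hnk, ← hml]
  rw [← hp] at h1
  rcases h2 with ⟨hv, hz⟩ | ⟨rfl, ha⟩
  · rw [h1.eval_eq_zero hv]
    rw [hz, mul_zero] at hcard
    rw [(mul_eq_zero.1 hcard).resolve_left hc.ne', Nat.cast_zero]
  · rw [h1.eval_eq]
    have hc' : (c : ℂ) ≠ 0 := by exact_mod_cast hc.ne'
    apply mul_left_cancel₀ hc'
    rw [ha]
    exact_mod_cast hcard.symm

/-! ### The factors of the generating functions -/

section sides
variable {n c : ℕ}

lemma wordSet_mul {d k : ℕ} [NeZero k] (hd : 0 < d) (c : ℕ) (P : Multiset ℕ → Multiset ℕ → Prop) :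
    wordSet d k (d * c) P = {w : MarkedWord k | IsRootedWord w.1 w.2 ∧ w.2.card = c ∧
      P (d • offType w) (d • onType w)} := by
  ext w
  simp only [wordSet, Set.mem_ofPred_eq, Nat.mul_right_inj hd.ne']

lemma ncard_wordSet_eq_zero {d k : ℕ} [NeZero k] {P : Multiset ℕ → Multiset ℕ → Prop}
    (h : ∀ w : MarkedWord k, P (d • offType w) (d • onType w) → d * w.2.card = c → False) :
    (wordSet d k c P).ncard = 0 := by
  have : wordSet d k c P = ∅ := by
    rw [Set.eq_empty_iff_forall_notMem]
    rintro w ⟨-, h2, h3⟩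
    exact h w h3 h2
  rw [this, Set.ncard_empty]

lemma ncard_wordSet_of_not_dvd {d k : ℕ} [NeZero k] {P : Multiset ℕ → Multiset ℕ → Prop}
    (h : ¬ d ∣ c) : (wordSet d k c P).ncard = 0 :=
  ncard_wordSet_eq_zero fun _ _ h2 => h ⟨_, h2.symm⟩

/-- The side for permutations with a given number of connected cycles. -/
theorem isSide_conn (hc : 0 < c) (h : c ≤ n) :
    IsSide n c (fun _ _ => True) 0 (qBinom (2 * n : ℕ) (n - c : ℕ)) where
  exp_nonneg := le_rfl
  order ζ := ⟨_, _, ordBinom_nonneg _ (by omega), hasLead_qBinom ζ (by omega)⟩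
  sieving ζ k _ hd hnk := by
    by_cases hdc : orderOf ζ ∣ c
    · refine Or.inr ⟨hdc, dvd_zero _, ?_⟩
      obtain ⟨c', rfl⟩ := hdc
      have hc' : 0 < c' := Nat.pos_of_mul_pos_left hc
      subst hnk
      have hle : c' ≤ k := Nat.le_of_mul_le_mul_left h hd
      have h1 := hasLead_qBinom_of_dvd hd (show k - c' ≤ 2 * k by omega)
      rw [Nat.mul_sub, Nat.mul_left_comm (orderOf ζ) 2 k] at h1
      refine ⟨_, h1, ?_⟩
      have h2 := ncard_rooted (n := k) hc'
      rw [← Nat.choose_symm (by omega), show 2 * k - (k + c') = k - c' by omega] at h2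
      rw [wordSet_mul hd]
      simp only [and_true]
      have h3 := congrArg (Nat.cast : ℕ → ℂ) h2
      push_cast at h3 ⊢
      linear_combination (orderOf ζ : ℂ) * h3
    · refine Or.inl ⟨_, _, one_le_ordBinom (by omega) ?_ ?_, hasLead_qBinom ζ (by omega),
        ncard_wordSet_of_not_dvd hdc⟩
      · rw [hnk]; exact (dvd_mul_right _ _).mul_left _
      · intro h2
        have h3 : orderOf ζ ∣ n - (n - c) := Nat.dvd_sub ⟨k, hnk⟩ h2
        rw [Nat.sub_sub_self h] at h3
        exact hdc h3

/-- The side for permutations with given numbers of connected and of exterior cycles. -/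
theorem isSide_card {r : ℕ} (hc : 0 < c) (h : r + c ≤ n) :
    IsSide n c (fun a _ => a.card = r) (r * (c + r)) (qBinom n r * qBinom n (r + c : ℕ)) where
  exp_nonneg := by positivity
  order ζ := ⟨_, _, add_nonneg (ordBinom_nonneg _ (by omega)) (ordBinom_nonneg _ (by omega)),
    (hasLead_qBinom ζ (by omega)).mul (hasLead_qBinom ζ (by omega))⟩
  sieving ζ k _ hd hnk := by
    have hdn : orderOf ζ ∣ n := ⟨k, hnk⟩
    have o1 := ordBinom_nonneg (orderOf ζ) (show r ≤ n by omega)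
    have o2 := ordBinom_nonneg (orderOf ζ) h
    by_cases hdr : orderOf ζ ∣ r
    · by_cases hdc : orderOf ζ ∣ c
      · refine Or.inr ⟨hdc, (Int.natCast_dvd_natCast.2 hdr).mul_right _, ?_⟩
        obtain ⟨c', rfl⟩ := hdc
        obtain ⟨r', rfl⟩ := hdr
        have hc' : 0 < c' := Nat.pos_of_mul_pos_left hc
        subst hnk
        rw [← mul_add] at h ⊢
        have hle : r' + c' ≤ k := Nat.le_of_mul_le_mul_left h hd
        refine ⟨_, (hasLead_qBinom_of_dvd hd (show r' ≤ k by omega)).mul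
          (hasLead_qBinom_of_dvd hd hle), ?_⟩
        have h2 := ncard_rooted_card (n := k) hc' r'
        rw [wordSet_mul hd]
        simp only [Multiset.card_nsmul, Nat.mul_right_inj hd.ne']
        have h3 := congrArg (Nat.cast : ℕ → ℂ) h2
        push_cast at h3 ⊢
        linear_combination (orderOf ζ : ℂ) * h3
      · have := one_le_ordBinom h hdn fun h2 => hdc ((Nat.dvd_add_right hdr).1 h2)
        exact Or.inl ⟨_, _, by omega, (hasLead_qBinom ζ (by omega)).mul (hasLead_qBinom ζ h),
          ncard_wordSet_of_not_dvd hdc⟩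
    · have := one_le_ordBinom (show r ≤ n by omega) hdn hdr
      refine Or.inl ⟨_, _, by omega, (hasLead_qBinom ζ (by omega)).mul (hasLead_qBinom ζ h),
        ncard_wordSet_eq_zero fun w h1 _ => hdr ?_⟩
      rw [Multiset.card_nsmul] at h1
      exact ⟨_, h1.symm⟩

end sides
end AnnularCSP
end

noncomputable section
namespace AnnularCSP

open Polynomial

section sides
variable {n c : ℕ}

/-! ### The factor `[R - 1 choose r - 1]` -/

lemma qBinom_pred_eq {R r : ℕ} (hr : 0 < r) (h : r ≤ R) :
    qBinom (R - 1) (r - 1) = qBinom R r * ((1 - q ^ r) / (1 - q ^ R)) := by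
  obtain ⟨r, rfl⟩ := Nat.exists_eq_add_of_le' hr
  obtain ⟨R, rfl⟩ := Nat.exists_eq_add_of_le' (hr.trans_le h)
  have e1 : ((R + 1 : ℕ) : ℤ) - 1 = R := by push_cast; ring
  have e2 : ((r + 1 : ℕ) : ℤ) - 1 = r := by push_cast; ring
  have hs : ∀ k, qPoch (k + 1) = qPoch k * (1 - q ^ (k + 1)) := fun k => by
    rw [qPoch, Finset.prod_range_succ, ← qPoch]
  have hne : ∀ k, (1 - q ^ (k + 1) : RatFunc ℂ) ≠ 0 := fun k h => by
    have := hs k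
    rw [h, mul_zero] at this
    exact qPoch_ne_zero _ this
  rw [e1, e2, qBinom_eq (by omega), qBinom_eq h, hs, hs, Nat.add_sub_add_right]
  have := qPoch_ne_zero r
  have := qPoch_ne_zero (R - r)
  have := hne r
  have := hne R
  field_simp

lemma exists_hasLead_qBinom_pred (ζ : ℂ) {R r : ℕ} (h : r ≤ R) (h0 : r = 0 → R = 0) :
    ∃ v a, 0 ≤ v ∧ HasLead ζ (qBinom (R - 1) (r - 1)) v a ∧
      (orderOf ζ ∣ r → ¬ orderOf ζ ∣ R → 1 ≤ v) := by
  rcases Nat.eq_zero_or_pos r with rfl | hr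
  · obtain rfl := h0 rfl
    refine ⟨0, 1, le_rfl, ?_, fun h1 h2 => absurd h1 h2⟩
    rw [qBinom, if_pos rfl]
    exact HasLead.one ζ
  · by_cases hd : orderOf ζ ∣ r ∧ ¬ orderOf ζ ∣ R
    · have hl := (hasLead_qBinom ζ h).mul
        ((hasLead_one_sub ζ hr).div (hasLead_one_sub ζ (hr.trans_le h)))
      rw [← qBinom_pred_eq hr h, ordDvd_of_dvd hd.1, ordDvd_of_not_dvd hd.2] at hl
      have := ordBinom_nonneg (orderOf ζ) h
      exact ⟨_, _, by omega, hl, fun _ _ => by omega⟩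
    · have e1 : (R : ℤ) - 1 = (R - 1 : ℕ) := by omega
      have e2 : (r : ℤ) - 1 = (r - 1 : ℕ) := by omega
      rw [e1, e2]
      exact ⟨_, _, ordBinom_nonneg _ (by omega), hasLead_qBinom ζ (by omega),
        fun h1 h2 => absurd ⟨h1, h2⟩ hd⟩

lemma hasLead_qBinom_pred_of_dvd {ζ : ℂ} (hd : 0 < orderOf ζ) {r j : ℕ} (h0 : r = 0 → j = 0) :
    HasLead ζ (qBinom ((orderOf ζ * (r + j) : ℕ) - 1) ((orderOf ζ * r : ℕ) - 1)) 0
      (r.multichoose j) := by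
  rcases Nat.eq_zero_or_pos r with rfl | hr
  · obtain rfl := h0 rfl
    rw [qBinom, if_pos (by simp)]
    simpa using HasLead.one ζ
  · rw [qBinom_pred_eq (by positivity) (Nat.mul_le_mul_left _ (by omega))]
    refine ((hasLead_qBinom_of_dvd hd (show r ≤ r + j by omega)).mul
      ((hasLead_one_sub ζ (by positivity)).div (hasLead_one_sub ζ (by positivity)))).congr ?_ ?_
    · rw [ordDvd_of_dvd (dvd_mul_right _ _), ordDvd_of_dvd (dvd_mul_right _ _)]
      ring
    · rw [leadNum, leadNum, if_pos (dvd_mul_right _ _), if_pos (dvd_mul_right _ _)]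
      have h1 := congrArg (Nat.cast : ℕ → ℂ) (add_mul_multichoose hr j)
      have h2 : ((r + j : ℕ) : ℂ) ≠ 0 := by exact_mod_cast (by omega : r + j ≠ 0)
      have h3 := ne_zero_of_orderOf_pos hd
      have h4 : (orderOf ζ : ℂ) ≠ 0 := by exact_mod_cast hd.ne'
      push_cast at h1 h2 ⊢
      field_simp
      linear_combination -h1

/-! ### Sides with a given number and total size of the cycles -/

lemma sum_onType_add {k : ℕ} [NeZero k] {w : MarkedWord k} (h : IsRootedWord w.1 w.2) :
    (offType w).sum + (onType w).sum = k := by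
  have h1 := height_add_sum_marks w k
  rw [h.luk.last, height_last] at h1
  have h2 : (onType w).sum = ∑ a ∈ w.2, w.1 a := rfl
  have h3 : w.2.filter (fun a : Fin k => (a : ℕ) < k) = w.2 := by
    ext a; simp
  rw [offType_eq_letterType, sum_letterType, h2]
  rw [h3] at h1
  zify
  omega

lemma card_onType {k : ℕ} (w : MarkedWord k) : (onType w).card = w.2.card := by
  rw [onType, Multiset.card_map, Finset.card_val]

lemma card_le_sum_onType {k : ℕ} [NeZero k] {w : MarkedWord k} (h : IsRootedWord w.1 w.2) :
    w.2.card ≤ (onType w).sum := by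
  rw [← card_onType]
  have := Multiset.card_nsmul_le_sum (s := onType w) (a := 1) fun x hx => by
    obtain ⟨a, ha, rfl⟩ := Multiset.mem_map.1 hx
    exact h.pos a ha
  simpa using this

/-- The side for permutations with a given number of connected cycles and given number and total size
of the exterior cycles. -/
theorem isSide_card_sum {r R : ℕ} (hc : 0 < c) (h : r ≤ R) (h0 : r = 0 → R = 0)
    (hR : R + c ≤ n) :
    IsSide n c (fun a _ => a.card = r ∧ a.sum = R) (r * (c + r) + r * (n - c - R))
      (qBinom n r * qBinom (R - 1) (r - 1) * qBinom (n - R : ℕ) c) where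
  exp_nonneg := by
    have : (0 : ℤ) ≤ n - c - R := by omega
    positivity
  order ζ := by
    obtain ⟨v, a, hv, h1, -⟩ := exists_hasLead_qBinom_pred ζ h h0
    exact ⟨_, _, add_nonneg (add_nonneg (ordBinom_nonneg _ (by omega)) hv)
      (ordBinom_nonneg _ (by omega)), ((hasLead_qBinom ζ (by omega)).mul h1).mul
      (hasLead_qBinom ζ (by omega))⟩
  sieving ζ k _ hd hnk := by
    have hdn : orderOf ζ ∣ n := ⟨k, hnk⟩
    have o1 := ordBinom_nonneg (orderOf ζ) (show r ≤ n by omega)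
    have o2 := ordBinom_nonneg (orderOf ζ) (show c ≤ n - R by omega)
    obtain ⟨v, a, hv, hlead, hpos⟩ := exists_hasLead_qBinom_pred ζ h h0
    have hall : ∀ {w : ℤ}, w = ordBinom (orderOf ζ) n r + v + ordBinom (orderOf ζ) (n - R) c →
        ∃ b, HasLead ζ (qBinom n r * qBinom (R - 1) (r - 1) * qBinom (n - R : ℕ) c) w b := by
      rintro w rfl
      exact ⟨_, ((hasLead_qBinom ζ (by omega)).mul hlead).mul (hasLead_qBinom ζ (by omega))⟩
    by_cases hdr : orderOf ζ ∣ r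
    · by_cases hdR : orderOf ζ ∣ R
      · by_cases hdc : orderOf ζ ∣ c
        · refine Or.inr ⟨hdc, ?_, ?_⟩
          · exact dvd_add ((Int.natCast_dvd_natCast.2 hdr).mul_right _)
              ((Int.natCast_dvd_natCast.2 hdr).mul_right _)
          obtain ⟨c', rfl⟩ := hdc
          obtain ⟨r', rfl⟩ := hdr
          obtain ⟨R', rfl⟩ := hdR
          have hc' : 0 < c' := Nat.pos_of_mul_pos_left hc
          subst hnk
          obtain ⟨j, rfl⟩ := Nat.exists_eq_add_of_le (Nat.le_of_mul_le_mul_left h hd)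
          have hle : r' + j + c' ≤ k := Nat.le_of_mul_le_mul_left (by rw [mul_add]; exact hR) hd
          have hj : r' = 0 → j = 0 := by
            rintro rfl
            have := h0 (mul_zero _)
            have := (mul_eq_zero.1 this).resolve_left hd.ne'
            omega
          have l1 := hasLead_qBinom_of_dvd hd (show c' ≤ k - (r' + j) by omega)
          rw [Nat.mul_sub] at l1
          refine ⟨_, ((hasLead_qBinom_of_dvd hd (show r' ≤ k by omega)).mul
            (hasLead_qBinom_pred_of_dvd hd hj)).mul l1, ?_⟩
          have h2 := ncard_rooted_card_sum (n := k) hc' r' j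
          rw [wordSet_mul hd]
          simp only [Multiset.card_nsmul, Multiset.sum_nsmul, smul_eq_mul,
            Nat.mul_right_inj hd.ne']
          have h3 := congrArg (Nat.cast : ℕ → ℂ) h2
          push_cast at h3 ⊢
          linear_combination (orderOf ζ : ℂ) * h3
        · have := one_le_ordBinom (show c ≤ n - R by omega) (Nat.dvd_sub hdn hdR) hdc
          obtain ⟨b, hb⟩ := hall rfl
          exact Or.inl ⟨_, _, by omega, hb, ncard_wordSet_of_not_dvd hdc⟩
      · have := hpos hdr hdR
        obtain ⟨b, hb⟩ := hall rfl
        refine Or.inl ⟨_, _, by omega, hb, ncard_wordSet_eq_zero fun w h1 _ => hdR ?_⟩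
        have h2 := h1.2
        rw [Multiset.sum_nsmul, smul_eq_mul] at h2
        exact ⟨_, h2.symm⟩
    · have := one_le_ordBinom (show r ≤ n by omega) hdn hdr
      obtain ⟨b, hb⟩ := hall rfl
      refine Or.inl ⟨_, _, by omega, hb, ncard_wordSet_eq_zero fun w h1 _ => hdr ?_⟩
      have h2 := h1.1
      rw [Multiset.card_nsmul] at h2
      exact ⟨_, h2.symm⟩

/-! ### Sides with given cycle types -/

lemma sum_transposePart_le (lam : Multiset ℕ) (N : ℕ) :
    ∑ i ∈ Finset.Icc 1 N, transposePart lam i ≤ lam.sum := by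
  induction lam using Multiset.induction_on with
  | empty => simp [transposePart]
  | cons a lam ih =>
    have h : ∀ i, transposePart (a ::ₘ lam) i = transposePart lam i + if i ≤ a then 1 else 0 :=
      fun i => Multiset.countP_cons _ _ _
    rw [Finset.sum_congr rfl fun i _ => h i, Finset.sum_add_distrib, Multiset.sum_cons, add_comm]
    refine Nat.add_le_add ?_ ih
    rw [← Finset.card_filter]
    calc _ ≤ (Finset.Icc 1 a).card := Finset.card_le_card fun i hi => by
          simp only [Finset.mem_filter, Finset.mem_Icc] at hi ⊢
          omega
      _ = a := by simp

lemma tau_le {lam : Multiset ℕ} (h : 0 ∉ lam) : (tau lam : ℤ) ≤ lam.card * (lam.sum - lam.card) := by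
  have h1 : transposePart lam 1 = lam.card := by
    rw [transposePart, Multiset.countP_eq_card]
    intro a ha
    exact Nat.pos_of_ne_zero fun h0 => h (h0 ▸ ha)
  have h2 := sum_transposePart_le lam (lam.sum + 1)
  rw [← Finset.Ico_add_one_right_eq_Icc, Finset.sum_Ico_eq_sum_range] at h2
  have h3 : tau lam ≤ lam.card * ∑ i ∈ Finset.range lam.sum, transposePart lam (1 + (i + 1)) := by
    rw [tau, ← Finset.Ico_add_one_right_eq_Icc, Finset.sum_Ico_eq_sum_range, Finset.mul_sum,
      Nat.add_sub_cancel]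
    refine Finset.sum_le_sum fun i _ => Nat.mul_le_mul (Multiset.countP_le_card _ _) ?_
    rw [add_assoc]
  rw [show lam.sum + 1 + 1 - 1 = lam.sum + 1 by omega, Finset.sum_range_succ', add_zero, h1] at h2
  generalize ∑ i ∈ Finset.range lam.sum, transposePart lam (1 + (i + 1)) = s at h2 h3
  have h4 : (s : ℤ) ≤ lam.sum - lam.card := by omega
  exact (Int.ofNat_le.2 h3).trans (by
    rw [Nat.cast_mul]
    exact mul_le_mul_of_nonneg_left h4 (by positivity))

lemma dvd_tau_nsmul (d : ℕ) (lam : Multiset ℕ) : d ∣ tau (d • lam) := by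
  refine Finset.dvd_sum fun i _ => Dvd.dvd.mul_right ?_ _
  rw [transposePart, Multiset.countP_nsmul]
  exact dvd_mul_right _ _

lemma exists_eq_nsmul {d : ℕ} {lam : Multiset ℕ} (h : ∀ i, d ∣ lam.count i) :
    ∃ mu : Multiset ℕ, lam = d • mu := by
  refine ⟨∑ i ∈ lam.toFinset, (lam.count i / d) • {i}, ?_⟩
  conv_lhs => rw [← Multiset.toFinset_sum_count_nsmul_eq lam]
  rw [Finset.smul_sum]
  refine Finset.sum_congr rfl fun i _ => ?_
  rw [smul_smul, Nat.mul_div_cancel' (h i)]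

lemma nsmul_left_inj {d : ℕ} (hd : 0 < d) {a b : Multiset ℕ} : d • a = d • b ↔ a = b := by
  refine ⟨fun h => ?_, fun h => by rw [h]⟩
  ext i
  have := congrArg (Multiset.count i) h
  rw [Multiset.count_nsmul, Multiset.count_nsmul] at this
  exact Nat.eq_of_mul_eq_mul_left hd this

lemma card_le_sum_of_notMem {lam : Multiset ℕ} (h : 0 ∉ lam) : lam.card ≤ lam.sum := by
  have := Multiset.card_nsmul_le_sum (s := lam) (a := 1) fun x hx =>
    Nat.pos_of_ne_zero fun h0 => h (h0 ▸ hx)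
  simpa using this

/-- The side for permutations with given sizes of the exterior cycles and given exterior sizes of the
connected cycles. -/
theorem isSide_types {α lam : Multiset ℕ} (hα : 0 ∉ α) (hlam : 0 ∉ lam) (hc : 0 < lam.card)
    (hsum : α.sum + lam.sum = n) :
    IsSide n lam.card (fun a b => a = α ∧ b = lam)
      (α.card * (lam.card + α.card) + α.card * (n - lam.card - α.sum) +
        (α.card * (α.sum - α.card) + lam.card * (n - α.sum - lam.card) - tau α - tau lam))
      ((1 - q ^ lam.sum) / (1 - q ^ lam.card) * qBinom n α.card * qMultinom α.card α *
        qMultinom lam.card lam) where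
  exp_nonneg := by
    have h1 := tau_le hα
    have h2 := tau_le hlam
    have h3 := card_le_sum_of_notMem hα
    have h4 := card_le_sum_of_notMem hlam
    have h5 : (n : ℤ) - α.sum = lam.sum := by omega
    have h6 : (0 : ℤ) ≤ n - lam.card - α.sum := by omega
    rw [h5]
    have h7 : (0 : ℤ) ≤ α.card * (lam.card + α.card) := by positivity
    have h8 : (0 : ℤ) ≤ α.card * (n - lam.card - α.sum) := by positivity
    linarith
  order ζ := by
    have h4 := card_le_sum_of_notMem hlam
    have h3 := card_le_sum_of_notMem hα
    refine ⟨_, _, ?_, ((((hasLead_one_sub ζ (hc.trans_le h4)).div (hasLead_one_sub ζ hc)).mul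
      (hasLead_qBinom ζ (by omega))).mul (hasLead_qMultinom ζ α)).mul (hasLead_qMultinom ζ lam)⟩
    have o1 := ordBinom_nonneg (orderOf ζ) (show α.card ≤ n by omega)
    have o2 := ordMultinom_nonneg (orderOf ζ) α
    have o3 := ordMultinom_nonneg (orderOf ζ) lam
    have o4 := ordDvd_nonneg (orderOf ζ) lam.sum
    by_cases hdc : orderOf ζ ∣ lam.card
    · rw [ordDvd_of_dvd hdc]
      by_cases hl : ∀ i, orderOf ζ ∣ lam.count i
      · obtain ⟨mu, hmu⟩ := exists_eq_nsmul hl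
        have : orderOf ζ ∣ lam.sum := by
          rw [hmu, Multiset.sum_nsmul, smul_eq_mul]; exact dvd_mul_right _ _
        rw [ordDvd_of_dvd this]
        omega
      · have := one_le_ordMultinom hdc hl
        omega
    · rw [ordDvd_of_not_dvd hdc]
      omega
  sieving ζ k _ hd hnk := by
    have h4 := card_le_sum_of_notMem hlam
    have h3 := card_le_sum_of_notMem hα
    have hdn : orderOf ζ ∣ n := ⟨k, hnk⟩
    have o1 := ordBinom_nonneg (orderOf ζ) (show α.card ≤ n by omega)
    have o2 := ordMultinom_nonneg (orderOf ζ) α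
    have o3 := ordMultinom_nonneg (orderOf ζ) lam
    have o4 := ordDvd_nonneg (orderOf ζ) lam.sum
    have hlead := ((((hasLead_one_sub ζ (hc.trans_le h4)).div (hasLead_one_sub ζ hc)).mul
      (hasLead_qBinom ζ (show α.card ≤ n by omega))).mul (hasLead_qMultinom ζ α)).mul
        (hasLead_qMultinom ζ lam)
    by_cases hall : (∀ i, orderOf ζ ∣ α.count i) ∧ ∀ i, orderOf ζ ∣ lam.count i
    · obtain ⟨α', rfl⟩ := exists_eq_nsmul hall.1
      obtain ⟨lam', rfl⟩ := exists_eq_nsmul hall.2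
      refine Or.inr ⟨⟨_, Multiset.card_nsmul _ _⟩, ?_, ?_⟩
      · have d1 : (orderOf ζ : ℤ) ∣ ((orderOf ζ • α').card : ℤ) :=
          Int.natCast_dvd_natCast.2 ⟨_, Multiset.card_nsmul _ _⟩
        have d2 : (orderOf ζ : ℤ) ∣ ((orderOf ζ • lam').card : ℤ) :=
          Int.natCast_dvd_natCast.2 ⟨_, Multiset.card_nsmul _ _⟩
        exact ((d1.mul_right _).add (d1.mul_right _)).add
          ((((d1.mul_right _).add (d2.mul_right _)).sub
            (Int.natCast_dvd_natCast.2 (dvd_tau_nsmul _ _))).sub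
            (Int.natCast_dvd_natCast.2 (dvd_tau_nsmul _ _)))
      · subst hnk
        rw [Multiset.sum_nsmul, Multiset.sum_nsmul, smul_eq_mul, smul_eq_mul, ← mul_add] at hsum
        have hsum' : α'.sum + lam'.sum = k := Nat.eq_of_mul_eq_mul_left hd hsum
        rw [Multiset.card_nsmul] at hc
        have hc' : 0 < lam'.card := Nat.pos_of_mul_pos_left hc
        have hα' : 0 ∉ α' := fun h => hα (Multiset.mem_nsmul.2 ⟨hd.ne', h⟩)
        have hlam' : 0 ∉ lam' := fun h => hlam (Multiset.mem_nsmul.2 ⟨hd.ne', h⟩)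
        have h3' := card_le_sum_of_notMem hα'
        have h4' := card_le_sum_of_notMem hlam'
        have hs : 0 < orderOf ζ * lam'.sum := Nat.mul_pos hd (hc'.trans_le h4')
        have l2 := hasLead_qBinom_of_dvd hd (show α'.card ≤ k by omega)
        have l1 := ((((hasLead_one_sub ζ hs).div (hasLead_one_sub ζ hc)).mul l2).mul
          (hasLead_qMultinom_of_dvd hd α')).mul (hasLead_qMultinom_of_dvd hd lam')
        rw [ordDvd_of_dvd (dvd_mul_right _ _), ordDvd_of_dvd (dvd_mul_right _ _), leadNum, leadNum,
          if_pos (dvd_mul_right _ _), if_pos (dvd_mul_right _ _)] at l1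
        rw [Multiset.sum_nsmul, smul_eq_mul]
        simp only [Multiset.card_nsmul] at l1 ⊢
        refine ⟨_, l1.congr (by ring) rfl, ?_⟩
        rw [wordSet_mul hd]
        simp only [nsmul_left_inj hd]
        have h5 := congrArg (Nat.cast : ℕ → ℂ)
          (ncard_rooted_types (n := k) hc' hα' hlam' rfl (by omega) hsum')
        have h6 := congrArg (Nat.cast : ℕ → ℂ)
          (Nat.choose_mul_factorial_mul_factorial (show α'.card ≤ k by omega))
        have hz := ne_zero_of_orderOf_pos hd
        have z1 : (orderOf ζ : ℂ) ≠ 0 := by exact_mod_cast hd.ne'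
        have z2 : (lam'.card : ℂ) ≠ 0 := by exact_mod_cast hc'.ne'
        have z3 : ((k - α'.card).factorial : ℂ) ≠ 0 := by exact_mod_cast Nat.factorial_ne_zero _
        have z4 : ∏ i ∈ α'.toFinset, ((α'.count i).factorial : ℂ) ≠ 0 :=
          Finset.prod_ne_zero_iff.2 fun i _ => by exact_mod_cast Nat.factorial_ne_zero _
        have z5 : ∏ i ∈ lam'.toFinset, ((lam'.count i).factorial : ℂ) ≠ 0 :=
          Finset.prod_ne_zero_iff.2 fun i _ => by exact_mod_cast Nat.factorial_ne_zero _
        rw [show k - α'.sum = lam'.sum by omega, ← Nat.choose_mul_factorial_mul_factorial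
          (show α'.card ≤ k by omega)] at h5
        push_cast at h5 ⊢
        field_simp
        apply mul_left_cancel₀ z3
        linear_combination h5
    · have hempty : (wordSet (orderOf ζ) k lam.card fun a b => a = α ∧ b = lam).ncard = 0 := by
        refine ncard_wordSet_eq_zero fun w h1 _ => hall ?_
        rw [← h1.1, ← h1.2]
        refine ⟨fun i => ?_, fun i => ?_⟩ <;> rw [Multiset.count_nsmul] <;> exact dvd_mul_right _ _
      refine Or.inl ⟨_, _, ?_, hlead, hempty⟩
      have hs : ordDvd (orderOf ζ) lam.sum ≤ 1 := by unfold ordDvd; split_ifs <;> simp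
      -- if `d` divides the sum of `α`, it also divides the sum of `lam`
      have hsum_dvd : (∀ i, orderOf ζ ∣ α.count i) → ordDvd (orderOf ζ) lam.sum = 1 := by
        intro h
        obtain ⟨α', h1⟩ := exists_eq_nsmul h
        refine ordDvd_of_dvd ((Nat.dvd_add_right ?_).1 (hsum ▸ hdn))
        rw [h1, Multiset.sum_nsmul, smul_eq_mul]
        exact dvd_mul_right _ _
      have hlam_dvd : orderOf ζ ∣ lam.card → ordDvd (orderOf ζ) lam.sum = 1 ∨
          1 ≤ ordMultinom (orderOf ζ) lam := by
        intro hdc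
        by_cases hl : ∀ i, orderOf ζ ∣ lam.count i
        · obtain ⟨mu, hmu⟩ := exists_eq_nsmul hl
          refine Or.inl (ordDvd_of_dvd ?_)
          rw [hmu, Multiset.sum_nsmul, smul_eq_mul]; exact dvd_mul_right _ _
        · exact Or.inr (one_le_ordMultinom hdc hl)
      have hcase : 1 ≤ ordBinom (orderOf ζ) n α.card + ordMultinom (orderOf ζ) α ∨
          ∀ i, orderOf ζ ∣ α.count i := by
        by_cases hdr : orderOf ζ ∣ α.card
        · by_cases h : ∀ i, orderOf ζ ∣ α.count i
          · exact Or.inr h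
          · have := one_le_ordMultinom hdr h
            left; omega
        · have := one_le_ordBinom (show α.card ≤ n by omega) hdn hdr
          left; omega
      by_cases hdc : orderOf ζ ∣ lam.card
      · rw [ordDvd_of_dvd hdc]
        have h5 := hlam_dvd hdc
        rcases hcase with h6 | h6
        · omega
        · have h7 := hsum_dvd h6
          have h8 := one_le_ordMultinom hdc fun h => hall ⟨h6, h⟩
          omega
      · rw [ordDvd_of_not_dvd hdc]
        rcases hcase with h6 | h6
        · omega
        · have := hsum_dvd h6
          omega

end sides
end AnnularCSP
end

noncomputable section
namespace AnnularCSP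

open Equiv

/-! ### The group of annular rotations -/

section group
variable {n m : ℕ} [NeZero n] [NeZero m]

lemma ofNat_add (a b : ℕ) : Fin.ofNat n (a + b) = Fin.ofNat n a + Fin.ofNat n b := by
  ext
  simp [Fin.val_add]

lemma rot_pow (a b k : ℕ) : rot (Fin.ofNat n a) (-Fin.ofNat m b) ^ k =
    rot (Fin.ofNat n (k * a)) (-Fin.ofNat m (k * b)) := by
  induction k with
  | zero =>
    rw [pow_zero, zero_mul, zero_mul, ← rot_zero_zero]
    simp
  | succ k ih =>
    rw [pow_succ, ih, rot_mul_rot, Nat.succ_mul, Nat.succ_mul, ofNat_add, ofNat_add, neg_add]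

lemma annularRotation_eq : annularRotation n m =
    rot (Fin.ofNat n (n / n.gcd m)) (-Fin.ofNat m (m / n.gcd m)) := by
  have h : (finRotate m ^ (m / n.gcd m))⁻¹ = Equiv.addRight (-Fin.ofNat m (m / n.gcd m)) := by
    rw [inv_eq_iff_mul_eq_one]
    ext x
    simp [Perm.mul_apply, finRotate_pow_apply]
  rw [annularRotation, h]
  ext (x | x) <;> simp [finRotate_pow_apply]

lemma annularRotation_pow (k : ℕ) : annularRotation n m ^ k =
    rot (Fin.ofNat n (k * (n / n.gcd m))) (-Fin.ofNat m (k * (m / n.gcd m))) := by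
  rw [annularRotation_eq, rot_pow]

lemma annularRotation_pow_eq_one_iff (k : ℕ) : annularRotation n m ^ k = 1 ↔ n.gcd m ∣ k := by
  have hn := Nat.pos_of_neZero n
  have hg : 0 < n.gcd m := Nat.gcd_pos_of_pos_left _ hn
  have key : ∀ a : ℕ, 0 < a → n.gcd m ∣ a → (a ∣ k * (a / n.gcd m) ↔ n.gcd m ∣ k) := by
    intro a ha hdvd
    have h1 : a = n.gcd m * (a / n.gcd m) := (Nat.mul_div_cancel' hdvd).symm
    conv_lhs => lhs; rw [h1]
    exact Nat.mul_dvd_mul_iff_right (Nat.div_pos (Nat.le_of_dvd ha hdvd) hg)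
  rw [annularRotation_pow]
  constructor
  · intro h
    have h1 := congrArg (fun σ : Perm (Pt n m) => σ (Sum.inl 0)) h
    simp only [rot_inl, Perm.one_apply, Sum.inl.injEq, zero_add] at h1
    rw [Fin.ofNat_eq_cast, Fin.natCast_eq_zero] at h1
    exact (key n hn (Nat.gcd_dvd_left n m)).1 h1
  · intro h
    have h1 := (key n hn (Nat.gcd_dvd_left n m)).2 h
    have h2 := (key m (Nat.pos_of_neZero m) (Nat.gcd_dvd_right n m)).2 h
    rw [← Fin.natCast_eq_zero, ← Fin.ofNat_eq_cast] at h1 h2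
    rw [h1, h2, neg_zero, rot_zero_zero]

lemma orderOf_annularRotation :
    orderOf (ConjAct.toConjAct (annularRotation n m)) = n.gcd m := by
  have h : ∀ k, ConjAct.toConjAct (annularRotation n m) ^ k = 1 ↔ n.gcd m ∣ k := by
    intro k
    rw [← map_pow, map_eq_one_iff _ (MulEquiv.injective _), annularRotation_pow_eq_one_iff]
  exact Nat.dvd_antisymm (orderOf_dvd_of_pow_eq_one ((h _).2 dvd_rfl))
    ((h _).1 (pow_orderOf_eq_one _))

lemma toConjAct_annularRotation_pow_smul (k : ℕ) (π : Perm (Pt n m)) :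
    ConjAct.toConjAct (annularRotation n m) ^ k • π =
      turn (Fin.ofNat n (k * (n / n.gcd m))) (-Fin.ofNat m (k * (m / n.gcd m))) π := by
  rw [← map_pow, ConjAct.toConjAct_smul, annularRotation_pow, turn]

lemma pow_smul_eq_iff_gcd {G A : Type*} [Group G] [MulAction G A] (x : G) (k : ℕ) (a : A) :
    x ^ k • a = a ↔ x ^ (k.gcd (orderOf x)) • a = a := by
  simp only [← MulAction.mem_stabilizer_iff]
  constructor
  · intro h
    have h1 : x ^ (k.gcd (orderOf x)) = (x ^ k) ^ (k.gcdA (orderOf x)) := by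
      rw [← zpow_natCast x (k.gcd _), Nat.gcd_eq_gcd_ab, zpow_add, zpow_mul, zpow_mul, zpow_natCast,
        zpow_natCast, pow_orderOf_eq_one, one_zpow, mul_one]
    rw [h1]
    exact Subgroup.zpow_mem _ h _
  · intro h
    obtain ⟨j, hj⟩ := Nat.gcd_dvd_left k (orderOf x)
    rw [hj, pow_mul]
    exact Subgroup.pow_mem _ h _

/-- An element of order `d` has the same fixed points as the rotation by `2π / d`. -/
lemma smul_eq_iff_turn (τ : rotationGroup n m) (π : Perm (Pt n m)) :
    orderOf τ ∣ n.gcd m ∧ (τ • π = π ↔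
      turn (Fin.ofNat n (n / orderOf τ)) (-Fin.ofNat m (m / orderOf τ)) π = π) := by
  obtain ⟨k, hk⟩ := mem_powers_iff_mem_zpowers.2 τ.2
  simp only at hk
  have hn := Nat.pos_of_neZero n
  have hg : 0 < n.gcd m := Nat.gcd_pos_of_pos_left _ hn
  have h1 : orderOf τ = n.gcd m / k.gcd (n.gcd m) := by
    rw [← Subgroup.orderOf_coe, ← hk, orderOf_pow, orderOf_annularRotation,
      Nat.gcd_comm (n.gcd m) k]
  set h := k.gcd (n.gcd m) with hh
  have hdvd : h ∣ n.gcd m := Nat.gcd_dvd_right _ _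
  have hpos : 0 < h := Nat.gcd_pos_of_pos_right _ hg
  have key : ∀ a, n.gcd m ∣ a → h * (a / n.gcd m) = a / orderOf τ := by
    rintro a ⟨b, rfl⟩
    obtain ⟨e, he⟩ := hdvd
    have he0 : 0 < e := Nat.pos_of_ne_zero fun h0 => by rw [h0] at he; omega
    rw [h1, Nat.mul_div_cancel_left _ hg, he, Nat.mul_div_cancel_left _ hpos,
      show h * e * b = e * (h * b) by ring, Nat.mul_div_cancel_left _ he0]
  refine ⟨h1 ▸ Nat.div_dvd_of_dvd hdvd, ?_⟩
  rw [Subgroup.smul_def, ← hk, pow_smul_eq_iff_gcd, orderOf_annularRotation, ← hh,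
    toConjAct_annularRotation_pow_smul, key n (Nat.gcd_dvd_left _ _),
    key m (Nat.gcd_dvd_right _ _)]

/-- The cyclic sieving phenomenon follows from the count of the permutations that are fixed by
the rotation by `2π / d`. -/
theorem exhibitsCSP_of_eval {X : Set (Perm (Pt n m))}
    (hstab : ∀ s t, ∀ π ∈ X, turn s t π ∈ X) {f : RatFunc ℂ} {p : Polynomial ℂ}
    (hp : algebraMap (Polynomial ℂ) (RatFunc ℂ) p = f)
    (heval : ∀ (d k l : ℕ) [NeZero d] [NeZero k] [NeZero l] (ζ : ℂ), orderOf ζ = d → n = d * k →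
      m = d * l → p.eval ζ =
        ({π | π ∈ X ∧ turn (Fin.ofNat n k) (-Fin.ofNat m l) π = π}.ncard : ℂ)) :
    ExhibitsCSP (rotationGroup n m) X f where
  isCyclic := Subgroup.isCyclic_zpowers _
  finite_group := inferInstance
  finite_set := Set.toFinite X
  stable τ π hπ := by
    obtain ⟨k, hk⟩ := mem_powers_iff_mem_zpowers.2 τ.2
    simp only at hk
    rw [Subgroup.smul_def, ← hk, toConjAct_annularRotation_pow_smul]
    exact hstab _ _ _ hπ
  sieving := by
    refine ⟨p, hp, fun w hw τ => ?_⟩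
    have hord : orderOf ((w τ : ℂˣ) : ℂ) = orderOf τ := by
      rw [orderOf_units, orderOf_injective w hw]
    have hd := (smul_eq_iff_turn τ 1).1
    obtain ⟨k, hk⟩ := hd.trans (Nat.gcd_dvd_left n m)
    obtain ⟨l, hl⟩ := hd.trans (Nat.gcd_dvd_right n m)
    have hn := Nat.pos_of_neZero n
    have hm := Nat.pos_of_neZero m
    have hd0 : orderOf τ ≠ 0 := fun h => by rw [h] at hk; omega
    have : NeZero (orderOf τ) := ⟨hd0⟩
    have : NeZero k := ⟨fun h => by rw [h] at hk; omega⟩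
    have : NeZero l := ⟨fun h => by rw [h] at hl; omega⟩
    rw [heval _ k l _ hord hk hl]
    congr 3
    ext π
    have h1 : n / orderOf τ = k := by
      conv_lhs => lhs; rw [hk]
      exact Nat.mul_div_cancel_left _ (Nat.pos_of_ne_zero hd0)
    have h2 : m / orderOf τ = l := by
      conv_lhs => lhs; rw [hl]
      exact Nat.mul_div_cancel_left _ (Nat.pos_of_ne_zero hd0)
    rw [(smul_eq_iff_turn τ π).2, h1, h2]

end group

/-! ### The sieving phenomenon for sets with given types -/

section sieving
variable {n m c : ℕ} [NeZero n] [NeZero m]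

lemma card_connCycles_turn (s : Fin n) (t : Fin m) (π : Perm (Pt n m)) :
    (connCycles (turn s t π)).card = (connCycles π).card := by
  rw [connCycles_turn, Finset.card_map]

/-- The annular noncrossing permutations with `c` connected cycles and given properties of the cycle
types. -/
def typeSet (n m c : ℕ) (P Q : Multiset ℕ → Multiset ℕ → Prop) : Set (Perm (Pt n m)) :=
  {π | IsAnnularNoncrossing π ∧ (connCycles π).card = c ∧ P (extType π) (connExtType π) ∧
    Q (intType π) (connIntType π)}

lemma turn_mem_typeSet {P Q : Multiset ℕ → Multiset ℕ → Prop} (s : Fin n) (t : Fin m)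
    {π : Perm (Pt n m)} (h : π ∈ typeSet n m c P Q) : turn s t π ∈ typeSet n m c P Q := by
  obtain ⟨h1, h2, h3, h4⟩ := h
  refine ⟨(isAnnularNoncrossing_turn s t).2 h1, ?_, ?_, ?_⟩
  · rw [card_connCycles_turn, h2]
  · rw [extType_turn, connExtType_turn]; exact h3
  · rw [intType_turn, connIntType_turn]; exact h4

lemma ncard_typeSet_fixed {d k l : ℕ} [NeZero d] [NeZero k] [NeZero l] (hn : n = d * k)
    (hm : m = d * l) (P Q : Multiset ℕ → Multiset ℕ → Prop) :
    {π | π ∈ typeSet n m c P Q ∧ turn (Fin.ofNat n k) (-Fin.ofNat m l) π = π}.ncard =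
      (fixedSet d k l c P Q).ncard := by
  subst hn hm
  congr 1
  ext π
  simp only [typeSet, fixedSet, Set.mem_ofPred_eq, and_assoc, period]

/-- Sieving for a set of permutations whose conditions on the exterior and on the interior sizes of
the cycles are independent of each other, except for the number of connected cycles. -/
theorem exhibitsCSP_typeSet (hc : 0 < c) {P Q : Multiset ℕ → Multiset ℕ → Prop} {e₁ e₂ : ℤ}
    {f g : RatFunc ℂ} (hf : IsSide n c P e₁ f) (hg : IsSide m c Q e₂ g) :
    ExhibitsCSP (rotationGroup n m) (typeSet n m c P Q)
      (q ^ ((c : ℤ) * (c - 1) + e₁ + e₂) * qBase n m c * (f * g)) := by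
  obtain ⟨p, hp, heval⟩ := exists_polynomial_of_isSide (Nat.pos_of_neZero n) (Nat.pos_of_neZero m)
    hc hf hg
  refine exhibitsCSP_of_eval (fun s t π h => turn_mem_typeSet s t h) hp ?_
  intro d k l _ _ _ ζ hζ hnk hml
  rw [heval d k l ζ hζ hnk hml, ncard_typeSet_fixed hnk hml]

lemma exhibitsCSP_zero {X : Set (Perm (Pt n m))} (hX : X = ∅) :
    ExhibitsCSP (rotationGroup n m) X 0 := by
  subst hX
  refine exhibitsCSP_of_eval (p := 0) (fun _ _ π h => h.elim) (map_zero _) ?_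
  intro d k l _ _ _ ζ _ _ _
  simp

/-- Every cycle type that occurs comes from rooted words. -/
lemma exists_rooted {π : Perm (Pt n m)} (h : IsAnnularNoncrossing π) (hc : (connCycles π).Nonempty) :
    (∃ w : MarkedWord n, IsRootedWord w.1 w.2 ∧ w.2.card = (connCycles π).card ∧
      offType w = extType π ∧ onType w = connExtType π) ∧
    ∃ w : MarkedWord m, IsRootedWord w.1 w.2 ∧ w.2.card = (connCycles π).card ∧
      offType w = intType π ∧ onType w = connIntType π := by
  have h1 := card_extMarks h
  obtain ⟨a, ha⟩ := Finset.card_pos.1 (h1 ▸ Finset.card_pos.2 hc)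
  obtain ⟨b, hr⟩ := exists_isRooted_turn h ha
  have h2 := card_extMarks ((isAnnularNoncrossing_turn (-a) (-b)).2 h)
  rw [card_connCycles_turn] at h2
  refine ⟨⟨(extWord (turn (-a) (-b) π), extMarks (turn (-a) (-b) π)), hr.isRootedWord_ext, h2, ?_, ?_⟩,
    ⟨(intWord (turn (-a) (-b) π), intMarks (turn (-a) (-b) π)), hr.isRootedWord_int, ?_, ?_, ?_⟩⟩
  · rw [← hr.nc.extType_eq, extType_turn]
  · rw [← hr.nc.connExtType_eq, connExtType_turn]
  · rw [← h2]
    exact hr.nc.card_marks.symm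
  · rw [← hr.nc.intType_eq, intType_turn]
  · rw [← hr.nc.connIntType_eq, connIntType_turn]

end sieving
end AnnularCSP
end

noncomputable section
namespace AnnularCSP

open Equiv

/-! ### The Kreweras and Narayana numbers -/

section narayana
variable {n m : ℕ}

lemma card_extType (π : Perm (Pt n m)) : (extType π).card = (extCycles π).card :=
  Multiset.card_map _ _

lemma card_intType (π : Perm (Pt n m)) : (intType π).card = (intCycles π).card :=
  Multiset.card_map _ _

lemma sum_extType (π : Perm (Pt n m)) : (extType π).sum = ∑ B ∈ extCycles π, B.card := rfl

lemma sum_intType (π : Perm (Pt n m)) : (intType π).sum = ∑ B ∈ intCycles π, B.card := rfl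

lemma qNum_zero : qNum 0 = 0 := by simp [qNum]

lemma card_connExtType (π : Perm (Pt n m)) : (connExtType π).card = (connCycles π).card :=
  Multiset.card_map _ _

lemma ANC₃_zero : ANC₃ n m 0 = ∅ := by
  rw [Set.eq_empty_iff_forall_notMem]
  rintro π ⟨⟨-, h1⟩, h2⟩
  exact h1.card_pos.ne' h2

lemma ANC₃_eq {c : ℕ} (hc : 0 < c) :
    ANC₃ n m c = typeSet n m c (fun _ _ => True) (fun _ _ => True) := by
  ext π
  simp only [ANC₃, ANC, typeSet, Set.mem_ofPred_eq, and_true]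
  exact ⟨fun ⟨⟨h1, _⟩, h2⟩ => ⟨h1, h2⟩, fun ⟨h1, h2⟩ =>
    ⟨⟨h1, Finset.card_pos.1 (h2 ▸ hc)⟩, h2⟩⟩

lemma ANC₂_eq {c : ℕ} (hc : 0 < c) (r s : ℕ) : ANC₂ n m c r s =
    typeSet n m c (fun a _ => a.card = r) (fun a _ => a.card = s) := by
  ext π
  rw [ANC₂, Set.mem_ofPred_eq, ANC₃_eq hc]
  simp only [typeSet, Set.mem_ofPred_eq, and_true, card_extType, card_intType, and_assoc]

lemma ANC₁_eq {c : ℕ} (hc : 0 < c) (r s R S : ℕ) : ANC₁ n m c r s R S =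
    typeSet n m c (fun a _ => a.card = r ∧ a.sum = R) (fun a _ => a.card = s ∧ a.sum = S) := by
  ext π
  rw [ANC₁, Set.mem_ofPred_eq, ANC₂_eq hc]
  simp only [typeSet, Set.mem_ofPred_eq, ← sum_extType, ← sum_intType]
  tauto

lemma ANCtype_eq {R S : ℕ} (α : R.Partition) (β : S.Partition) (lam : (n - R).Partition)
    (mu : (m - S).Partition) (hc : 0 < lam.parts.card) : ANCtype n m α β lam mu =
      typeSet n m lam.parts.card (fun a b => a = α.parts ∧ b = lam.parts)
        (fun a b => a = β.parts ∧ b = mu.parts) := by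
  ext π
  simp only [ANCtype, ANC, typeSet, Set.mem_ofPred_eq]
  constructor
  · rintro ⟨⟨h1, h2⟩, h3, h4, h5, h6⟩
    refine ⟨h1, ?_, ⟨h3, h5⟩, h4, h6⟩
    rw [← h5, card_connExtType]
  · rintro ⟨h1, h2, ⟨h3, h5⟩, h4, h6⟩
    exact ⟨⟨h1, Finset.card_pos.1 (h2 ▸ hc)⟩, h3, h4, h5, h6⟩

lemma ANC₁_subset (c r s R S : ℕ) : ANC₁ n m c r s R S ⊆ ANC₃ n m c := fun _ h => h.1.1

lemma ANC₂_subset (c r s : ℕ) : ANC₂ n m c r s ⊆ ANC₃ n m c := fun _ h => h.1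

lemma card_connCycles_le (π : Perm (Pt n m)) : (connCycles π).card ≤ n + m := by
  refine (Finset.card_filter_le _ _).trans (Finset.card_image_le.trans ?_)
  simp

variable [NeZero n] [NeZero m]

lemma card_offType_add_card_le {k : ℕ} [NeZero k] {w : MarkedWord k} :
    (offType w).card + w.2.card ≤ k := by
  have h1 : (offType w).card = (Finset.univ.filter fun x => x ∉ w.2 ∧ 0 < w.1 x).card := by
    rw [offType, Multiset.card_map, Finset.card_val]
  have h2 : Disjoint (Finset.univ.filter fun x => x ∉ w.2 ∧ 0 < w.1 x) w.2 := by
    rw [Finset.disjoint_left]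
    intro x hx
    exact (Finset.mem_filter.1 hx).2.1
  rw [h1, ← Finset.card_union_of_disjoint h2]
  exact (Finset.card_le_univ _).trans (by simp)

/-- Bounds for the parameters that occur. -/
lemma type_bounds {π : Perm (Pt n m)} {c : ℕ} (h : π ∈ ANC₃ n m c) :
    ((extCycles π).card + c ≤ n ∧ (extCycles π).card ≤ (extType π).sum ∧
      ((extCycles π).card = 0 → (extType π).sum = 0) ∧ (extType π).sum + c ≤ n) ∧
    (intCycles π).card + c ≤ m ∧ (intCycles π).card ≤ (intType π).sum ∧
      ((intCycles π).card = 0 → (intType π).sum = 0) ∧ (intType π).sum + c ≤ m := by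
  obtain ⟨⟨h1, h2⟩, rfl⟩ := h
  have aux : ∀ {k : ℕ} [NeZero k] (w : MarkedWord k), IsRootedWord w.1 w.2 →
      (offType w).card + w.2.card ≤ k ∧ (offType w).card ≤ (offType w).sum ∧
      ((offType w).card = 0 → (offType w).sum = 0) ∧ (offType w).sum + w.2.card ≤ k := by
    intro k _ w hw
    have e1 := sum_onType_add hw
    have e2 := card_le_sum_onType hw
    refine ⟨card_offType_add_card_le, card_offType_le_sum w, fun h0 => ?_, by omega⟩
    rw [Multiset.card_eq_zero.1 h0, Multiset.sum_zero]
  obtain ⟨⟨w, hw, e1, e2, -⟩, v, hv, e3, e4, -⟩ := exists_rooted h1 h2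
  have b1 := aux w hw
  have b2 := aux v hv
  rw [e1, e2, card_extType] at b1
  rw [e3, e4, card_intType] at b2
  exact ⟨b1, b2⟩

/-- For `c = 0` or too large, the set is empty and the function vanishes: the two circles
contribute a factor only if there is room for `c` connected cycles. The other families are treated
in the same way. -/
theorem exhibitsCSP_Nara₃ (c : ℕ) : ExhibitsCSP (rotationGroup n m) (ANC₃ n m c) (Nara₃ n m c) := by
  rcases Nat.eq_zero_or_pos c with rfl | hc
  · have : Nara₃ n m 0 = 0 := by simp [Nara₃, qNum_zero]
    rw [this]
    exact exhibitsCSP_zero ANC₃_zero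
  by_cases h : c ≤ n ∧ c ≤ m
  · have := exhibitsCSP_typeSet (n := n) (m := m) hc (isSide_conn hc h.1) (isSide_conn hc h.2)
    rw [← ANC₃_eq hc] at this
    convert this using 1
    rw [Nara₃, qBase, expX, add_zero, add_zero]
    push_cast [h.1, h.2]
    ring
  · have h1 : Nara₃ n m c = 0 := by
      rcases not_and_or.1 h with h | h
      · rw [Nara₃, qBinom_eq_zero (a := 2 * n) (by omega) (by omega)]
        ring
      · rw [Nara₃, qBinom_eq_zero (a := 2 * m) (by omega) (by omega)]
        ring
    rw [h1]
    refine exhibitsCSP_zero (Set.eq_empty_iff_forall_notMem.2 fun π hπ => ?_)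
    have := type_bounds hπ
    omega

theorem exhibitsCSP_Nara₂ (c r s : ℕ) :
    ExhibitsCSP (rotationGroup n m) (ANC₂ n m c r s) (Nara₂ n m c r s) := by
  rcases Nat.eq_zero_or_pos c with rfl | hc
  · have : Nara₂ n m 0 r s = 0 := by simp [Nara₂, qNum_zero]
    rw [this]
    exact exhibitsCSP_zero (Set.subset_empty_iff.1 (ANC₃_zero (n := n) (m := m) ▸ ANC₂_subset 0 r s))
  by_cases h : r + c ≤ n ∧ s + c ≤ m
  · have := exhibitsCSP_typeSet (n := n) (m := m) hc (isSide_card hc h.1) (isSide_card hc h.2)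
    rw [← ANC₂_eq hc] at this
    convert this using 1
    rw [Nara₂, qBase, ← zpow_add₀ q_ne_zero]
    have e : expX c + expY c r s = c * (c - 1) + r * (c + r) + s * (c + s) := by
      unfold expX expY; ring
    rw [e]
    push_cast
    ring
  · have h1 : Nara₂ n m c r s = 0 := by
      rcases not_and_or.1 h with h | h
      · rw [Nara₂, qBinom_eq_zero (a := n) (b := r + c) (by omega) (by omega)]
        ring
      · rw [Nara₂, qBinom_eq_zero (a := m) (b := s + c) (by omega) (by omega)]
        ring
    rw [h1]
    refine exhibitsCSP_zero (Set.eq_empty_iff_forall_notMem.2 fun π hπ => ?_)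
    have := type_bounds hπ.1
    rw [hπ.2.1, hπ.2.2] at this
    omega

theorem exhibitsCSP_Nara₁ (c r s R S : ℕ) :
    ExhibitsCSP (rotationGroup n m) (ANC₁ n m c r s R S) (Nara₁ n m c r s R S) := by
  rcases Nat.eq_zero_or_pos c with rfl | hc
  · have : Nara₁ n m 0 r s R S = 0 := by simp [Nara₁, qNum_zero]
    rw [this]
    exact exhibitsCSP_zero
      (Set.subset_empty_iff.1 (ANC₃_zero (n := n) (m := m) ▸ ANC₁_subset 0 r s R S))
  by_cases h : (r ≤ R ∧ (r = 0 → R = 0) ∧ R + c ≤ n) ∧ s ≤ S ∧ (s = 0 → S = 0) ∧ S + c ≤ m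
  · obtain ⟨⟨h1, h2, h3⟩, h4, h5, h6⟩ := h
    have := exhibitsCSP_typeSet (n := n) (m := m) hc (isSide_card_sum hc h1 h2 h3)
      (isSide_card_sum hc h4 h5 h6)
    rw [← ANC₁_eq hc] at this
    convert this using 1
    rw [Nara₁, qBase, ← zpow_add₀ q_ne_zero, ← zpow_add₀ q_ne_zero]
    have e : expX c + expY c r s + expZ n m c r s R S = c * (c - 1) +
        (r * (c + r) + r * (n - c - R)) + (s * (c + s) + s * (m - c - S)) := by
      unfold expX expY expZ; ring
    rw [e, Nat.cast_sub (show R ≤ n by omega), Nat.cast_sub (show S ≤ m by omega)]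
    ring
  · have aux : ∀ {k t T : ℕ}, ¬ (t ≤ T ∧ (t = 0 → T = 0) ∧ T + c ≤ k) →
        qBinom (T - 1) (t - 1) = 0 ∨ qBinom (k - T) c = 0 := by
      intro k t T h
      by_cases h' : t ≤ T ∧ (t = 0 → T = 0)
      · right
        exact qBinom_eq_zero (by omega) (by omega)
      · left
        exact qBinom_eq_zero (by omega) (by omega)
    have h1 : Nara₁ n m c r s R S = 0 := by
      rcases not_and_or.1 h with h | h
      · rcases aux h with h | h <;> (rw [Nara₁, h]; ring)
      · rcases aux h with h | h <;> (rw [Nara₁, h]; ring)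
    rw [h1]
    refine exhibitsCSP_zero (Set.eq_empty_iff_forall_notMem.2 fun π hπ => h ?_)
    have := type_bounds hπ.1.1
    rw [hπ.1.2.1, hπ.1.2.2, sum_extType, sum_intType, hπ.2.1, hπ.2.2] at this
    tauto

lemma zero_notMem_parts {k : ℕ} (p : k.Partition) : 0 ∉ p.parts :=
  fun h => (p.parts_pos h).ne' rfl

theorem exhibitsCSP_Kre {c r s R S : ℕ} (hc : 1 ≤ c) (hR : R ≤ n) (hS : S ≤ m) (α : R.Partition)
    (β : S.Partition) (lam : (n - R).Partition) (mu : (m - S).Partition) (hα : α.parts.card = r)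
    (hβ : β.parts.card = s) (hlam : lam.parts.card = c) (hmu : mu.parts.card = c) :
    ExhibitsCSP (rotationGroup n m) (ANCtype n m α β lam mu)
      (Kre n m c r s R S α.parts β.parts lam.parts mu.parts) := by
  subst hα hβ hlam
  have h1 := isSide_types (n := n) (zero_notMem_parts α) (zero_notMem_parts lam) hc
    (by rw [α.parts_sum, lam.parts_sum]; omega)
  have h2 := isSide_types (n := m) (zero_notMem_parts β) (zero_notMem_parts mu) (hmu ▸ hc)
    (by rw [β.parts_sum, mu.parts_sum]; omega)
  rw [hmu] at h2
  have := exhibitsCSP_typeSet (n := n) (m := m) hc h1 h2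
  rw [← ANCtype_eq _ _ _ _ hc] at this
  convert this using 1
  rw [α.parts_sum, β.parts_sum, lam.parts_sum, mu.parts_sum, Kre, qBase, ← zpow_add₀ q_ne_zero,
    ← zpow_add₀ q_ne_zero, ← zpow_add₀ q_ne_zero]
  set c := lam.parts.card with hcdef
  set r := α.parts.card
  set s := β.parts.card
  have e : expX c + expY c r s + expZ n m c r s R S +
      expW n m c r s R S α.parts β.parts lam.parts mu.parts = c * (c - 1) +
      (r * (c + r) + r * (n - c - R) + (r * (R - r) + c * (n - R - c) - tau α.parts -
        tau lam.parts)) +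
      (s * (c + s) + s * (m - c - S) + (s * (S - s) + c * (m - S - c) - tau β.parts -
        tau mu.parts)) := by
    unfold expX expY expZ expW; ring
  have e2 : qNum (n - R) * qNum (m - S) / qNum c ^ 2 =
      (1 - q ^ (n - R)) / (1 - q ^ c) * ((1 - q ^ (m - S)) / (1 - q ^ c)) := by
    have hu := pow_one q ▸ one_sub_q_ne_zero
    by_cases h0 : 1 - q ^ c = 0
    · simp [qNum, h0]
    · rw [qNum, qNum, qNum]
      field_simp
  rw [e, e2]
  ring

end narayana

/-! ### The Catalan number -/

section catalan
variable {n m : ℕ} [NeZero n] [NeZero m]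

/-- The number of elements of `ANC₃ n m c` that are fixed by a rotation of order `d`. -/
lemma ncard_ANC₃_fixed {d k l : ℕ} [NeZero d] [NeZero k] [NeZero l] (hn : n = d * k)
    (hm : m = d * l) (c : ℕ) :
    {π | π ∈ ANC₃ n m (d * c) ∧ turn (Fin.ofNat n k) (-Fin.ofNat m l) π = π}.ncard =
      d * (c * ((2 * k).choose (k + c) * (2 * l).choose (l + c))) := by
  rcases Nat.eq_zero_or_pos c with rfl | hc
  · simp [ANC₃_zero]
  have hd := Nat.pos_of_neZero d
  have hdc : 0 < d * c := Nat.mul_pos hd hc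
  rw [ANC₃_eq hdc, ncard_typeSet_fixed hn hm]
  have h := card_fixedSet (d := d) (k := k) (l := l) (d * c) (fun _ _ => True) (fun _ _ => True)
  have h1 := ncard_rooted (n := k) hc
  have h2 := ncard_rooted (n := l) hc
  rw [wordSet_mul hd, wordSet_mul hd] at h
  simp only [and_true] at h
  apply Nat.eq_of_mul_eq_mul_left hdc
  rw [h]
  linear_combination (d * d * l *
    {w : MarkedWord l | IsRootedWord w.1 w.2 ∧ w.2.card = c}.ncard) * h1 +
    (d * d * c * (2 * k).choose (k + c)) * h2

lemma ncard_ANC₃_fixed_of_not_dvd {d k l : ℕ} [NeZero d] [NeZero k] [NeZero l] (hn : n = d * k)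
    (hm : m = d * l) {c : ℕ} (hc : ¬ d ∣ c) :
    {π | π ∈ ANC₃ n m c ∧ turn (Fin.ofNat n k) (-Fin.ofNat m l) π = π}.ncard = 0 := by
  have hc0 : 0 < c := Nat.pos_of_ne_zero fun h => hc (h ▸ dvd_zero d)
  rw [ANC₃_eq hc0, ncard_typeSet_fixed hn hm]
  have h := card_fixedSet (d := d) (k := k) (l := l) c (fun _ _ => True) (fun _ _ => True)
  rw [ncard_wordSet_of_not_dvd hc, zero_mul, mul_zero] at h
  exact (mul_eq_zero.1 h).resolve_left hc0.ne'

lemma ncard_ANC_fixed {d k l : ℕ} [NeZero d] [NeZero k] [NeZero l] (hn : n = d * k)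
    (hm : m = d * l) :
    2 * (k + l) * {π | π ∈ ANC n m ∧ turn (Fin.ofNat n k) (-Fin.ofNat m l) π = π}.ncard =
      d * (k * l * ((2 * k).choose k * (2 * l).choose l)) := by
  have hd := Nat.pos_of_neZero d
  have hK : ∀ π : Perm (Pt n m), (connCycles π).card < d * (n + m + 1) := fun π =>
    calc _ < n + m + 1 := Nat.lt_succ_of_le (card_connCycles_le π)
      _ ≤ _ := Nat.le_mul_of_pos_left _ hd
  have hkn : k ≤ n := by rw [hn]; exact Nat.le_mul_of_pos_left _ hd
  rw [ncard_eq_sum_ncard_fiber (Set.toFinite _) (fun π => (connCycles π).card)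
    (N := d * (n + m + 1)) fun π _ => hK π]
  have h1 : ∀ c, {π | π ∈ {π | π ∈ ANC n m ∧ turn (Fin.ofNat n k) (-Fin.ofNat m l) π = π} ∧
      (connCycles π).card = c} =
      {π | π ∈ ANC₃ n m c ∧ turn (Fin.ofNat n k) (-Fin.ofNat m l) π = π} := by
    intro c
    ext π
    simp only [ANC₃, Set.mem_ofPred_eq]
    tauto
  simp only [h1]
  have h2 : (Finset.range (n + m + 1)).image (d * ·) ⊆ Finset.range (d * (n + m + 1)) := by
    intro c hc
    obtain ⟨c', hc', rfl⟩ := Finset.mem_image.1 hc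
    rw [Finset.mem_range] at hc' ⊢
    exact Nat.mul_lt_mul_of_pos_left hc' hd
  rw [← Finset.sum_subset h2, Finset.sum_image fun a _ b _ h => Nat.eq_of_mul_eq_mul_left hd h]
  · simp only [ncard_ANC₃_fixed hn hm]
    rw [← Finset.mul_sum, ← sum_mul_choose_mul_choose k l (n + m + 1) (by omega)]
    ring
  · intro c hc hc'
    refine ncard_ANC₃_fixed_of_not_dvd hn hm fun hdvd => hc' ?_
    obtain ⟨c', rfl⟩ := hdvd
    rw [Finset.mem_range] at hc
    exact Finset.mem_image_of_mem _ (Finset.mem_range.2 (Nat.lt_of_mul_lt_mul_left hc))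

lemma ANC_turn (s : Fin n) (t : Fin m) {π : Perm (Pt n m)} (h : π ∈ ANC n m) :
    turn s t π ∈ ANC n m := by
  refine ⟨(isAnnularNoncrossing_turn s t).2 h.1, ?_⟩
  rw [← Finset.card_pos, card_connCycles_turn, Finset.card_pos]
  exact h.2

lemma one_le_ordBinom_central {d a : ℕ} (hd : 0 < d) (h : d ≤ 2 * (a % d)) :
    1 ≤ ordBinom d (2 * a) a := by
  have h1 := Nat.div_add_mod a d
  unfold ordBinom
  rw [show 2 * a - a = a by omega]
  have : 2 * (a / d) + 1 ≤ 2 * a / d := by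
    rw [Nat.le_div_iff_mul_le hd]
    nlinarith
  omega

/-- The order at `ζ` decides that the function is a polynomial: where `1 - q ^ (m + n)` vanishes,
either `1 - q ^ (n * m)` or one of the two central binomial coefficients vanishes too. Its values are
those of the telescoping sum over the number of connected cycles. -/
theorem exhibitsCSP_Cat : ExhibitsCSP (rotationGroup n m) (ANC n m) (Cat n m) := by
  have hn := Nat.pos_of_neZero n
  have hm := Nat.pos_of_neZero m
  have hCat : Cat n m = (1 - q ^ (n * m)) / (1 - q ^ (m + n)) / 2 *
      (qBinom (2 * n : ℕ) n * qBinom (2 * m : ℕ) m) := by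
    have hu := pow_one q ▸ one_sub_q_ne_zero
    have e : qNum (n * m) / (2 * qNum (m + n)) = (1 - q ^ (n * m)) / (1 - q ^ (m + n)) / 2 := by
      rw [qNum, qNum]
      by_cases h0 : 1 - q ^ (m + n) = 0
      · simp [h0]
      · field_simp
    rw [Cat, e]
    push_cast
    ring
  have htwo : ∀ ζ, HasLead ζ 2 0 2 := by
    intro ζ
    have h3 := HasLead.of_polynomial (ζ := ζ) (p := 2) (by simp)
    have h4 : algebraMap (Polynomial ℂ) (RatFunc ℂ) 2 = 2 := map_ofNat _ 2
    rw [h4, Polynomial.eval_ofNat] at h3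
    exact h3
  have hlead : ∀ ζ, HasLead ζ (Cat n m) (ordDvd (orderOf ζ) (n * m) - ordDvd (orderOf ζ) (m + n) - 0 +
      (ordBinom (orderOf ζ) (2 * n) n + ordBinom (orderOf ζ) (2 * m) m)) _ := fun ζ => by
    rw [hCat]
    exact (((hasLead_one_sub ζ (Nat.mul_pos hn hm)).div (hasLead_one_sub ζ (by omega))).div
      (htwo ζ)).mul ((hasLead_qBinom ζ (by omega)).mul (hasLead_qBinom ζ (by omega)))
  obtain ⟨p, hp⟩ := exists_polynomial_of_hasLead (f := Cat n m) fun ζ => by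
    refine ⟨_, _, ?_, hlead ζ⟩
    have o1 := ordBinom_nonneg (orderOf ζ) (show n ≤ 2 * n by omega)
    have o2 := ordBinom_nonneg (orderOf ζ) (show m ≤ 2 * m by omega)
    have o3 := ordDvd_nonneg (orderOf ζ) (n * m)
    by_cases h : orderOf ζ ∣ m + n
    · rw [ordDvd_of_dvd h]
      by_cases hdn : orderOf ζ ∣ n
      · rw [ordDvd_of_dvd (hdn.mul_right m)]
        omega
      -- the residues of `n` and `m` add up to `d`, so that one of them is at least `d / 2`
      · have hd : 0 < orderOf ζ := Nat.pos_of_ne_zero fun h0 => by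
          rw [h0, zero_dvd_iff] at h; omega
        have h1 : 0 < n % orderOf ζ :=
          Nat.pos_of_ne_zero fun h0 => hdn (Nat.dvd_of_mod_eq_zero h0)
        have h2 : orderOf ζ ∣ m % orderOf ζ + n % orderOf ζ := by
          rw [Nat.dvd_iff_mod_eq_zero, ← Nat.add_mod]
          exact Nat.mod_eq_zero_of_dvd h
        have h3 := Nat.le_of_dvd (by omega) h2
        rcases le_total (m % orderOf ζ) (n % orderOf ζ) with h4 | h4
        · have := one_le_ordBinom_central (a := n) hd (by omega)
          omega
        · have := one_le_ordBinom_central (a := m) hd (by omega)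
          omega
    · rw [ordDvd_of_not_dvd h]
      omega
  refine exhibitsCSP_of_eval (fun s t π h => ANC_turn s t h) hp ?_
  intro d k l _ _ _ ζ hζ hnk hml
  have hd : 0 < orderOf ζ := hζ ▸ Nat.pos_of_neZero d
  have hcount := congrArg (Nat.cast : ℕ → ℂ) (ncard_ANC_fixed hnk hml)
  have d1 : orderOf ζ ∣ n := hζ ▸ ⟨k, hnk⟩
  have d2 : orderOf ζ ∣ m := hζ ▸ ⟨l, hml⟩
  have l1 := hasLead_qBinom_of_dvd hd (show k ≤ 2 * k by omega)
  have l2 := hasLead_qBinom_of_dvd hd (show l ≤ 2 * l by omega)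
  rw [Nat.mul_left_comm, hζ, ← hnk] at l1
  rw [Nat.mul_left_comm, hζ, ← hml] at l2
  have l3 := (((hasLead_one_sub ζ (Nat.mul_pos hn hm)).div
    (hasLead_one_sub ζ (Nat.add_pos_left hm n))).div (htwo ζ)).mul (l1.mul l2)
  rw [ordDvd_of_dvd (d1.mul_right m), ordDvd_of_dvd (d2.add d1), leadNum, leadNum,
    if_pos (d1.mul_right m), if_pos (d2.add d1), ← hCat, ← hp] at l3
  rw [(l3.congr (by ring) rfl).eval_eq]
  have hz := ne_zero_of_orderOf_pos hd
  have z1 : ((m + n : ℕ) : ℂ) ≠ 0 := by exact_mod_cast (by omega : m + n ≠ 0)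
  have z2 : (2 * (k + l) : ℂ) ≠ 0 := by
    have := Nat.pos_of_neZero k
    exact_mod_cast (by omega : 2 * (k + l) ≠ 0)
  have z3 : (d : ℂ) ≠ 0 := by exact_mod_cast NeZero.ne d
  apply mul_left_cancel₀ z2
  push_cast at hcount
  rw [hcount]
  have e1 : (n : ℂ) = d * k := by exact_mod_cast hnk
  have e2 : (m : ℂ) = d * l := by exact_mod_cast hml
  push_cast at z1 ⊢
  rw [e1, e2] at z1 ⊢
  rw [← mul_add] at z1 ⊢
  have z4 := right_ne_zero_of_mul z1
  field_simp
  ring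

end catalan
end AnnularCSP
end

theorem mainTheorem1 (n m : ℕ) (hn : 0 < n) (hm : 0 < m) :
    (∀ (c r s R S : ℕ), 1 ≤ c → R ≤ n → S ≤ m →
      ∀ (α : R.Partition) (β : S.Partition) (lam : (n - R).Partition) (mu : (m - S).Partition),
        α.parts.card = r → β.parts.card = s → lam.parts.card = c → mu.parts.card = c →
        ExhibitsCSP (rotationGroup n m) (ANCtype n m α β lam mu)
          (Kre n m c r s R S α.parts β.parts lam.parts mu.parts)) ∧
    (∀ c r s R S : ℕ,
      ExhibitsCSP (rotationGroup n m) (ANC₁ n m c r s R S) (Nara₁ n m c r s R S)) ∧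
    (∀ c r s : ℕ, ExhibitsCSP (rotationGroup n m) (ANC₂ n m c r s) (Nara₂ n m c r s)) ∧
    (∀ c : ℕ, ExhibitsCSP (rotationGroup n m) (ANC₃ n m c) (Nara₃ n m c)) ∧
    ExhibitsCSP (rotationGroup n m) (ANC n m) (Cat n m) := by
  have : NeZero n := ⟨hn.ne'⟩
  have : NeZero m := ⟨hm.ne'⟩
  exact ⟨fun _ _ _ _ _ hc hR hS α β lam mu hα hβ hlam hmu =>
      exhibitsCSP_Kre hc hR hS α β lam mu hα hβ hlam hmu,
    exhibitsCSP_Nara₁, exhibitsCSP_Nara₂, exhibitsCSP_Nara₃, exhibitsCSP_Cat⟩
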